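/- Let $m\in\mathbb N$, let $X=C((-\infty,0],\mathbb R^m)$ with the compact-open topology, metrized by $$\mathsf d(x,y)=\sum_{n\ge1}2^{-n}\frac{\|x-y\|_n}{1+\|x-y\|_n},\qquad \|x\|_n=\sup_{s\in[-n,0]}\|x(s)\|,$$ ($\|\cdot\|$ the maximum norm of $\mathbb R^m$), let $BU\subset X$ be the Banach space of bounded uniformly continuous functions with the supremum norm, and $B_k=\{x\in BU:\|x\|_\infty\le k\}$. Let $(\Omega,\sigma,\mathbb R)$, $\sigma(t,\omega)=\omega\cdot t$, be a minimal continuous flow on a compact metric space. Let $$Dx=x(0)-\int_{(-\infty,0]}[d\nu(s)]\,x(s),\qquad x\in BU,$$ where $\nu=[\nu_{ij}]$ is an $m\times m$ matrix of finite positive Borel measures with $\nu_{ij}(\{0\})=0$. Let $A$ be a quasipositive real $m\times m$ matrix, i.e. $A+\lambda I\ge0$ entrywise for some $\lambda>0$. For $x,y\in BU$ and $r\ge0$ write $x\le_{A,r}y$ if $x(s)\le y(s)$ for all $s\le 0$ and $y(t)-x(t)\ge e^{A(t-s)}(y(s)-x(s))$ whenever $-r\le s\le t\le0$; write $x\le_{A,\infty}y$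 if $x(s)\le y(s)$ for all $s\le 0$ and the last inequality holds whenever $s\le t\le0$. Assume one of the following: * Case I: $\nu=0$ and $\le_A$ is $\le_{A,r}$ for some $r\ge0$; * Case II: $\nu=0$, all the eigenvalues of $A$ have strictly negative real part, and $\le_A$ is $\le_{A,\infty}$; * Case III: all the eigenvalues of $A$ have strictly negative real part, $\le_A$ is $\le_{A,\infty}$, and $D$ is stable, i.e. there is a continuous $c:[0,\infty)\to[0,\infty)$ with $c(t)\to0$ as $t\to\infty$ such that, for each $\varphi\in BU$ with $D\varphi=0$, the solution of $Dx_t=0$ $(t\ge0)$, $x_0=\varphi$, satisfies $\|x(t)\|\le c(t)\|\varphi\|_\infty$ for $t\ge0$. Here $x_t(s)=x(t+s)$ for $s\le0$. Let $F:\Omega\times BU\to\mathbb R^m$ satisfy: * (F1) $F$ is continuous, and locally Lipschitz in $x$, for the norm $\|\cdot\|_\infty$ (each point of $\Omega\times BU$ has a neighbourhood on which $F$ is Lipschitz in $x$ with a constant independent of $\omega$); * (F2) $F(\Omega\times B_k)$ is bounded for each $k>0$; * (F3) for each $k>0$, $F$ is continuous on $\Omega\times B_k$ when $B_k$ carries the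 compact-open topology; * (F4) if $x\le_A y$, then $F(\omega,y)-F(\omega,x)\ge A(Dy-Dx)$ for all $\omega\in\Omega$. Let $\tau(t,\omega,x)=(\omega\cdot t,u(t,\omega,x))$ be the local skew-product semiflow on $\Omega\times BU$ induced by $\frac{d}{dt}Dz_t=F(\omega\cdot t,z_t)$, $t\ge0$, that is, $u(t,\omega,x)=z_t$ for the solution $z$ with $z_0=x$. Let $(\omega_0,x_0)\in\Omega\times BU$ have a forward orbit $\{\tau(t,\omega_0,x_0):t\ge0\}$ that is defined for all $t\ge 0$, is relatively compact in $\Omega\times X$, and is uniformly stable for $\le_A$ in bounded sets: for all $k,\varepsilon>0$ there is $\delta>0$ such that, if $s\ge0$, $x\in B_k$, $\mathsf d(u(s,\omega_0,x_0),x)\le\delta$, and $x\le_A u(s,\omega_0,x_0)$ or $u(s,\omega_0,x_0)\le_A x$, then for all $t\ge0$ $u(t,\omega_0\cdot s,x)$ is defined and $\mathsf d(u(t+s,\omega_0,x_0),u(t,\omega_0\cdot s,x))\le\varepsilon$. Let $$K=\{(\omega,x)\in\Omega\times BU:\ \exists\, t_n\to\infty,\ \omega_0\cdot t_n\to\omega,\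 \mathsf d(u(t_n,\omega_0,x_0),x)\to0\}$$ be the omega-limit set of $(\omega_0,x_0)$. Then $K$ is compact in $\Omega\times X$ and positively $\tau$-invariant (its orbits are defined for all $t\ge 0$ and stay in $K$), and: 1. $K$ is uniformly stable for $\le_A$ in bounded sets: for all $k,\varepsilon>0$ there is $\delta>0$ such that, if $(\omega,x)\in K$, $y\in B_k$, $\mathsf d(x,y)<\delta$, and $x\le_A y$ or $y\le_A x$, then for all $t\ge0$ $u(t,\omega,y)$ is defined and $\mathsf d(u(t,\omega,x),u(t,\omega,y))\le\varepsilon$. 2. $(K,\tau,\mathbb R^+)$ is uniformly stable: for every $\varepsilon>0$ there is $\delta>0$ such that, if $(\omega,x),(\omega,y)\in K$ and $\mathsf d(x,y)<\delta$, then $\mathsf d(u(t,\omega,x),u(t,\omega,y))\le\varepsilon$ for all $t\ge0$. -/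

import Mathlib

open Set Filter Topology MeasureTheory
open scoped NNReal BoundedContinuousFunction

noncomputable section

namespace ExpOrdering

/-- The half-line `(-∞, 0]`. -/
abbrev Past : Type := Set.Iic (0 : ℝ)

/-- The point `0` of the half-line `(-∞, 0]`. -/
def now : Past := ⟨0, le_refl (0 : ℝ)⟩

/-- The Fréchet space `X = C((-∞,0], ℝ^m)`; Mathlib's topology on it is the compact-open one.
The space `Fin m → ℝ` carries the maximum norm and the componentwise order. -/
abbrev X (m : ℕ) : Type := C(Past, Fin m → ℝ)

/-- `‖x‖_n = sup_{s ∈ [-n,0]} ‖x(s)‖`. -/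
def seminormOn {m : ℕ} (n : ℕ) (x : X m) : ℝ :=
  ⨆ s : {s : Past // -(n : ℝ) ≤ (s : ℝ)}, ‖x s.1‖

/-- The metric `d(x,y) = ∑_{n ≥ 1} 2^{-n} ‖x-y‖_n / (1 + ‖x-y‖_n)` of the compact-open topology
(the index is shifted by one). -/
def dX {m : ℕ} (x y : X m) : ℝ :=
  ∑' n : ℕ, (1 / 2 : ℝ) ^ (n + 1) *
    (seminormOn (n + 1) (x - y) / (1 + seminormOn (n + 1) (x - y)))

/-- The Banach space of bounded uniformly continuous functions `(-∞,0] → ℝ^m`, with the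
supremum norm. -/
def BU (m : ℕ) : Submodule ℝ (Past →ᵇ (Fin m → ℝ)) where
  carrier := {x | UniformContinuous x}
  add_mem' := fun {_ _} hx hy => UniformContinuous.add hx hy
  zero_mem' := uniformContinuous_const
  smul_mem' := fun c _ hx => UniformContinuous.const_smul hx c

/-- An element of `BU`, seen in the space `X` with the compact-open topology. -/
def toX {m : ℕ} (x : BU m) : X m := x.1.toContinuousMap

/-- The distance `d` between two elements of `BU`. -/
def di {m : ℕ} (x y : BU m) : ℝ := dX (toX x) (toX y)

/-- `B_k = {x ∈ BU : ‖x‖_∞ ≤ k}`. -/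
def B (m : ℕ) (k : ℝ) : Set (BU m) := {x | ‖x‖ ≤ k}

/-- `v` is the history `z_t` of `z` at time `t`, i.e. `v(s) = z(t+s)` for `s ≤ 0`. -/
def IsHistory {m : ℕ} (z : ℝ → Fin m → ℝ) (t : ℝ) (v : BU m) : Prop :=
  ∀ s : Past, v.1 s = z (t + (s : ℝ))

/-- The neutral operator `D x = x(0) - ∫_{(-∞,0]} [dν(s)] x(s)`, for an `m × m` matrix `ν` of
finite positive Borel measures on `(-∞,0]`. -/
def neutralOp {m : ℕ} (ν : Fin m → Fin m → FiniteMeasure Past) (x : BU m) : Fin m → ℝ :=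
  fun i => x.1 now i - ∑ j, ∫ s, x.1 s j ∂(ν i j : Measure Past)

/-- Stability of `D`: the solutions of the difference equation `D x_t = 0`, `t ≥ 0`, `x_0 = φ`
decay uniformly, at a rate `c(t) → 0`. -/
def StableOp {m : ℕ} (ν : Fin m → Fin m → FiniteMeasure Past) : Prop :=
  ∃ c : ℝ → ℝ, ContinuousOn c (Ici 0) ∧ (∀ t, 0 ≤ t → 0 ≤ c t) ∧ Tendsto c atTop (𝓝 0) ∧
    ∀ (φ : BU m) (z : ℝ → Fin m → ℝ) (v : ℝ → BU m), neutralOp ν φ = 0 →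
      v 0 = φ → (∀ t, 0 ≤ t → IsHistory z t (v t)) → (∀ t, 0 ≤ t → neutralOp ν (v t) = 0) →
      ∀ t, 0 ≤ t → ‖z t‖ ≤ c t * ‖φ‖

/-- A flow is minimal if the only nonempty compact positively invariant set is the whole space. -/
def IsMinimalFlow {Ω : Type*} [TopologicalSpace Ω] (σ : Flow ℝ Ω) : Prop :=
  ∀ M : Set Ω, M.Nonempty → IsCompact M → IsForwardInvariant σ M → M = univ

/-- `A` is quasipositive: `A + λ I ≥ 0` entrywise, for some `λ > 0`. -/
def Quasipositive {m : ℕ} (A : Matrix (Fin m) (Fin m) ℝ) : Prop :=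
  ∃ l : ℝ, 0 < l ∧ ∀ i j, 0 ≤ (A + l • (1 : Matrix (Fin m) (Fin m) ℝ)) i j

/-- All the (complex) eigenvalues of `A` have strictly negative real part. -/
def EigenvaluesNeg {m : ℕ} (A : Matrix (Fin m) (Fin m) ℝ) : Prop :=
  ∀ z : ℂ, Module.End.HasEigenvalue (Matrix.toLin' (A.map (algebraMap ℝ ℂ))) z → z.re < 0

/-- The exponential ordering `≤_{A,r}`. -/
def leR {m : ℕ} (A : Matrix (Fin m) (Fin m) ℝ) (r : ℝ) (x y : BU m) : Prop :=
  (∀ s : Past, x.1 s ≤ y.1 s) ∧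
    ∀ s t : Past, -r ≤ (s : ℝ) → s ≤ t →
      (NormedSpace.exp (((t : ℝ) - (s : ℝ)) • A)).mulVec (y.1 s - x.1 s) ≤ y.1 t - x.1 t

/-- The exponential ordering `≤_{A,∞}`. -/
def leInf {m : ℕ} (A : Matrix (Fin m) (Fin m) ℝ) (x y : BU m) : Prop :=
  (∀ s : Past, x.1 s ≤ y.1 s) ∧
    ∀ s t : Past, s ≤ t →
      (NormedSpace.exp (((t : ℝ) - (s : ℝ)) • A)).mulVec (y.1 s - x.1 s) ≤ y.1 t - x.1 t

/-- The three cases: (I) delay equations (`ν = 0`) with an order `≤_{A,r}`; (II) delay equations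
with the order `≤_{A,∞}`, the eigenvalues of `A` having negative real parts; (III) neutral
equations with stable operator and the order `≤_{A,∞}`, with the same condition on `A`. -/
def AdmissibleCase {m : ℕ} (A : Matrix (Fin m) (Fin m) ℝ)
    (ν : Fin m → Fin m → FiniteMeasure Past) (le : BU m → BU m → Prop) : Prop :=
  ((∀ i j, ν i j = 0) ∧ ∃ r : ℝ, 0 ≤ r ∧ le = leR A r) ∨
  ((∀ i j, ν i j = 0) ∧ EigenvaluesNeg A ∧ le = leInf A) ∨
  (StableOp ν ∧ EigenvaluesNeg A ∧ le = leInf A)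

section System

variable {Ω : Type*} [MetricSpace Ω] {m : ℕ}

/-- `F` is continuous on `Ω × BU` and locally Lipschitz in `x`, for the norm of `BU`. -/
def HypF1 (F : Ω → BU m → Fin m → ℝ) : Prop :=
  Continuous (fun p : Ω × BU m => F p.1 p.2) ∧
    ∀ p : Ω × BU m, ∃ U ∈ 𝓝 p, ∃ L : ℝ, ∀ (ω : Ω) (x y : BU m), (ω, x) ∈ U → (ω, y) ∈ U →
      ‖F ω x - F ω y‖ ≤ L * ‖x - y‖

/-- `F` maps each `Ω × B_k` to a bounded set. -/
def HypF2 (F : Ω → BU m → Fin m → ℝ) : Prop :=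
  ∀ k : ℝ, 0 < k → ∃ C : ℝ, ∀ (ω : Ω), ∀ x ∈ B m k, ‖F ω x‖ ≤ C

/-- `F` is continuous on each `Ω × B_k` for the compact-open topology on `B_k`. -/
def HypF3 (F : Ω → BU m → Fin m → ℝ) : Prop :=
  ∀ k : ℝ, 0 < k → ∀ (ωn : ℕ → Ω) (ω : Ω) (xn : ℕ → BU m) (x : BU m),
    (∀ n, xn n ∈ B m k) → x ∈ B m k → Tendsto ωn atTop (𝓝 ω) →
    Tendsto (fun n => toX (xn n)) atTop (𝓝 (toX x)) →
    Tendsto (fun n => F (ωn n) (xn n)) atTop (𝓝 (F ω x))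

/-- Quasimonotonicity: `x ≤_A y` implies `F(ω,y) - F(ω,x) ≥ A (Dy - Dx)`. -/
def HypF4 (A : Matrix (Fin m) (Fin m) ℝ) (ν : Fin m → Fin m → FiniteMeasure Past)
    (le : BU m → BU m → Prop) (F : Ω → BU m → Fin m → ℝ) : Prop :=
  ∀ (ω : Ω) (x y : BU m), le x y →
    A.mulVec (neutralOp ν y - neutralOp ν x) ≤ F ω y - F ω x

/-- `z` solves `(d/dt) D z_t = F(ω·t, z_t)` on `[0,T]` with `z_0 = x`; here `v t = z_t`.
The derivative is one-sided at the end points. -/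
structure IsSolution (σ : Flow ℝ Ω) (ν : Fin m → Fin m → FiniteMeasure Past)
    (F : Ω → BU m → Fin m → ℝ) (ω : Ω) (x : BU m) (T : ℝ)
    (z : ℝ → Fin m → ℝ) (v : ℝ → BU m) : Prop where
  init : IsHistory z 0 x
  history : ∀ t ∈ Icc 0 T, IsHistory z t (v t)
  deriv : ∀ t ∈ Icc 0 T,
    HasDerivWithinAt (fun τ => neutralOp ν (v τ)) (F (σ t ω) (v t)) (Icc 0 T) t

/-- The solution starting at `(ω,x)` exists up to time `t`, i.e. `u(t,ω,x)` is defined. -/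
def Defined (σ : Flow ℝ Ω) (ν : Fin m → Fin m → FiniteMeasure Past)
    (F : Ω → BU m → Fin m → ℝ) (t : ℝ) (ω : Ω) (x : BU m) : Prop :=
  0 ≤ t ∧ ∃ v : ℝ → BU m, ∃ z : ℝ → Fin m → ℝ, IsSolution σ ν F ω x t z v

open Classical in
/-- The second component `u(t,ω,x) = z_t` of the local skew-product semiflow
`τ(t,ω,x) = (ω·t, u(t,ω,x))` (with value `0` where it is not defined). -/
def u (σ : Flow ℝ Ω) (ν : Fin m → Fin m → FiniteMeasure Past)
    (F : Ω → BU m → Fin m → ℝ) (t : ℝ) (ω : Ω) (x : BU m) : BU m :=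
  if h : Defined σ ν F t ω x then h.2.choose t else 0

/-- The forward orbit of `(ω₀,x₀)` exists for all `t ≥ 0` and is relatively compact in `Ω × X`. -/
def RelativelyCompactOrbit (σ : Flow ℝ Ω) (ν : Fin m → Fin m → FiniteMeasure Past)
    (F : Ω → BU m → Fin m → ℝ) (ω₀ : Ω) (x₀ : BU m) : Prop :=
  (∀ t, 0 ≤ t → Defined σ ν F t ω₀ x₀) ∧
    IsCompact (closure {p : Ω × X m | ∃ t : ℝ, 0 ≤ t ∧ p = (σ t ω₀, toX (u σ ν F t ω₀ x₀))})

/-- The omega-limit set of `(ω₀,x₀)`, as a subset of `Ω × BU`. -/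
def omegaLimitSet (σ : Flow ℝ Ω) (ν : Fin m → Fin m → FiniteMeasure Past)
    (F : Ω → BU m → Fin m → ℝ) (ω₀ : Ω) (x₀ : BU m) : Set (Ω × BU m) :=
  {p | ∃ tn : ℕ → ℝ, Tendsto tn atTop atTop ∧
    Tendsto (fun n => σ (tn n) ω₀) atTop (𝓝 p.1) ∧
    Tendsto (fun n => toX (u σ ν F (tn n) ω₀ x₀)) atTop (𝓝 (toX p.2))}

/-- `K` is positively invariant: orbits starting in `K` exist for all `t ≥ 0` and stay in `K`. -/
def PositivelyInvariant (σ : Flow ℝ Ω) (ν : Fin m → Fin m → FiniteMeasure Past)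
    (F : Ω → BU m → Fin m → ℝ) (K : Set (Ω × BU m)) : Prop :=
  ∀ p ∈ K, ∀ t, 0 ≤ t → Defined σ ν F t p.1 p.2 ∧ (σ t p.1, u σ ν F t p.1 p.2) ∈ K

/-- The forward orbit of `(ω₀,x₀)` is uniformly stable for the order `le` in bounded sets. -/
def OrbitStableForOrder (σ : Flow ℝ Ω) (ν : Fin m → Fin m → FiniteMeasure Past)
    (F : Ω → BU m → Fin m → ℝ) (le : BU m → BU m → Prop) (ω₀ : Ω) (x₀ : BU m) : Prop :=
  ∀ k : ℝ, 0 < k → ∀ ε : ℝ, 0 < ε → ∃ δ : ℝ, 0 < δ ∧ ∀ s : ℝ, 0 ≤ s → ∀ x ∈ B m k,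
    di (u σ ν F s ω₀ x₀) x ≤ δ → (le x (u σ ν F s ω₀ x₀) ∨ le (u σ ν F s ω₀ x₀) x) →
    ∀ t : ℝ, 0 ≤ t → Defined σ ν F t (σ s ω₀) x ∧
      di (u σ ν F (t + s) ω₀ x₀) (u σ ν F t (σ s ω₀) x) ≤ ε

/-- The positively invariant set `K` is uniformly stable for the order `le` in bounded sets. -/
def SetStableForOrder (σ : Flow ℝ Ω) (ν : Fin m → Fin m → FiniteMeasure Past)
    (F : Ω → BU m → Fin m → ℝ) (le : BU m → BU m → Prop) (K : Set (Ω × BU m)) : Prop :=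
  PositivelyInvariant σ ν F K ∧
    ∀ k : ℝ, 0 < k → ∀ ε : ℝ, 0 < ε → ∃ δ : ℝ, 0 < δ ∧
      ∀ (ω : Ω) (x y : BU m), (ω, x) ∈ K → y ∈ B m k → di x y < δ → (le x y ∨ le y x) →
      ∀ t : ℝ, 0 ≤ t → Defined σ ν F t ω y ∧ di (u σ ν F t ω x) (u σ ν F t ω y) ≤ ε

/-- `K` is a compact (in `Ω × X`) positively invariant set and the restriction of the semiflow
to `K` is uniformly stable. -/
def UniformlyStable (σ : Flow ℝ Ω) (ν : Fin m → Fin m → FiniteMeasure Past)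
    (F : Ω → BU m → Fin m → ℝ) (K : Set (Ω × BU m)) : Prop :=
  IsCompact ((fun p : Ω × BU m => (p.1, toX p.2)) '' K) ∧ PositivelyInvariant σ ν F K ∧
    ∀ ε : ℝ, 0 < ε → ∃ δ : ℝ, 0 < δ ∧
      ∀ (ω : Ω) (x y : BU m), (ω, x) ∈ K → (ω, y) ∈ K → di x y < δ →
      ∀ t : ℝ, 0 ≤ t → di (u σ ν F t ω x) (u σ ν F t ω y) ≤ ε

end System

end ExpOrdering

end

open Set Filter Topology MeasureTheory
open scoped NNReal BoundedContinuousFunction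

noncomputable section

namespace ExpOrdering

/-! ### Elements of `BU` as functions on the line -/

/-! Part 1 passes order stability from the orbit `U` to its limits. If `U(t_n)` tends to `x` and `y`
is comparable to `x`, then `U(t_n) + (y - x)` is comparable to `U(t_n)` and just as close to it,
because the order and the metric depend only on differences. The solutions from these points stay
near the orbit. They are bounded and equicontinuous (`equiUC_of_sol`), so a subsequence converges;
the limit solves the equation from `y` (`sol_of_tendsto`), and uniqueness (`Sol.unique`) identifies
it with `u`. Existence on `K` and near `K` thus comes from compactness, not from a local existence
theorem.

Part 2 follows from part 1 once two nearby points `x`, `y` of `K` over the same `ω` have a common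
upper bound `z = x + w` that is bounded and close to both: compare `x` with `z` and `y` with `z`.
For the exponential order, `w` must dominate `h = x - y` together with its rate of change, so `h`
must have a small Lipschitz constant on a long interval. Points of `K` are their own backward
solutions (`IsOrbit.backward`), so increments of `D` along `h` are integrals of differences of `F`.
These are small on a long window by compactness (`IsOrbit.exists_rhs_close`). Stability of `D` turns
bounds on `D` into bounds on `h` (`StableOp.estimate`, `IsOrbit.exists_small_lipschitz`).

The function `w` is explicit (`Dominating`). For `≤_{A,r}` it is an amplitude times a fast
exponential on `[-r,0]`. For `≤_{A,∞}` it is a slowly decreasing logistic function times a positive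
vector `p` with every component of `A p` equal to `-1`; such a `p` exists because `A` is
quasipositive with eigenvalues of negative real part (`Quasipositive.exists_pos`). -/

/-- The point `min t 0` of the half-line. -/
def clamp (t : ℝ) : Past := ⟨min t 0, min_le_right t 0⟩

/-- The value of `x ∈ BU` at `t`, extended by the constant `x(0)` for `t ≥ 0`. -/
def ev {m : ℕ} (x : BU m) (t : ℝ) : Fin m → ℝ := x.1 (clamp t)

section Basics

variable {m : ℕ}

lemma clamp_coe (s : Past) : clamp (s : ℝ) = s := by
  apply Subtype.ext
  exact min_eq_left s.2

lemma ev_coe (x : BU m) (s : Past) : ev x (s : ℝ) = x.1 s := by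
  rw [ev, clamp_coe]

lemma ev_mk (x : BU m) {t : ℝ} (ht : t ≤ 0) : x.1 ⟨t, ht⟩ = ev x t :=
  (ev_coe x ⟨t, ht⟩).symm

lemma ev_now (x : BU m) : x.1 now = ev x 0 := ev_mk x le_rfl

lemma ev_add (x y : BU m) (t : ℝ) : ev (x + y) t = ev x t + ev y t := rfl
lemma ev_sub (x y : BU m) (t : ℝ) : ev (x - y) t = ev x t - ev y t := rfl
lemma ev_zero (t : ℝ) : ev (0 : BU m) t = 0 := rfl

lemma BU_ext {x y : BU m} (h : ∀ s : ℝ, s ≤ 0 → ev x s = ev y s) : x = y := by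
  apply Subtype.ext
  ext1 s
  rw [← ev_coe, ← ev_coe, h s s.2]

lemma uniformContinuous_clamp : UniformContinuous clamp := by
  apply UniformContinuous.subtype_mk
  exact (LipschitzWith.id.min_const 0).uniformContinuous

lemma uniformContinuous_ev (x : BU m) : UniformContinuous (ev x) :=
  UniformContinuous.comp (show UniformContinuous x.1 from x.2) uniformContinuous_clamp

lemma continuous_ev (x : BU m) : Continuous (ev x) := (uniformContinuous_ev x).continuous

lemma norm_ev_le (x : BU m) (t : ℝ) : ‖ev x t‖ ≤ ‖x‖ := x.1.norm_coe_le_norm _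

lemma norm_le_of_ev {x : BU m} {c : ℝ} (hc : 0 ≤ c) (h : ∀ s : ℝ, s ≤ 0 → ‖ev x s‖ ≤ c) :
    ‖x‖ ≤ c := by
  refine (BoundedContinuousFunction.norm_le hc).2 fun s => ?_
  have := h s s.2
  rwa [ev_coe] at this

lemma BU_norm_nonneg (x : BU m) : 0 ≤ ‖x‖ := norm_nonneg x

lemma continuous_norm_BU : Continuous fun x : BU m => ‖x‖ :=
  continuous_norm.comp continuous_subtype_val

lemma BU_norm_zero : ‖(0 : BU m)‖ = 0 :=
  le_antisymm (norm_le_of_ev le_rfl fun s _ => by simp [ev_zero]) (BU_norm_nonneg _)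

lemma BU_sub_self (x : BU m) : x - x = 0 := sub_self x

lemma BU_eq_of_norm_sub_le {x y : BU m} (h : ‖x - y‖ ≤ 0) : x = y :=
  sub_eq_zero.1 (norm_le_zero_iff.1 h)

lemma dist_BU (x y : BU m) : dist x y = ‖x - y‖ := dist_eq_norm x y

/-- The element of `BU` given by a bounded function, uniformly continuous on `(-∞, 0]`. -/
def mkBU (f : ℝ → Fin m → ℝ) (hf : UniformContinuous fun s : Past => f s) (C : ℝ)
    (hC : ∀ s : ℝ, s ≤ 0 → ‖f s‖ ≤ C) : BU m :=
  ⟨BoundedContinuousFunction.ofNormedAddCommGroup (fun s : Past => f s) hf.continuous C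
    fun s => hC s s.2, hf⟩

lemma ev_mkBU {f : ℝ → Fin m → ℝ} {hf : UniformContinuous fun s : Past => f s} {C : ℝ}
    {hC : ∀ s : ℝ, s ≤ 0 → ‖f s‖ ≤ C} {t : ℝ} (ht : t ≤ 0) : ev (mkBU f hf C hC) t = f t := by
  rw [← ev_mk _ ht]
  rfl

/-- The translate `s ↦ x(s - r)`, for `r ≥ 0`. -/
def shift (r : ℝ) (x : BU m) : BU m :=
  -- The truncation `max r 0` makes `shift r` the identity for `r ≤ 0`, so that `r ↦ shift r x` is
  -- continuous on the whole line.
  mkBU (fun s => ev x (s - max r 0))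
    ((uniformContinuous_ev x).comp (uniformContinuous_subtype_val.sub uniformContinuous_const))
    ‖x‖ fun _ _ => norm_ev_le _ _

lemma ev_shift {r : ℝ} (hr : 0 ≤ r) (x : BU m) {s : ℝ} (hs : s ≤ 0) :
    ev (shift r x) s = ev x (s - r) := by
  rw [shift, ev_mkBU hs, max_eq_left hr]

lemma shift_of_nonpos {r : ℝ} (hr : r ≤ 0) (x : BU m) : shift r x = x := by
  apply BU_ext
  intro s hs
  rw [shift, ev_mkBU hs, max_eq_right hr, sub_zero]

lemma shift_max (r : ℝ) (x : BU m) : shift (max r 0) x = shift r x := by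
  apply BU_ext
  intro s hs
  rw [shift, shift, ev_mkBU hs, ev_mkBU hs]
  simp

lemma shift_zero (x : BU m) : shift 0 x = x := shift_of_nonpos le_rfl x

lemma shift_shift {r q : ℝ} (hr : 0 ≤ r) (hq : 0 ≤ q) (x : BU m) :
    shift r (shift q x) = shift (r + q) x := by
  apply BU_ext
  intro s hs
  rw [ev_shift hr _ hs, ev_shift hq _ (by linarith), ev_shift (by linarith) _ hs]
  congr 1
  ring

lemma shift_sub (r : ℝ) (x y : BU m) : shift r (x - y) = shift r x - shift r y := by
  apply BU_ext
  intro s hs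
  simp only [ev_sub, shift, ev_mkBU hs]

lemma norm_shift_le (r : ℝ) (x : BU m) : ‖shift r x‖ ≤ ‖x‖ := by
  refine norm_le_of_ev (norm_nonneg x) fun s hs => ?_
  rw [shift, ev_mkBU hs]
  exact norm_ev_le _ _

lemma ev_shift_zero {r : ℝ} (hr : 0 ≤ r) (x : BU m) : ev (shift r x) 0 = ev x (-r) := by
  rw [ev_shift hr x le_rfl, zero_sub]

/-- Uniform continuity of `x` gives continuity in the supremum norm. With (F1), the right-hand side
of the equation is then continuous in time along any history. -/
lemma continuous_shift (x : BU m) : Continuous fun r => shift r x := by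
  rw [Metric.continuous_iff]
  intro r ε hε
  obtain ⟨δ, hδ, h⟩ := Metric.uniformContinuous_iff.1 (uniformContinuous_ev x) (ε / 2) (by linarith)
  refine ⟨δ, hδ, fun q hq => ?_⟩
  rw [dist_BU]
  refine lt_of_le_of_lt (norm_le_of_ev (c := ε / 2) (by linarith) fun s hs => ?_) (by linarith)
  rw [ev_sub, shift, shift, ev_mkBU hs, ev_mkBU hs, ← dist_eq_norm]
  refine (h ?_).le
  rw [Real.dist_eq] at hq ⊢
  have : |max q 0 - max r 0| ≤ |q - r| := by
    simpa using abs_max_sub_max_le_abs q r 0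
  calc |s - max q 0 - (s - max r 0)| = |max q 0 - max r 0| := by
        rw [abs_sub_comm]; congr 1; ring
    _ < δ := by linarith

/-! ### The neutral operator -/

variable (ν : Fin m → Fin m → FiniteMeasure Past)

lemma integrable_ev (x : BU m) (i j : Fin m) :
    Integrable (fun s : Past => ev x s j) (ν i j : Measure Past) := by
  refine Integrable.of_bound (C := ‖x‖) ?_ ?_
  · exact (((continuous_apply j).comp (continuous_ev x)).comp
      continuous_subtype_val).aestronglyMeasurable
  · exact Eventually.of_forall fun s => (norm_le_pi_norm (ev x s) j).trans (norm_ev_le x s)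

lemma neutralOp_apply (x : BU m) (i : Fin m) :
    neutralOp ν x i = ev x 0 i - ∑ j, ∫ s : Past, ev x s j ∂(ν i j : Measure Past) := by
  simp only [neutralOp, ev_coe, ev_now]

lemma neutralOp_sub (x y : BU m) : neutralOp ν (x - y) = neutralOp ν x - neutralOp ν y := by
  funext i
  simp only [neutralOp_apply, Pi.sub_apply, ev_sub]
  have : ∀ j, ∫ s : Past, (ev x s j - ev y s j) ∂(ν i j : Measure Past)
      = ∫ s : Past, ev x s j ∂(ν i j : Measure Past)
        - ∫ s : Past, ev y s j ∂(ν i j : Measure Past) := fun j =>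
    integral_sub (integrable_ev ν x i j) (integrable_ev ν y i j)
  simp only [this, Finset.sum_sub_distrib]
  ring

/-- The total mass of the matrix of measures. -/
def mass : ℝ := ∑ i, ∑ j, (ν i j : Measure Past).real univ

lemma mass_nonneg : 0 ≤ mass ν :=
  Finset.sum_nonneg fun _ _ => Finset.sum_nonneg fun _ _ => measureReal_nonneg

lemma row_le_mass (i : Fin m) : ∑ j, (ν i j : Measure Past).real univ ≤ mass ν :=
  Finset.single_le_sum (f := fun i => ∑ j, (ν i j : Measure Past).real univ)
    (fun _ _ => Finset.sum_nonneg fun _ _ => measureReal_nonneg) (Finset.mem_univ i)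

lemma abs_sum_integral_le {c : ℝ} (hc : 0 ≤ c) (f : Past → Fin m → ℝ) (hf : ∀ s, ‖f s‖ ≤ c)
    (i : Fin m) : |∑ j, ∫ s : Past, f s j ∂(ν i j : Measure Past)| ≤ mass ν * c := by
  calc |∑ j, ∫ s : Past, f s j ∂(ν i j : Measure Past)|
      ≤ ∑ j, |∫ s : Past, f s j ∂(ν i j : Measure Past)| := Finset.abs_sum_le_sum_abs _ _
    _ ≤ ∑ j, c * (ν i j : Measure Past).real univ := by
        refine Finset.sum_le_sum fun j _ => ?_
        exact norm_integral_le_of_norm_le_const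
          (Eventually.of_forall fun s => (norm_le_pi_norm (f s) j).trans (hf s))
    _ = (∑ j, (ν i j : Measure Past).real univ) * c := by
        rw [← Finset.mul_sum, mul_comm]
    _ ≤ mass ν * c := mul_le_mul_of_nonneg_right (row_le_mass ν i) hc

lemma norm_neutralOp_le (x : BU m) : ‖neutralOp ν x‖ ≤ (1 + mass ν) * ‖x‖ := by
  have h0 := mass_nonneg ν
  refine (pi_norm_le_iff_of_nonneg (by positivity)).2 fun i => ?_
  rw [neutralOp_apply, Real.norm_eq_abs]
  have h1 := abs_sum_integral_le ν (norm_nonneg x) (fun s : Past => ev x s)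
    (fun s => norm_ev_le x s) i
  have h2 : |ev x 0 i| ≤ ‖x‖ := (norm_le_pi_norm (ev x 0) i).trans (norm_ev_le x 0)
  have h3 := abs_sub (ev x 0 i) (∑ j, ∫ s : Past, ev x s j ∂(ν i j : Measure Past))
  linarith

lemma continuous_neutralOp : Continuous (neutralOp ν) := by
  have h0 := mass_nonneg ν
  refine LipschitzWith.continuous (K := Real.toNNReal (1 + mass ν))
    (LipschitzWith.of_dist_le_mul fun x y => ?_)
  rw [Real.coe_toNNReal _ (by positivity)]
  rw [dist_BU, dist_eq_norm, ← neutralOp_sub]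
  exact norm_neutralOp_le ν _

/-- Dominated convergence with the constant `k`, the measures being finite. In particular `D` is
sequentially continuous on `B_k` for the compact-open topology. -/
lemma tendsto_neutralOp {k : ℝ} {xn : ℕ → BU m} {x : BU m} (hk : ∀ n, ‖xn n‖ ≤ k)
    (hx : ∀ s : ℝ, s ≤ 0 → Tendsto (fun n => ev (xn n) s) atTop (𝓝 (ev x s))) :
    Tendsto (fun n => neutralOp ν (xn n)) atTop (𝓝 (neutralOp ν x)) := by
  rw [tendsto_pi_nhds]
  intro i
  simp only [neutralOp_apply]
  refine Tendsto.sub ((tendsto_pi_nhds.1 (hx 0 le_rfl)) i) (tendsto_finsetSum _ fun j _ => ?_)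
  refine tendsto_integral_of_dominated_convergence (fun _ => k) ?_ (integrable_const k) ?_ ?_
  · exact fun n => (integrable_ev ν (xn n) i j).aestronglyMeasurable
  · exact fun n => Eventually.of_forall fun s =>
      (norm_le_pi_norm _ j).trans ((norm_ev_le _ _).trans (hk n))
  · exact Eventually.of_forall fun s => (tendsto_pi_nhds.1 (hx s s.2)) j

end Basics

/-! ### The metric of the compact-open topology -/

section Metric

variable {m : ℕ}

lemma seminormOn_sub_eq (n : ℕ) (x y : BU m) :
    seminormOn n (toX x - toX y) =
      ⨆ s : {s : Past // -(n : ℝ) ≤ (s : ℝ)}, ‖ev x (s.1 : ℝ) - ev y (s.1 : ℝ)‖ := by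
  simp only [ev_coe]
  rfl

lemma seminormOn_sub_le {n : ℕ} {x y : BU m} {c : ℝ} (hc : 0 ≤ c)
    (h : ∀ s : ℝ, -(n : ℝ) ≤ s → s ≤ 0 → ‖ev x s - ev y s‖ ≤ c) :
    seminormOn n (toX x - toX y) ≤ c := by
  rw [seminormOn_sub_eq]
  exact Real.iSup_le (fun s => h _ s.2 s.1.2) hc

lemma le_seminormOn_sub {n : ℕ} (x y : BU m) {s : ℝ} (hs : -(n : ℝ) ≤ s) (hs0 : s ≤ 0) :
    ‖ev x s - ev y s‖ ≤ seminormOn n (toX x - toX y) := by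
  rw [seminormOn_sub_eq]
  refine le_ciSup (f := fun s : {s : Past // -(n : ℝ) ≤ (s : ℝ)} =>
    ‖ev x (s.1 : ℝ) - ev y (s.1 : ℝ)‖) ⟨‖x - y‖, ?_⟩ ⟨⟨s, hs0⟩, hs⟩
  rintro _ ⟨s, rfl⟩
  exact norm_ev_le (x - y) _

lemma seminormOn_sub_nonneg (n : ℕ) (x y : BU m) : 0 ≤ seminormOn n (toX x - toX y) := by
  rw [seminormOn_sub_eq]
  exact Real.iSup_nonneg fun _ => norm_nonneg _

lemma seminormOn_sub_triangle (n : ℕ) (x y z : BU m) :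
    seminormOn n (toX x - toX z) ≤ seminormOn n (toX x - toX y) + seminormOn n (toX y - toX z) := by
  refine seminormOn_sub_le (add_nonneg (seminormOn_sub_nonneg _ _ _)
    (seminormOn_sub_nonneg _ _ _)) fun s hs hs0 => ?_
  calc ‖ev x s - ev z s‖ ≤ ‖ev x s - ev y s‖ + ‖ev y s - ev z s‖ :=
        norm_sub_le_norm_sub_add_norm_sub _ _ _
    _ ≤ _ := add_le_add (le_seminormOn_sub x y hs hs0) (le_seminormOn_sub y z hs hs0)

lemma seminormOn_sub_comm (n : ℕ) (x y : BU m) :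
    seminormOn n (toX x - toX y) = seminormOn n (toX y - toX x) := by
  simp only [seminormOn_sub_eq, norm_sub_rev]

lemma div_one_add_nonneg {a : ℝ} (ha : 0 ≤ a) : 0 ≤ a / (1 + a) := by positivity

lemma div_one_add_le_one {a : ℝ} (ha : 0 ≤ a) : a / (1 + a) ≤ 1 := by
  rw [div_le_one (by positivity)]
  linarith

lemma div_one_add_le_self {a : ℝ} (ha : 0 ≤ a) : a / (1 + a) ≤ a :=
  div_le_self ha (by linarith)

lemma div_one_add_mono {a b : ℝ} (ha : 0 ≤ a) (hab : a ≤ b) : a / (1 + a) ≤ b / (1 + b) := by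
  rw [div_le_div_iff₀ (by linarith) (by linarith)]
  nlinarith

lemma div_one_add_add {a b : ℝ} (ha : 0 ≤ a) (hb : 0 ≤ b) :
    (a + b) / (1 + (a + b)) ≤ a / (1 + a) + b / (1 + b) := by
  rw [add_div]
  exact add_le_add (div_le_div_of_nonneg_left ha (by linarith) (by linarith))
    (div_le_div_of_nonneg_left hb (by linarith) (by linarith))

/-- The `n`-th term of the series defining the distance. -/
def diTerm (x y : BU m) (n : ℕ) : ℝ :=
  (1 / 2 : ℝ) ^ (n + 1) *
    (seminormOn (n + 1) (toX x - toX y) / (1 + seminormOn (n + 1) (toX x - toX y)))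

lemma di_eq (x y : BU m) : di x y = ∑' n, diTerm x y n := rfl

lemma diTerm_nonneg (x y : BU m) (n : ℕ) : 0 ≤ diTerm x y n :=
  mul_nonneg (by positivity) (div_one_add_nonneg (seminormOn_sub_nonneg _ _ _))

lemma diTerm_le (x y : BU m) (n : ℕ) : diTerm x y n ≤ 1 / 2 / 2 ^ n := by
  have h : (1 / 2 : ℝ) / 2 ^ n = (1 / 2 : ℝ) ^ (n + 1) * 1 := by
    rw [pow_succ, one_div_pow]; ring
  rw [h]
  exact mul_le_mul_of_nonneg_left (div_one_add_le_one (seminormOn_sub_nonneg _ _ _))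
    (by positivity)

lemma summable_diTerm (x y : BU m) : Summable (diTerm x y) :=
  Summable.of_nonneg_of_le (diTerm_nonneg x y) (diTerm_le x y) (summable_geometric_two' 1)

lemma di_nonneg (x y : BU m) : 0 ≤ di x y := tsum_nonneg (diTerm_nonneg x y)

lemma di_comm (x y : BU m) : di x y = di y x := by
  simp only [di_eq, diTerm, seminormOn_sub_comm _ x y]

lemma di_triangle (x y z : BU m) : di x z ≤ di x y + di y z := by
  rw [di_eq, di_eq, di_eq, ← (summable_diTerm x y).tsum_add (summable_diTerm y z)]
  refine (summable_diTerm x z).tsum_le_tsum (fun n => ?_)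
    ((summable_diTerm x y).add (summable_diTerm y z))
  rw [diTerm, diTerm, diTerm, ← mul_add]
  refine mul_le_mul_of_nonneg_left ?_ (by positivity)
  exact (div_one_add_mono (seminormOn_sub_nonneg _ _ _) (seminormOn_sub_triangle _ x y z)).trans
    (div_one_add_add (seminormOn_sub_nonneg _ _ _) (seminormOn_sub_nonneg _ _ _))

/-- Translation invariance of the metric is what lets a perturbation of a limit point be copied onto
the orbit. -/
lemma di_congr {x y x' y' : BU m} (h : x - y = x' - y') : di x y = di x' y' := by
  have h1 : ∀ s, ev x s - ev y s = ev x' s - ev y' s := fun s => by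
    rw [← ev_sub, h, ev_sub]
  simp only [di_eq, diTerm, seminormOn_sub_eq, h1]

/-- The first `N` terms only see `[-N,0]` and have total weight at most `1`; the tail is at most
`2^{-N}`. -/
lemma di_le {x y : BU m} {N : ℕ} {ε : ℝ} (hε : 0 ≤ ε)
    (h : ∀ s : ℝ, -(N : ℝ) ≤ s → s ≤ 0 → ‖ev x s - ev y s‖ ≤ ε) :
    di x y ≤ ε + (1 / 2) ^ N := by
  have hg := summable_geometric_two' (1 : ℝ)
  have hg1 := tsum_geometric_two' (1 : ℝ)
  rw [di_eq, ← (summable_diTerm x y).sum_add_tsum_nat_add N]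
  refine add_le_add ?_ ?_
  · calc ∑ n ∈ Finset.range N, diTerm x y n
        ≤ ∑ n ∈ Finset.range N, 1 / 2 / 2 ^ n * ε := by
          refine Finset.sum_le_sum fun n hn => ?_
          have hn' : ((n + 1 : ℕ) : ℝ) ≤ N := by exact_mod_cast Finset.mem_range.1 hn
          have h1 : (1 / 2 : ℝ) / 2 ^ n = (1 / 2 : ℝ) ^ (n + 1) := by
            rw [pow_succ, one_div_pow]; ring
          rw [h1]
          refine mul_le_mul_of_nonneg_left ?_ (by positivity)
          refine (div_one_add_le_self (seminormOn_sub_nonneg _ _ _)).trans ?_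
          exact seminormOn_sub_le hε fun s hs hs0 => h s (by linarith) hs0
      _ = (∑ n ∈ Finset.range N, 1 / 2 / 2 ^ n) * ε := by rw [Finset.sum_mul]
      _ ≤ 1 * ε := by
          refine mul_le_mul_of_nonneg_right ?_ hε
          exact (hg.sum_le_tsum (Finset.range N) fun _ _ => by positivity).trans hg1.le
      _ = ε := one_mul _
  · have h2 : ∀ n, diTerm x y (n + N) ≤ (1 / 2) ^ N * (1 / 2 / 2 ^ n) := fun n => by
      refine (diTerm_le x y (n + N)).trans (le_of_eq ?_)
      rw [pow_add, one_div_pow]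
      field_simp
    calc ∑' n, diTerm x y (n + N) ≤ ∑' n : ℕ, (1 / 2) ^ N * (1 / 2 / 2 ^ n) :=
          ((summable_nat_add_iff N).2 (summable_diTerm x y)).tsum_le_tsum h2 (hg.mul_left _)
      _ = (1 / 2) ^ N := by rw [tsum_mul_left, hg1, mul_one]

lemma exists_di_le (ε : ℝ) (hε : 0 < ε) : ∃ N : ℕ, ∃ δ : ℝ, 0 < δ ∧ ∀ x y : BU m,
    (∀ s : ℝ, -(N : ℝ) ≤ s → s ≤ 0 → ‖ev x s - ev y s‖ ≤ δ) → di x y ≤ ε := by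
  obtain ⟨N, hN⟩ := exists_pow_lt_of_lt_one (show (0 : ℝ) < ε / 2 by linarith)
    (show (1 / 2 : ℝ) < 1 by norm_num)
  refine ⟨N, ε / 2, by linarith, fun x y h => ?_⟩
  have := di_le (by linarith) h
  linarith

/-- A single term is at most the whole series, and `a ↦ a / (1 + a)` is increasing. Because of the
shifted index, term `n` controls `[-(n+1),0]`. -/
lemma norm_ev_sub_le_of_di {x y : BU m} {n : ℕ} {η : ℝ} (hη : 0 ≤ η)
    (h : di x y ≤ (1 / 2) ^ (n + 1) * (η / (1 + η))) {s : ℝ} (hs : -((n + 1 : ℕ) : ℝ) ≤ s)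
    (hs0 : s ≤ 0) : ‖ev x s - ev y s‖ ≤ η := by
  refine (le_seminormOn_sub x y hs hs0).trans ?_
  have h1 : diTerm x y n ≤ di x y :=
    (summable_diTerm x y).le_tsum n fun j _ => diTerm_nonneg x y j
  have h2 := le_of_mul_le_mul_left (h1.trans h) (by positivity)
  have h3 := seminormOn_sub_nonneg (n + 1) x y
  rw [div_le_div_iff₀ (by linarith) (by linarith)] at h2
  nlinarith

lemma exists_le_of_di (N : ℕ) (η : ℝ) (hη : 0 < η) : ∃ δ : ℝ, 0 < δ ∧ ∀ x y : BU m,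
    di x y ≤ δ → ∀ s : ℝ, -(N : ℝ) ≤ s → s ≤ 0 → ‖ev x s - ev y s‖ ≤ η := by
  refine ⟨(1 / 2) ^ (N + 1) * (η / (1 + η)), by positivity, fun x y h s hs hs0 => ?_⟩
  refine norm_ev_sub_le_of_di hη.le h ?_ hs0
  push_cast
  linarith

lemma tendsto_toX_iff {xn : ℕ → BU m} {x : BU m} :
    Tendsto (fun n => toX (xn n)) atTop (𝓝 (toX x)) ↔
      ∀ N : ℕ, ∀ ε : ℝ, 0 < ε → ∀ᶠ n in atTop, ∀ s : ℝ, -(N : ℝ) ≤ s → s ≤ 0 →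
        ‖ev (xn n) s - ev x s‖ ≤ ε := by
  rw [ContinuousMap.tendsto_iff_forall_isCompact_tendstoUniformlyOn]
  constructor
  · intro h N ε hε
    have hK : IsCompact {s : Past | -(N : ℝ) ≤ (s : ℝ)} := by
      rw [Topology.IsInducing.subtypeVal.isCompact_iff]
      convert! isCompact_Icc (a := -(N : ℝ)) (b := 0) using 1
      ext s
      constructor
      · rintro ⟨t, ht, rfl⟩
        exact ⟨ht, t.2⟩
      · exact fun hs => ⟨⟨s, hs.2⟩, hs.1, rfl⟩
    filter_upwards [Metric.tendstoUniformlyOn_iff.1 (h _ hK) ε hε] with n hn s hs hs0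
    have := hn ⟨s, hs0⟩ hs
    rw [dist_comm, dist_eq_norm] at this
    rw [← ev_mk _ hs0, ← ev_mk _ hs0]
    exact this.le
  · intro h K hK
    rw [Metric.tendstoUniformlyOn_iff]
    intro ε hε
    obtain ⟨b, hb⟩ := (hK.image continuous_subtype_val).bddBelow
    obtain ⟨N, hN⟩ := exists_nat_ge (-b)
    filter_upwards [h N (ε / 2) (by linarith)] with n hn s hs
    have h1 : b ≤ (s : ℝ) := hb ⟨s, hs, rfl⟩
    have h2 := hn s (by linarith) s.2
    rw [ev_coe, ev_coe] at h2
    rw [dist_comm, dist_eq_norm]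
    exact lt_of_le_of_lt h2 (by linarith)

lemma tendsto_toX_iff_di {xn : ℕ → BU m} {x : BU m} :
    Tendsto (fun n => toX (xn n)) atTop (𝓝 (toX x)) ↔
      Tendsto (fun n => di (xn n) x) atTop (𝓝 0) := by
  rw [tendsto_toX_iff]
  constructor
  · intro h
    rw [Metric.tendsto_nhds]
    intro ε hε
    obtain ⟨N, δ, hδ, hN⟩ := exists_di_le (m := m) (ε / 2) (by linarith)
    filter_upwards [h N δ hδ] with n hn
    have h1 := hN _ _ hn
    rw [Real.dist_eq, sub_zero, abs_of_nonneg (di_nonneg _ _)]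
    linarith
  · intro h N ε hε
    obtain ⟨δ, hδ, hN⟩ := exists_le_of_di (m := m) N ε hε
    filter_upwards [h.eventually (gt_mem_nhds hδ)] with n hn
    exact hN _ _ (le_of_lt hn)

lemma tendsto_ev_of_toX {xn : ℕ → BU m} {x : BU m}
    (h : Tendsto (fun n => toX (xn n)) atTop (𝓝 (toX x))) {s : ℝ} (hs : s ≤ 0) :
    Tendsto (fun n => ev (xn n) s) atTop (𝓝 (ev x s)) := by
  rw [← ev_mk x hs]
  simp only [← ev_mk _ hs]
  exact ((ContinuousEvalConst.continuous_eval_const (F := X m) (⟨s, hs⟩ : Past)).tendsto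
    (toX x)).comp h

lemma toX_injective {x y : BU m} (h : toX x = toX y) : x = y := by
  apply BU_ext
  intro s hs
  rw [← ev_mk x hs, ← ev_mk y hs]
  exact DFunLike.congr_fun h ⟨s, hs⟩

lemma tendsto_toX_shift {xn : ℕ → BU m} {x : BU m}
    (h : Tendsto (fun n => toX (xn n)) atTop (𝓝 (toX x))) (r : ℝ) :
    Tendsto (fun n => toX (shift r (xn n))) atTop (𝓝 (toX (shift r x))) := by
  rw [tendsto_toX_iff] at h ⊢
  intro N ε hε
  obtain ⟨M, hM⟩ := exists_nat_ge (max r 0)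
  filter_upwards [h (N + M) ε hε] with n hn s hs hs0
  rw [← shift_max r (xn n), ← shift_max r x, ev_shift (le_max_right _ _) _ hs0,
    ev_shift (le_max_right _ _) _ hs0]
  refine hn _ ?_ ?_
  · push_cast
    linarith
  · linarith [le_max_right r 0]

lemma tendsto_toX_of_sub {xn yn : ℕ → BU m} {x y : BU m} (hxy : ∀ n, yn n - xn n = y - x)
    (h : Tendsto (fun n => toX (xn n)) atTop (𝓝 (toX x))) :
    Tendsto (fun n => toX (yn n)) atTop (𝓝 (toX y)) := by
  rw [tendsto_toX_iff_di] at h ⊢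
  refine h.congr fun n => di_congr ?_
  have h1 : yn n = (yn n - xn n) + xn n := by abel
  rw [h1, hxy n]
  abel

lemma di_le_of_tendsto {xn yn : ℕ → BU m} {x y : BU m} {ε : ℝ}
    (hx : Tendsto (fun n => toX (xn n)) atTop (𝓝 (toX x)))
    (hy : Tendsto (fun n => toX (yn n)) atTop (𝓝 (toX y)))
    (h : ∀ n, di (xn n) (yn n) ≤ ε) : di x y ≤ ε := by
  rw [tendsto_toX_iff_di] at hx hy
  have h1 : Tendsto (fun n => di (xn n) x + ε + di (yn n) y) atTop (𝓝 (0 + ε + 0)) :=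
    (hx.add_const ε).add hy
  rw [zero_add, add_zero] at h1
  refine ge_of_tendsto' h1 fun n => ?_
  have h2 := di_triangle x (xn n) y
  have h3 := di_triangle (xn n) (yn n) y
  rw [di_comm x (xn n)] at h2
  linarith [h n]

end Metric

/-! ### A priori estimates for the neutral operator -/

section Weighted

variable {m : ℕ} {ν : Fin m → Fin m → FiniteMeasure Past}

lemma integrable_exp_past {γ : ℝ} (hγ : 0 ≤ γ) (i j : Fin m) :
    Integrable (fun s : Past => Real.exp (γ * s)) (ν i j : Measure Past) := by
  refine Integrable.of_bound (C := 1) (by fun_prop) (Eventually.of_forall fun s => ?_)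
  rw [Real.norm_eq_abs, Real.abs_exp, Real.exp_le_one_iff]
  exact mul_nonpos_of_nonneg_of_nonpos hγ s.2

/-- The rows of the measures `e^{γ s} dν(s)` have mass at most `1/2`. -/
def HalfWeight (ν : Fin m → Fin m → FiniteMeasure Past) (γ : ℝ) : Prop :=
  0 ≤ γ ∧ ∀ i, ∑ j, ∫ s : Past, Real.exp (γ * s) ∂(ν i j : Measure Past) ≤ 1 / 2

/-- As `n → ∞`, `e^{ns}` tends to `0` except at `s = 0`, which carries no mass. Dominated
convergence applies to the finitely many entries. -/
lemma exists_halfWeight (hν : ∀ i j, (ν i j : Measure Past) {now} = 0) :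
    ∃ γ : ℝ, HalfWeight ν γ := by
  have h1 : ∀ i j, Tendsto (fun n : ℕ => ∫ s : Past, Real.exp ((n : ℝ) * s) ∂(ν i j : Measure Past))
      atTop (𝓝 (∫ _ : Past, 0 ∂(ν i j : Measure Past))) := by
    intro i j
    refine tendsto_integral_of_dominated_convergence (fun _ => 1) ?_ (integrable_const _) ?_ ?_
    · intro n
      exact (integrable_exp_past (Nat.cast_nonneg n) i j).aestronglyMeasurable
    · refine fun n => Eventually.of_forall fun s => ?_
      rw [Real.norm_eq_abs, Real.abs_exp, Real.exp_le_one_iff]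
      exact mul_nonpos_of_nonneg_of_nonpos (Nat.cast_nonneg n) s.2
    · have h2 : ∀ᵐ s ∂(ν i j : Measure Past), s ≠ now := by
        rw [ae_iff]
        simpa using hν i j
      filter_upwards [h2] with s hs
      have hs' : (s : ℝ) < 0 := lt_of_le_of_ne s.2 fun h => hs (Subtype.ext h)
      exact Real.tendsto_exp_atBot.comp (tendsto_natCast_atTop_atTop.atTop_mul_const_of_neg hs')
  have h2 : ∀ i, Tendsto
      (fun n : ℕ => ∑ j, ∫ s : Past, Real.exp ((n : ℝ) * s) ∂(ν i j : Measure Past))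
      atTop (𝓝 0) := by
    intro i
    have := tendsto_finsetSum Finset.univ fun j _ => h1 i j
    simpa using this
  have h3 : ∀ᶠ n : ℕ in atTop, ∀ i,
      ∑ j, ∫ s : Past, Real.exp ((n : ℝ) * s) ∂(ν i j : Measure Past) < 1 / 2 := by
    rw [eventually_all]
    exact fun i => (h2 i).eventually (gt_mem_nhds (by norm_num))
  obtain ⟨n, hn⟩ := h3.exists
  exact ⟨n, Nat.cast_nonneg n, fun i => (hn i).le⟩

lemma HalfWeight.abs_sum_integral_le {γ : ℝ} (h : HalfWeight ν γ) {f : Past → Fin m → ℝ}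
    {S R : ℝ} (hS : 0 ≤ S) (hR : 0 ≤ R) (hf : ∀ s : Past, ‖f s‖ ≤ Real.exp (γ * s) * S + R)
    (i : Fin m) :
    |∑ j, ∫ s : Past, f s j ∂(ν i j : Measure Past)| ≤ S / 2 + mass ν * R := by
  calc |∑ j, ∫ s : Past, f s j ∂(ν i j : Measure Past)|
      ≤ ∑ j, |∫ s : Past, f s j ∂(ν i j : Measure Past)| := Finset.abs_sum_le_sum_abs _ _
    _ ≤ ∑ j, ∫ s : Past, (Real.exp (γ * s) * S + R) ∂(ν i j : Measure Past) := by
        refine Finset.sum_le_sum fun j _ => ?_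
        exact norm_integral_le_of_norm_le
          (((integrable_exp_past h.1 i j).mul_const S).add (integrable_const R))
          (Eventually.of_forall fun s => (norm_le_pi_norm (f s) j).trans (hf s))
    _ = (∑ j, ∫ s : Past, Real.exp (γ * s) ∂(ν i j : Measure Past)) * S
          + (∑ j, (ν i j : Measure Past).real univ) * R := by
        rw [Finset.sum_mul, Finset.sum_mul, ← Finset.sum_add_distrib]
        refine Finset.sum_congr rfl fun j _ => ?_
        rw [integral_add ((integrable_exp_past h.1 i j).mul_const S) (integrable_const R),
          integral_mul_const, integral_const, smul_eq_mul]
    _ ≤ 1 / 2 * S + mass ν * R :=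
        add_le_add (mul_le_mul_of_nonneg_right (h.2 i) hS)
          (mul_le_mul_of_nonneg_right (row_le_mass ν i) hR)
    _ = S / 2 + mass ν * R := by ring

/-- An a priori estimate on bounded time intervals that does not need stability. At a point
maximizing `e^{-γq}‖e(q - t)‖` on `[0,t]`, the value of `e` is its `D`-part plus an integral. The
weighted part of the integral is at most half the maximum and is absorbed; the part before `-t`
costs `mass ν * ‖shift t e‖`. -/
lemma norm_ev_zero_le (hγ : ∃ γ, HalfWeight ν γ) (T : ℝ) : ∃ C : ℝ, 0 ≤ C ∧
    ∀ t ∈ Icc 0 T, ∀ (e : BU m) (d : ℝ), 0 ≤ d → (∀ a ∈ Icc 0 t, ‖neutralOp ν (shift a e)‖ ≤ d) →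
      ‖e‖ ≤ C * (d + ‖shift t e‖) := by
  obtain ⟨γ, h⟩ := hγ
  have h0 := h.1
  have hM := mass_nonneg ν
  refine ⟨2 * Real.exp (γ * T) * (1 + mass ν) + 1, by positivity, fun t ht e d hd hD => ?_⟩
  set R := ‖shift t e‖ with hR
  have hR0 : 0 ≤ R := BU_norm_nonneg _
  have hpast : ∀ s ≤ -t, ‖ev e s‖ ≤ R := fun s hs => by
    have h1 := norm_ev_le (shift t e) (s + t)
    rwa [ev_shift ht.1 _ (by linarith), add_sub_cancel_right] at h1
  obtain ⟨q, hq, hmax⟩ := isCompact_Icc.exists_isMaxOn (nonempty_Icc.2 ht.1)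
    (show ContinuousOn (fun q => Real.exp (-(γ * q)) * ‖ev e (q - t)‖) (Icc 0 t) from
      Continuous.continuousOn (by have := continuous_ev e; fun_prop))
  set S := Real.exp (-(γ * q)) * ‖ev e (q - t)‖ with hSdef
  have hS0 : 0 ≤ S := by positivity
  have hS : ∀ p ∈ Icc 0 t, ‖ev e (p - t)‖ ≤ Real.exp (γ * p) * S := fun p hp => by
    have h1 : Real.exp (-(γ * p)) * ‖ev e (p - t)‖ ≤ S := hmax hp
    calc ‖ev e (p - t)‖ = Real.exp (γ * p) * (Real.exp (-(γ * p)) * ‖ev e (p - t)‖) := by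
          rw [← mul_assoc, ← Real.exp_add, add_neg_cancel, Real.exp_zero, one_mul]
      _ ≤ _ := mul_le_mul_of_nonneg_left h1 (Real.exp_pos _).le
  have hSle : S ≤ 2 * (d + mass ν * R) := by
    have h1 : ‖ev e (q - t)‖ ≤ d + (Real.exp (γ * q) * S / 2 + mass ν * R) := by
      refine (pi_norm_le_iff_of_nonneg (by positivity)).2 fun i => ?_
      have h2 := h.abs_sum_integral_le (f := fun s => ev (shift (t - q) e) s)
        (S := Real.exp (γ * q) * S) (by positivity) hR0 (fun s => ?_) i
      · have h3 := (norm_le_pi_norm _ i).trans (hD (t - q) ⟨by linarith [hq.2], by linarith [hq.1]⟩)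
        rw [neutralOp_apply, ev_shift_zero (by linarith [hq.2]), neg_sub, Real.norm_eq_abs] at h3
        rw [Real.norm_eq_abs]
        have h4 := abs_add_le (ev e (q - t) i - ∑ j, ∫ s : Past, ev (shift (t - q) e) s j
          ∂(ν i j : Measure Past)) (∑ j, ∫ s : Past, ev (shift (t - q) e) s j
          ∂(ν i j : Measure Past))
        rw [sub_add_cancel] at h4
        linarith
      · have hs : (s : ℝ) ≤ 0 := s.2
        rw [ev_shift (by linarith [hq.2]) _ hs]
        rcases le_total 0 (q + s) with h5 | h5
        · have h6 := hS (q + s) ⟨h5, by linarith [hq.2]⟩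
          rw [mul_add, Real.exp_add] at h6
          have h7 : (s : ℝ) - (t - q) = q + s - t := by ring
          rw [h7]
          calc _ ≤ _ := h6
            _ = Real.exp (γ * s) * (Real.exp (γ * q) * S) := by ring
            _ ≤ _ := by linarith
        · have h6 := hpast (s - (t - q)) (by linarith)
          have : 0 ≤ Real.exp (γ * s) * (Real.exp (γ * q) * S) := by positivity
          linarith
    -- Multiplication by `e^{-γq}` turns the integral term into `S / 2`, which is absorbed on the
    -- left.
    have h2 : S ≤ Real.exp (-(γ * q)) * (d + (Real.exp (γ * q) * S / 2 + mass ν * R)) :=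
      mul_le_mul_of_nonneg_left h1 (Real.exp_pos _).le
    have h3 : Real.exp (-(γ * q)) * (d + (Real.exp (γ * q) * S / 2 + mass ν * R))
        = Real.exp (-(γ * q)) * (d + mass ν * R) + S / 2 := by
      have : Real.exp (-(γ * q)) * Real.exp (γ * q) = 1 := by
        rw [← Real.exp_add, neg_add_cancel, Real.exp_zero]
      linear_combination (S / 2) * this
    have h4 : Real.exp (-(γ * q)) * (d + mass ν * R) ≤ 1 * (d + mass ν * R) := by
      refine mul_le_mul_of_nonneg_right ?_ (by positivity)
      rw [Real.exp_le_one_iff]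
      have := mul_nonneg h0 hq.1
      linarith
    linarith
  refine norm_le_of_ev (by positivity) fun s hs => ?_
  rcases le_total (-t) s with h1 | h1
  · have h2 := hS (s + t) ⟨by linarith, by linarith⟩
    rw [add_sub_cancel_right] at h2
    have h3 : Real.exp (γ * (s + t)) ≤ Real.exp (γ * T) :=
      Real.exp_le_exp.2 (mul_le_mul_of_nonneg_left (by linarith [ht.2]) h0)
    have h4 : Real.exp (γ * (s + t)) * S ≤ Real.exp (γ * T) * (2 * (d + mass ν * R)) :=
      mul_le_mul h3 hSle hS0 (Real.exp_pos _).le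
    have h5 : 0 ≤ 2 * Real.exp (γ * T) * (mass ν * d + R) + (d + R) := by positivity
    linarith
  · have h2 := hpast s h1
    have h5 : 0 ≤ 2 * Real.exp (γ * T) * (1 + mass ν) * (d + R) + d := by positivity
    linarith

end Weighted

/-! ### Solutions -/

section Solutions

variable {Ω : Type*} [MetricSpace Ω] {m : ℕ} {σ : Flow ℝ Ω}
  {ν : Fin m → Fin m → FiniteMeasure Past} {F : Ω → BU m → Fin m → ℝ}

/-- `w` is the history at time `T` of a solution along `ω` on `[0, T]`. -/
def Sol (σ : Flow ℝ Ω) (ν : Fin m → Fin m → FiniteMeasure Past)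
    (F : Ω → BU m → Fin m → ℝ) (T : ℝ) (ω : Ω) (w : BU m) : Prop :=
  ∀ t ∈ Icc 0 T, HasDerivWithinAt (fun τ => neutralOp ν (shift (T - τ) w))
    (F (σ t ω) (shift (T - t) w)) (Icc 0 T) t

lemma IsHistory.eq_shift {z : ℝ → Fin m → ℝ} {t T : ℝ} {v w : BU m} (htT : t ≤ T)
    (hv : IsHistory z t v) (hw : IsHistory z T w) : v = shift (T - t) w := by
  apply BU_ext
  intro s hs
  rw [ev_shift (by linarith) _ hs, ← ev_mk _ hs, ← ev_mk w (show s - (T - t) ≤ 0 by linarith),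
    hv, hw]
  congr 1
  simp only
  ring

lemma IsSolution.sol {ω : Ω} {x : BU m} {T : ℝ} {z : ℝ → Fin m → ℝ} {v : ℝ → BU m}
    (hT : 0 ≤ T) (h : IsSolution σ ν F ω x T z v) : Sol σ ν F T ω (v T) ∧ shift T (v T) = x := by
  have hv : ∀ t ∈ Icc 0 T, v t = shift (T - t) (v T) := fun t ht =>
    (h.history t ht).eq_shift ht.2 (h.history T ⟨hT, le_rfl⟩)
  constructor
  · intro t ht
    have h1 := h.deriv t ht
    rw [hv t ht] at h1
    exact h1.congr (fun τ hτ => by rw [← hv τ hτ]) (by rw [← hv t ht])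
  · have := h.init.eq_shift hT (h.history T ⟨hT, le_rfl⟩)
    rw [this, sub_zero]

lemma Sol.isSolution {ω : Ω} {T : ℝ} {w : BU m} (hT : 0 ≤ T) (h : Sol σ ν F T ω w) :
    IsSolution σ ν F ω (shift T w) T (fun t => ev w (t - T)) (fun t => shift (T - t) w) where
  init := fun s => by
    rw [← ev_coe, ev_shift hT _ s.2, zero_add]
  history := fun t ht s => by
    rw [← ev_coe, ev_shift (by linarith [ht.2]) _ s.2]
    congr 1
    ring
  deriv := h

/-- The history at the final time contains all earlier ones as its shifts, so a solution on `[0,T]`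
is encoded by a single element of `BU`. -/
lemma defined_iff {ω : Ω} {T : ℝ} {x : BU m} :
    Defined σ ν F T ω x ↔ 0 ≤ T ∧ ∃ w, Sol σ ν F T ω w ∧ shift T w = x := by
  constructor
  · rintro ⟨hT, v, z, h⟩
    exact ⟨hT, v T, h.sol hT⟩
  · rintro ⟨hT, w, h, rfl⟩
    exact ⟨hT, _, _, h.isSolution hT⟩

lemma u_spec {ω : Ω} {T : ℝ} {x : BU m} (h : Defined σ ν F T ω x) :
    Sol σ ν F T ω (u σ ν F T ω x) ∧ shift T (u σ ν F T ω x) = x := by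
  rw [u, dif_pos h]
  obtain ⟨z, hz⟩ := h.2.choose_spec
  exact hz.sol h.1

lemma Sol.restrict {ω : Ω} {t T : ℝ} {w : BU m} (h : Sol σ ν F T ω w) (ht : t ≤ T) :
    Sol σ ν F t ω (shift (T - t) w) := by
  have h1 : ∀ τ ∈ Icc 0 t, shift (t - τ) (shift (T - t) w) = shift (T - τ) w := fun τ hτ => by
    rw [shift_shift (by linarith [hτ.2]) (by linarith)]
    congr 1
    ring
  intro τ hτ
  have h2 := (h τ ⟨hτ.1, hτ.2.trans ht⟩).mono (Icc_subset_Icc_right ht)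
  rw [h1 τ hτ]
  exact h2.congr (fun q hq => by rw [h1 q hq]) (by rw [h1 τ hτ])

lemma Sol.restart {ω : Ω} {s t : ℝ} {w : BU m} (hs : 0 ≤ s) (h : Sol σ ν F (t + s) ω w) :
    Sol σ ν F t (σ s ω) w := by
  intro τ hτ
  have h1 := h (τ + s) ⟨by linarith [hτ.1], by linarith [hτ.2]⟩
  have h2 := HasDerivWithinAt.scomp (h := fun τ => τ + s) (h' := 1) (s := Icc 0 t) τ h1
    ((hasDerivWithinAt_id τ (Icc 0 t)).add_const s)
    (fun q hq => ⟨by linarith [hq.1], by linarith [hq.2]⟩)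
  rw [one_smul, Flow.map_add] at h2
  have h3 : ∀ q : ℝ, t + s - (q + s) = t - q := fun q => by ring
  simpa only [Function.comp_def, h3] using h2

lemma continuous_rhs (hF : Continuous fun p : Ω × BU m => F p.1 p.2) (T : ℝ) (ω : Ω) (w : BU m) :
    Continuous fun t => F (σ t ω) (shift (T - t) w) :=
  hF.comp ((σ.continuous continuous_id continuous_const).prodMk
    ((continuous_shift w).comp (continuous_const.sub continuous_id)))

lemma continuous_neutralOp_shift (T : ℝ) (w : BU m) :
    Continuous fun t => neutralOp ν (shift (T - t) w) :=
  (continuous_neutralOp ν).comp ((continuous_shift w).comp (continuous_const.sub continuous_id))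

lemma Sol.integral_eq (hF : Continuous fun p : Ω × BU m => F p.1 p.2) {T : ℝ} {ω : Ω} {w : BU m}
    (h : Sol σ ν F T ω w) {a b : ℝ} (ha : 0 ≤ a) (hab : a ≤ b) (hb : b ≤ T) :
    ∫ s in a..b, F (σ s ω) (shift (T - s) w) =
      neutralOp ν (shift (T - b) w) - neutralOp ν (shift (T - a) w) := by
  refine intervalIntegral.integral_eq_sub_of_hasDerivAt_of_le hab
    (f := fun t => neutralOp ν (shift (T - t) w))
    (continuous_neutralOp_shift T w).continuousOn (fun t ht => ?_)
    ((continuous_rhs hF T ω w).intervalIntegrable _ _)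
  exact (h t ⟨by linarith [ht.1], by linarith [ht.2]⟩).hasDerivAt
    (Icc_mem_nhds (by linarith [ht.1]) (by linarith [ht.2]))

/-- The integrated equation survives limits without any convergence of derivatives; this converse of
`Sol.integral_eq` recovers the equation afterwards. -/
lemma sol_of_integral_eq (hF : Continuous fun p : Ω × BU m => F p.1 p.2) {T : ℝ} {ω : Ω} {w : BU m}
    (h : ∀ t ∈ Icc 0 T, ∫ s in (0 : ℝ)..t, F (σ s ω) (shift (T - s) w) =
      neutralOp ν (shift (T - t) w) - neutralOp ν (shift T w)) : Sol σ ν F T ω w := by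
  intro t ht
  have h1 : HasDerivAt (fun t => (∫ s in (0 : ℝ)..t, F (σ s ω) (shift (T - s) w))
      + neutralOp ν (shift T w)) (F (σ t ω) (shift (T - t) w)) t :=
    ((continuous_rhs hF T ω w).integral_hasStrictDerivAt 0 t).hasDerivAt.add_const _
  exact h1.hasDerivWithinAt.congr (fun q hq => by rw [h q hq, sub_add_cancel])
    (by rw [h t ht, sub_add_cancel])

/-- A locally Lipschitz function is Lipschitz on compact sets. -/
lemma HypF1.exists_lipschitz (hF : HypF1 F) {C : Set (Ω × BU m)} (hC : IsCompact C) :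
    ∃ L : ℝ, 0 ≤ L ∧ ∀ (ω : Ω) (x y : BU m), (ω, x) ∈ C → (ω, y) ∈ C →
      ‖F ω x - F ω y‖ ≤ L * ‖x - y‖ := by
  by_contra! hcon
  -- Violating pairs with constant `n` satisfy `‖x_n - y_n‖ ≤ 2M/n`, as `F` is bounded by `M` on
  -- `C`. Both sequences cluster at one point, where the local constant gives a contradiction.
  choose ωn xn yn hx hy hn using fun n : ℕ => hcon n (Nat.cast_nonneg n)
  obtain ⟨M, hM⟩ := hC.exists_bound_of_continuousOn hF.1.continuousOn
  obtain ⟨p, -, φ, hφ, hp⟩ := hC.tendsto_subseq hx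
  obtain ⟨U, hU, L, hL⟩ := hF.2 p
  have hxy : Tendsto (fun n => ‖xn (φ n) - yn (φ n)‖) atTop (𝓝 0) := by
    have h1 : ∀ᶠ n : ℕ in atTop, ‖xn (φ n) - yn (φ n)‖ ≤ 2 * M * ((φ n : ℝ))⁻¹ := by
      filter_upwards [hφ.tendsto_atTop.eventually_gt_atTop 0] with n hn0
      have h2 : (0 : ℝ) < φ n := by exact_mod_cast hn0
      rw [← div_eq_mul_inv, le_div_iff₀ h2]
      have h3 := hn (φ n)
      have h4 := norm_sub_le (F (ωn (φ n)) (xn (φ n))) (F (ωn (φ n)) (yn (φ n)))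
      have h5 := hM _ (hx (φ n))
      have h6 := hM _ (hy (φ n))
      simp only at h5 h6
      linarith
    refine squeeze_zero' (Eventually.of_forall fun _ => BU_norm_nonneg _) h1 ?_
    have h2 := ((tendsto_inv_atTop_zero (𝕜 := ℝ)).comp
      (tendsto_natCast_atTop_atTop.comp hφ.tendsto_atTop)).const_mul (2 * M)
    simpa using h2
  have hp1 : Tendsto (fun n => ωn (φ n)) atTop (𝓝 p.1) := (continuous_fst.tendsto p).comp hp
  have hp2 : Tendsto (fun n => xn (φ n)) atTop (𝓝 p.2) := (continuous_snd.tendsto p).comp hp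
  have hy2 : Tendsto (fun n => yn (φ n)) atTop (𝓝 p.2) := by
    refine hp2.congr_dist ?_
    simpa only [dist_BU] using hxy
  have hq : Tendsto (fun n => (ωn (φ n), yn (φ n))) atTop (𝓝 p) := hp1.prodMk_nhds hy2
  obtain ⟨n, h1, h2, h3⟩ := ((hp.eventually hU).and ((hq.eventually hU).and
    ((tendsto_natCast_atTop_atTop.comp hφ.tendsto_atTop).eventually_ge_atTop L))).exists
  have h4 := hL _ _ _ h1 h2
  have h5 := hn (φ n)
  have h6 : L * ‖xn (φ n) - yn (φ n)‖ ≤ (φ n : ℝ) * ‖xn (φ n) - yn (φ n)‖ :=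
    mul_le_mul_of_nonneg_right h3 (BU_norm_nonneg _)
  linarith

/-- Gronwall for the integral `J` of the norm of the difference of histories. The equation bounds
`D` of the difference by `L * J`, and `norm_ev_zero_le`, with zero initial difference, bounds the
difference itself by `C * L * J`. -/
lemma Sol.unique (hγ : ∃ γ, HalfWeight ν γ) (hF : HypF1 F) {T : ℝ} (hT : 0 ≤ T) {ω : Ω}
    {w₁ w₂ : BU m} (h₁ : Sol σ ν F T ω w₁) (h₂ : Sol σ ν F T ω w₂)
    (h : shift T w₁ = shift T w₂) : w₁ = w₂ := by
  obtain ⟨C, hC0, hC⟩ := norm_ev_zero_le hγ T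
  have hpath : ∀ w : BU m, Continuous fun t => (σ t ω, shift (T - t) w) := fun w =>
    (σ.continuous continuous_id continuous_const).prodMk
      ((continuous_shift w).comp (continuous_const.sub continuous_id))
  -- The two trajectories form a compact set in the norm topology, which yields one Lipschitz
  -- constant for both.
  obtain ⟨L, hL0, hL⟩ := hF.exists_lipschitz
    (((isCompact_Icc (a := (0 : ℝ)) (b := T)).image (hpath w₁)).union
      ((isCompact_Icc (a := (0 : ℝ)) (b := T)).image (hpath w₂)))
  set e := w₁ - w₂ with he
  set N : ℝ → ℝ := fun t => ‖shift (T - t) e‖ with hN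
  have hNc : Continuous N :=
    continuous_norm_BU.comp ((continuous_shift e).comp (continuous_const.sub continuous_id))
  set J : ℝ → ℝ := fun t => ∫ s in (0 : ℝ)..t, N s with hJ
  have hJ' : ∀ t, HasDerivAt J (N t) t := fun t => (hNc.integral_hasStrictDerivAt 0 t).hasDerivAt
  have hJmono : ∀ s t, s ≤ t → J s ≤ J t := fun s t hst => by
    have h1 := intervalIntegral.integral_add_adjacent_intervals
      (hNc.intervalIntegrable (μ := volume) 0 s) (hNc.intervalIntegrable s t)
    have h2 : 0 ≤ ∫ q in s..t, N q :=
      intervalIntegral.integral_nonneg hst fun _ _ => BU_norm_nonneg _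
    simp only [hJ]
    linarith
  have hJ0 : J 0 = 0 := intervalIntegral.integral_same
  have hD : ∀ t ∈ Icc 0 T, ‖neutralOp ν (shift (T - t) e)‖ ≤ L * J t := by
    intro t ht
    have h1 := h₁.integral_eq hF.1 le_rfl ht.1 ht.2
    have h2 := h₂.integral_eq hF.1 le_rfl ht.1 ht.2
    rw [sub_zero] at h1 h2
    have h3 : neutralOp ν (shift (T - t) e) = ∫ s in (0 : ℝ)..t,
        (F (σ s ω) (shift (T - s) w₁) - F (σ s ω) (shift (T - s) w₂)) := by
      rw [intervalIntegral.integral_sub ((continuous_rhs hF.1 T ω w₁).intervalIntegrable _ _)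
        ((continuous_rhs hF.1 T ω w₂).intervalIntegrable _ _), h1, h2, h, he, shift_sub,
        neutralOp_sub]
      abel
    rw [h3, hJ, ← intervalIntegral.integral_const_mul]
    refine intervalIntegral.norm_integral_le_of_norm_le ht.1 ?_
      ((hNc.const_mul L).intervalIntegrable _ _)
    refine Eventually.of_forall fun s hs => ?_
    have hs' : s ∈ Icc 0 T := ⟨hs.1.le, hs.2.trans ht.2⟩
    have h4 := hL (σ s ω) _ _ (Or.inl ⟨s, hs', rfl⟩) (Or.inr ⟨s, hs', rfl⟩)
    rwa [← shift_sub] at h4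
  have hNJ : ∀ t ∈ Icc 0 T, N t ≤ C * L * J t := by
    intro t ht
    have h1 := hC t ht (shift (T - t) e) (L * J t)
      (mul_nonneg hL0 (hJ0.symm.le.trans (hJmono 0 t ht.1))) fun a ha => ?_
    · rw [shift_shift ht.1 (by linarith [ht.2])] at h1
      have h2 : shift (t + (T - t)) e = 0 := by
        rw [he, shift_sub, show t + (T - t) = T by ring, h, BU_sub_self]
      rw [h2, BU_norm_zero, add_zero, ← mul_assoc] at h1
      exact h1
    · rw [shift_shift ha.1 (by linarith [ht.2])]
      have h1 := hD (t - a) ⟨by linarith [ha.2], by linarith [ha.1, ht.2]⟩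
      rw [show a + (T - t) = T - (t - a) by ring]
      exact h1.trans (mul_le_mul_of_nonneg_left (hJmono _ _ (by linarith [ha.1])) hL0)
  have hJz : ∀ t ∈ Icc 0 T, J t = 0 := by
    have h1 := norm_le_gronwallBound_of_norm_deriv_right_le (f := J) (f' := N) (δ := 0)
      (K := C * L) (ε := 0) (a := 0) (b := T)
      (fun t _ => (hJ' t).continuousAt.continuousWithinAt)
      (fun t _ => (hJ' t).hasDerivWithinAt) (by simp [hJ0]) (fun t ht => by
        have h2 := hNJ t ⟨ht.1, ht.2.le⟩
        have h3 : 0 ≤ N t := BU_norm_nonneg _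
        have h4 : 0 ≤ J t := hJ0.symm.le.trans (hJmono 0 t ht.1)
        rw [Real.norm_of_nonneg h3, Real.norm_of_nonneg h4]
        linarith)
    intro t ht
    have h2 := h1 t ht
    rw [gronwallBound_ε0, zero_mul] at h2
    exact norm_le_zero_iff.1 h2
  have h1 := hNJ T ⟨hT, le_rfl⟩
  rw [hJz T ⟨hT, le_rfl⟩, mul_zero] at h1
  simp only [hN, sub_self, shift_zero] at h1
  exact BU_eq_of_norm_sub_le h1

lemma Sol.eq_u (hγ : ∃ γ, HalfWeight ν γ) (hF : HypF1 F) {T : ℝ} (hT : 0 ≤ T) {ω : Ω}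
    {w x : BU m} (h : Sol σ ν F T ω w) (hx : shift T w = x) :
    Defined σ ν F T ω x ∧ u σ ν F T ω x = w := by
  have h1 : Defined σ ν F T ω x := defined_iff.2 ⟨hT, w, h, hx⟩
  obtain ⟨h2, h3⟩ := u_spec h1
  exact ⟨h1, h2.unique hγ hF hT h (h3.trans hx.symm)⟩

end Solutions

/-! ### Compactness in the compact-open topology -/

instance : LocallyCompactSpace Past :=
  (isClosed_Iic (a := (0 : ℝ))).isClosedEmbedding_subtypeVal.locallyCompactSpace

instance : SigmaCompactSpace Past :=
  (isClosed_Iic (a := (0 : ℝ))).isClosedEmbedding_subtypeVal.sigmaCompactSpace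

section Compactness

variable {m : ℕ}

/-- A uniformly equicontinuous set of elements of `BU`. -/
def EquiUC (S : Set (BU m)) : Prop :=
  ∀ ε : ℝ, 0 < ε → ∃ δ : ℝ, 0 < δ ∧ ∀ w ∈ S, ∀ a ∈ Icc 0 δ, ‖w - shift a w‖ ≤ ε

lemma norm_ev_sub_le_of_shift {w : BU m} {δ ε : ℝ}
    (h : ∀ a ∈ Icc 0 δ, ‖w - shift a w‖ ≤ ε) {s s' : ℝ} (hs : s ≤ 0) (hs' : s' ≤ 0)
    (hss' : |s - s'| ≤ δ) : ‖ev w s - ev w s'‖ ≤ ε := by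
  wlog hle : s' ≤ s generalizing s s'
  · rw [norm_sub_rev]
    exact this hs' hs (by rwa [abs_sub_comm]) (by linarith)
  have h1 := (norm_ev_le _ s).trans (h (s - s') ⟨by linarith, (le_abs_self _).trans hss'⟩)
  rwa [ev_sub, ev_shift (by linarith) _ hs, sub_sub_cancel] at h1

lemma equiUC_singleton (w : BU m) : EquiUC {w} := by
  intro ε hε
  have h := (continuous_shift w).tendsto 0
  rw [shift_zero, Metric.tendsto_nhds_nhds] at h
  obtain ⟨δ, hδ, h1⟩ := h ε hε
  refine ⟨δ / 2, by linarith, ?_⟩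
  rintro _ rfl a ha
  rw [← dist_BU, dist_comm]
  refine (h1 ?_).le
  rw [Real.dist_eq, sub_zero, abs_of_nonneg ha.1]
  linarith [ha.2]

/-- The functions bounded by `k` with modulus of continuity `δ`. -/
def modulusSet (m : ℕ) (k : ℝ) (δ : ℝ → ℝ) : Set (Past → Fin m → ℝ) :=
  {f | (∀ s, ‖f s‖ ≤ k) ∧ ∀ ε : ℝ, 0 < ε → ∀ s s' : Past, dist s s' ≤ δ ε → ‖f s - f s'‖ ≤ ε}

lemma uniformContinuous_of_mem_modulusSet {k : ℝ} {δ : ℝ → ℝ} (hδ : ∀ ε, 0 < ε → 0 < δ ε)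
    {f : Past → Fin m → ℝ} (hf : f ∈ modulusSet m k δ) : UniformContinuous f := by
  rw [Metric.uniformContinuous_iff]
  intro ε hε
  refine ⟨δ (ε / 2), hδ _ (by linarith), fun s s' h => ?_⟩
  rw [dist_eq_norm]
  exact lt_of_le_of_lt (hf.2 (ε / 2) (by linarith) s s' h.le) (by linarith)

/-- Tychonoff: the bound and the modulus are closed conditions for pointwise convergence. -/
lemma isCompact_modulusSet (k : ℝ) (δ : ℝ → ℝ) : IsCompact (modulusSet m k δ) := by
  have h1 : IsCompact (Set.pi univ fun _ : Past => Metric.closedBall (0 : Fin m → ℝ) k) :=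
    isCompact_univ_pi fun _ => isCompact_closedBall 0 k
  refine h1.of_isClosed_subset ?_ fun f hf s _ => ?_
  · have h2 : modulusSet m k δ = (⋂ s, {f | ‖f s‖ ≤ k}) ∩
        ⋂ (ε : ℝ) (_ : 0 < ε) (s : Past) (s' : Past) (_ : dist s s' ≤ δ ε),
          {f | ‖f s - f s'‖ ≤ ε} := by
      ext f
      simp [modulusSet]
    rw [h2]
    refine IsClosed.inter (isClosed_iInter fun s => ?_) ?_
    · exact isClosed_le (continuous_apply s).norm continuous_const
    · refine isClosed_iInter fun ε => isClosed_iInter fun _ => isClosed_iInter fun s =>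
        isClosed_iInter fun s' => isClosed_iInter fun _ => ?_
      exact isClosed_le ((continuous_apply s).sub (continuous_apply s')).norm continuous_const
  · rw [mem_closedBall_zero_iff]
    exact hf.1 s

lemma isCompact_modulusSet_preimage (k : ℝ) {δ : ℝ → ℝ} (hδ : ∀ ε, 0 < ε → 0 < δ ε) :
    IsCompact {g : X m | (g : Past → Fin m → ℝ) ∈ modulusSet m k δ} := by
  refine ArzelaAscoli.isCompact_of_equicontinuous _ ?_ ?_
  · convert! isCompact_modulusSet (m := m) k δ using 1
    ext f
    constructor
    · rintro ⟨g, hg, rfl⟩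
      exact hg
    · exact fun hf => ⟨⟨f, (uniformContinuous_of_mem_modulusSet hδ hf).continuous⟩, hf, rfl⟩
  · refine UniformEquicontinuous.equicontinuous (Metric.uniformEquicontinuous_iff.2 ?_)
    intro ε hε
    refine ⟨δ (ε / 2), hδ _ (by linarith), fun s s' h g => ?_⟩
    rw [dist_eq_norm]
    exact lt_of_le_of_lt (g.2.2 (ε / 2) (by linarith) s s' h.le) (by linarith)

/-- The limit inherits the bound and the modulus of continuity, so it lies in `BU` and not merely in
`X`. -/
lemma exists_subseq_tendsto {S : Set (BU m)} (hS : EquiUC S) {k : ℝ} {wn : ℕ → BU m}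
    (hwS : ∀ n, wn n ∈ S) (hk : ∀ n, ‖wn n‖ ≤ k) :
    ∃ φ : ℕ → ℕ, StrictMono φ ∧ ∃ w : BU m,
      Tendsto (fun n => toX (wn (φ n))) atTop (𝓝 (toX w)) := by
  choose! δ hδ hSδ using hS
  have hmem : ∀ n, toX (wn n) ∈ {g : X m | (g : Past → Fin m → ℝ) ∈ modulusSet m k δ} := by
    refine fun n => ⟨fun s => ((wn n).1.norm_coe_le_norm s).trans (hk n), fun ε hε s s' h => ?_⟩
    have h1 := norm_ev_sub_le_of_shift (hSδ ε hε (wn n) (hwS n)) s.2 s'.2 h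
    rw [ev_coe, ev_coe] at h1
    exact h1
  obtain ⟨g, hg, φ, hφ, hlim⟩ := (isCompact_modulusSet_preimage k hδ).tendsto_subseq hmem
  refine ⟨φ, hφ, ⟨BoundedContinuousFunction.ofNormedAddCommGroup g g.continuous k hg.1,
    uniformContinuous_of_mem_modulusSet hδ hg⟩, ?_⟩
  convert! hlim using 1

lemma norm_le_of_tendsto_toX {k : ℝ} {xn : ℕ → BU m} {x : BU m} (hk : ∀ n, ‖xn n‖ ≤ k)
    (hx : Tendsto (fun n => toX (xn n)) atTop (𝓝 (toX x))) : ‖x‖ ≤ k :=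
  norm_le_of_ev ((BU_norm_nonneg _).trans (hk 0)) fun _ hs =>
    le_of_tendsto' (tendsto_ev_of_toX hx hs).norm fun n => (norm_ev_le _ _).trans (hk n)

end Compactness

/-! ### Limits of solutions -/

section Limits

variable {Ω : Type*} [MetricSpace Ω] {m : ℕ} {σ : Flow ℝ Ω}
  {ν : Fin m → Fin m → FiniteMeasure Past} {F : Ω → BU m → Fin m → ℝ}

/-- Limit in the integrated equation: (F3) gives pointwise convergence of the integrand, (F2) a
dominating constant, and `tendsto_neutralOp` handles the left-hand side. -/
lemma sol_of_tendsto (hF1 : HypF1 F) (hF2 : HypF2 F) (hF3 : HypF3 F) {T k : ℝ} (hk : 0 < k)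
    {ωn : ℕ → Ω} {ω : Ω} {wn : ℕ → BU m} {w : BU m} (hwk : ∀ n, ‖wn n‖ ≤ k)
    (hω : Tendsto ωn atTop (𝓝 ω)) (hw : Tendsto (fun n => toX (wn n)) atTop (𝓝 (toX w)))
    (hsol : ∀ n, Sol σ ν F T (ωn n) (wn n)) : Sol σ ν F T ω w := by
  have hk' := norm_le_of_tendsto_toX hwk hw
  obtain ⟨C, hC⟩ := hF2 k hk
  have hD : ∀ r, Tendsto (fun n => neutralOp ν (shift r (wn n))) atTop
      (𝓝 (neutralOp ν (shift r w))) := fun r =>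
    tendsto_neutralOp ν (fun n => (norm_shift_le r _).trans (hwk n))
      fun s hs => tendsto_ev_of_toX (tendsto_toX_shift hw r) hs
  refine sol_of_integral_eq hF1.1 fun t ht => ?_
  refine tendsto_nhds_unique (f := fun n => ∫ s in (0 : ℝ)..t, F (σ s (ωn n)) (shift (T - s) (wn n)))
    (l := atTop) ?_ ?_
  · refine intervalIntegral.tendsto_integral_filter_of_dominated_convergence (fun _ => C) ?_ ?_
      intervalIntegrable_const ?_
    · exact Eventually.of_forall fun n => (continuous_rhs hF1.1 T _ _).aestronglyMeasurable
    · exact Eventually.of_forall fun n => Eventually.of_forall fun s _ =>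
        hC _ _ ((norm_shift_le _ _).trans (hwk n))
    · refine Eventually.of_forall fun s _ => ?_
      exact hF3 k hk _ _ _ _ (fun n => (norm_shift_le _ _).trans (hwk n))
        ((norm_shift_le _ _).trans hk')
        (((σ.continuous continuous_const continuous_id).tendsto ω).comp hω)
        (tendsto_toX_shift hw _)
  · refine ((hD (T - t)).sub (hD T)).congr fun n => ?_
    have := (hsol n).integral_eq hF1.1 le_rfl ht.1 ht.2
    rw [this, sub_zero]

lemma u_hist (hγ : ∃ γ, HalfWeight ν γ) (hF : HypF1 F) {ω : Ω} {x : BU m} {t T : ℝ}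
    (ht : 0 ≤ t) (htT : t ≤ T) (h : Defined σ ν F T ω x) :
    Defined σ ν F t ω x ∧ shift (T - t) (u σ ν F T ω x) = u σ ν F t ω x := by
  obtain ⟨h1, h2⟩ := u_spec h
  obtain ⟨h3, h4⟩ := (h1.restrict htT).eq_u hγ hF ht (x := x) (by
    rw [shift_shift ht (by linarith), add_sub_cancel, h2])
  exact ⟨h3, h4.symm⟩

/-- A forward orbit that is bounded and uniformly equicontinuous. -/
structure IsOrbit (σ : Flow ℝ Ω) (ν : Fin m → Fin m → FiniteMeasure Past)
    (F : Ω → BU m → Fin m → ℝ) (ω₀ : Ω) (U : ℝ → BU m) (k : ℝ) : Prop where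
  sol : ∀ T, 0 ≤ T → Sol σ ν F T ω₀ (U T)
  hist : ∀ t T, 0 ≤ t → t ≤ T → shift (T - t) (U T) = U t
  pos : 0 < k
  bound : ∀ t, 0 ≤ t → ‖U t‖ ≤ k
  equi : EquiUC (U '' Ici 0)

lemma ev_of_hist {U : ℝ → BU m} (hist : ∀ t T, 0 ≤ t → t ≤ T → shift (T - t) (U T) = U t)
    {t s : ℝ} (ht : 0 ≤ t) (hs : s ≤ 0) :
    ev (U t) s = ev (U (max (t + s) 0)) (min (t + s) 0) := by
  rcases le_total 0 (t + s) with h | h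
  · rw [max_eq_left h, min_eq_right h, ← hist (t + s) t h (by linarith), ev_shift_zero (by linarith)]
    congr 1
    ring
  · rw [max_eq_right h, min_eq_left h, ← hist 0 t le_rfl ht, ev_shift (by linarith) _ h]
    congr 1
    ring

/-- Each value in a history of the orbit is either a present value at an earlier time, controlled by
compactness in `X`, or a value of the initial function, which is bounded and uniformly continuous.
-/
lemma isOrbit_u (hγ : ∃ γ, HalfWeight ν γ) (hF : HypF1 F) {ω₀ : Ω} {x₀ : BU m}
    (hcomp : RelativelyCompactOrbit σ ν F ω₀ x₀) :
    ∃ k, IsOrbit σ ν F ω₀ (fun t => u σ ν F t ω₀ x₀) k := by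
  set U : ℝ → BU m := fun t => u σ ν F t ω₀ x₀ with hU
  obtain ⟨hdef, hC⟩ := hcomp
  have hist : ∀ t T, 0 ≤ t → t ≤ T → shift (T - t) (U T) = U t := fun t T ht htT =>
    (u_hist hγ hF ht htT (hdef T (ht.trans htT))).2
  have hC2 := hC.image continuous_snd
  have hmem : ∀ t, 0 ≤ t → toX (U t) ∈ Prod.snd '' closure {p : Ω × X m | ∃ t : ℝ, 0 ≤ t ∧
      p = (σ t ω₀, toX (u σ ν F t ω₀ x₀))} := fun t ht =>
    ⟨_, subset_closure ⟨t, ht, rfl⟩, rfl⟩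
  obtain ⟨k₁, hk₁⟩ := hC2.exists_bound_of_continuousOn
    (f := fun g : X m => g now) (ContinuousEvalConst.continuous_eval_const now).continuousOn
  have hev0 : ∀ t, 0 ≤ t → ‖ev (U t) 0‖ ≤ k₁ := fun t ht => by
    have h1 := hk₁ _ (hmem t ht)
    rw [← ev_now]
    exact h1
  refine ⟨max k₁ (max ‖U 0‖ 1), fun T hT => (u_spec (hdef T hT)).1, hist,
    lt_max_of_lt_right (lt_max_of_lt_right one_pos), fun t ht => ?_, ?_⟩
  · refine norm_le_of_ev (le_max_of_le_right (le_max_of_le_right zero_le_one)) fun s hs => ?_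
    rw [ev_of_hist hist ht hs]
    rcases le_total 0 (t + s) with h | h
    · rw [max_eq_left h, min_eq_right h]
      exact (hev0 _ h).trans (le_max_left _ _)
    · rw [max_eq_right h]
      exact (norm_ev_le _ _).trans ((le_max_left _ _).trans (le_max_right _ _))
  · have hlocal : ∀ ε : ℝ, 0 < ε → ∃ δ : ℝ, 0 < δ ∧ ∀ t, 0 ≤ t → ∀ a ∈ Icc 0 δ,
        ‖ev (U t) 0 - ev (U t) (-a)‖ ≤ ε := by
      by_contra! hcon
      obtain ⟨ε, hε, hcon⟩ := hcon
      choose tn htn an han hn using fun n : ℕ => hcon (1 / ((n : ℝ) + 1)) (by positivity)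
      obtain ⟨g, -, φ, hφ, hg⟩ := hC2.tendsto_subseq fun n => hmem (tn n) (htn n)
      have ha0 : Tendsto (fun n => clamp (-an (φ n))) atTop (𝓝 (clamp 0)) := by
        refine (uniformContinuous_clamp.continuous.tendsto 0).comp ?_
        rw [← neg_zero]
        refine Tendsto.neg ?_
        exact (squeeze_zero (fun n => (han n).1) (fun n => (han n).2)
          tendsto_one_div_add_atTop_nhds_zero_nat).comp hφ.tendsto_atTop
      have h1 : Tendsto (fun n => toX (U (tn (φ n))) (clamp (-an (φ n)))) atTop
          (𝓝 (g (clamp 0))) :=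
        ((ContinuousEval.continuous_eval (F := X m) (X := Past)).tendsto (g, clamp 0)).comp
          (hg.prodMk_nhds ha0)
      have h2 : Tendsto (fun n => toX (U (tn (φ n))) (clamp 0)) atTop (𝓝 (g (clamp 0))) :=
        ((ContinuousEvalConst.continuous_eval_const (F := X m) (clamp 0)).tendsto g).comp hg
      have h3 := (h2.sub h1).norm
      rw [sub_self, norm_zero] at h3
      exact absurd (ge_of_tendsto' h3 fun n => (hn (φ n)).le) (by linarith)
    intro ε hε
    obtain ⟨δ₁, hδ₁, h₁⟩ := hlocal (ε / 2) (by linarith)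
    obtain ⟨δ₂, hδ₂, h₂⟩ := equiUC_singleton (U 0) (ε / 2) (by linarith)
    refine ⟨min δ₁ δ₂, lt_min hδ₁ hδ₂, ?_⟩
    rintro _ ⟨t, ht, rfl⟩ a ha
    have ht' : 0 ≤ t := ht
    refine norm_le_of_ev hε.le fun s hs => ?_
    rw [ev_sub, ev_shift ha.1 _ hs, ev_of_hist hist ht hs,
      ev_of_hist hist ht (show s - a ≤ 0 by linarith [ha.1])]
    -- For `t + s ≥ 0` the local modulus at time `t + s` also covers steps that reach back across
    -- time `0`; otherwise both points lie in the initial history.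
    rcases le_total 0 (t + s) with h | h
    · rw [max_eq_left h, min_eq_right h]
      have h3 := h₁ (t + s) h a ⟨ha.1, ha.2.trans (min_le_left _ _)⟩
      rw [ev_of_hist hist h (show -a ≤ 0 by linarith [ha.1])] at h3
      rw [show t + (s - a) = t + s + -a by ring]
      linarith
    · have h' : t + (s - a) ≤ 0 := by linarith [ha.1]
      rw [max_eq_right h, min_eq_left h, max_eq_right h', min_eq_left h']
      have h3 := norm_ev_sub_le_of_shift (h₂ _ rfl) h h' (by
        rw [show t + s - (t + (s - a)) = a by ring, abs_of_nonneg ha.1]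
        exact ha.2.trans (min_le_right _ _))
      linarith

end Limits

/-! ### The omega-limit set -/

section OmegaLimit

variable {Ω : Type*} [MetricSpace Ω] {m : ℕ} {σ : Flow ℝ Ω}
  {ν : Fin m → Fin m → FiniteMeasure Past} {F : Ω → BU m → Fin m → ℝ}
  {ω₀ : Ω} {U : ℝ → BU m} {k : ℝ}

/-- The omega-limit set of the orbit `t ↦ (ω₀·t, U(t))`. -/
def omegaSet (σ : Flow ℝ Ω) (ω₀ : Ω) (U : ℝ → BU m) : Set (Ω × BU m) :=
  {p | ∃ tn : ℕ → ℝ, Tendsto tn atTop atTop ∧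
    Tendsto (fun n => σ (tn n) ω₀) atTop (𝓝 p.1) ∧
    Tendsto (fun n => toX (U (tn n))) atTop (𝓝 (toX p.2))}

lemma exists_seq_of_mem_omegaSet {p : Ω × BU m} (hp : p ∈ omegaSet σ ω₀ U) (r : ℝ) :
    ∃ tn : ℕ → ℝ, Tendsto tn atTop atTop ∧ (∀ n, r ≤ tn n) ∧
      Tendsto (fun n => σ (tn n) ω₀) atTop (𝓝 p.1) ∧
      Tendsto (fun n => toX (U (tn n))) atTop (𝓝 (toX p.2)) := by
  obtain ⟨tn, h1, h2, h3⟩ := hp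
  obtain ⟨N, hN⟩ := eventually_atTop.1 (h1.eventually_ge_atTop r)
  have h4 := tendsto_add_atTop_nat N
  exact ⟨fun n => tn (n + N), h1.comp h4, fun n => hN _ (Nat.le_add_left _ _), h2.comp h4,
    h3.comp h4⟩

lemma IsOrbit.exists_subseq (h : IsOrbit σ ν F ω₀ U k) {tn : ℕ → ℝ} (ht : ∀ n, 0 ≤ tn n) :
    ∃ φ : ℕ → ℕ, StrictMono φ ∧ ∃ w : BU m,
      Tendsto (fun n => toX (U (tn (φ n)))) atTop (𝓝 (toX w)) :=
  exists_subseq_tendsto h.equi (fun n => ⟨tn n, ht n, rfl⟩) fun n => h.bound _ (ht n)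

lemma IsOrbit.norm_le (h : IsOrbit σ ν F ω₀ U k) {p : Ω × BU m} (hp : p ∈ omegaSet σ ω₀ U) :
    ‖p.2‖ ≤ k := by
  obtain ⟨tn, -, h1, -, h2⟩ := exists_seq_of_mem_omegaSet hp 0
  exact norm_le_of_tendsto_toX (fun n => h.bound _ (h1 n)) h2

lemma tendsto_flow {ωn : ℕ → Ω} {ω : Ω} (h : Tendsto ωn atTop (𝓝 ω)) (t : ℝ) :
    Tendsto (fun n => σ t (ωn n)) atTop (𝓝 (σ t ω)) :=
  ((σ.continuous continuous_const continuous_id).tendsto ω).comp h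

/-- The solution from a limit point is a limit of the orbit at the delayed times `t + t_n`; this
gives global existence on the omega-limit set. -/
lemma IsOrbit.forward (h : IsOrbit σ ν F ω₀ U k) (hF1 : HypF1 F) (hF2 : HypF2 F) (hF3 : HypF3 F)
    {tn : ℕ → ℝ} (htn : Tendsto tn atTop atTop) (ht0 : ∀ n, 0 ≤ tn n) {ω : Ω} {x : BU m}
    (hω : Tendsto (fun n => σ (tn n) ω₀) atTop (𝓝 ω))
    (hx : Tendsto (fun n => toX (U (tn n))) atTop (𝓝 (toX x))) {t : ℝ} (ht : 0 ≤ t) :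
    ∃ φ : ℕ → ℕ, StrictMono φ ∧ ∃ w, Tendsto (fun n => toX (U (t + tn (φ n)))) atTop (𝓝 (toX w)) ∧
      Sol σ ν F t ω w ∧ shift t w = x ∧ (σ t ω, w) ∈ omegaSet σ ω₀ U := by
  have ht1 : ∀ n, 0 ≤ t + tn n := fun n => add_nonneg ht (ht0 n)
  obtain ⟨φ, hφ, w, hw⟩ := h.exists_subseq ht1
  refine ⟨φ, hφ, w, hw, ?_, ?_, ?_⟩
  · exact sol_of_tendsto hF1 hF2 hF3 h.pos (fun n => h.bound _ (ht1 (φ n)))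
      (hω.comp hφ.tendsto_atTop) hw fun n => (h.sol _ (ht1 (φ n))).restart (ht0 (φ n))
  · refine toX_injective (tendsto_nhds_unique (tendsto_toX_shift hw t) ?_)
    refine (hx.comp hφ.tendsto_atTop).congr fun n => ?_
    have := h.hist (tn (φ n)) (t + tn (φ n)) (ht0 _) (by linarith)
    rw [add_sub_cancel_right] at this
    rw [this, Function.comp_apply]
  · refine ⟨fun n => t + tn (φ n), tendsto_atTop_add_const_left _ _
      (htn.comp hφ.tendsto_atTop), ?_, hw⟩
    simp only [Flow.map_add]
    exact tendsto_flow (hω.comp hφ.tendsto_atTop) t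

lemma IsOrbit.positivelyInvariant (h : IsOrbit σ ν F ω₀ U k) (hγ : ∃ γ, HalfWeight ν γ)
    (hF1 : HypF1 F) (hF2 : HypF2 F) (hF3 : HypF3 F) :
    PositivelyInvariant σ ν F (omegaSet σ ω₀ U) := by
  intro p hp t ht
  obtain ⟨tn, h1, h2, h3, h4⟩ := exists_seq_of_mem_omegaSet hp 0
  obtain ⟨φ, -, w, -, h5, h6, h7⟩ := h.forward hF1 hF2 hF3 h1 h2 h3 h4 ht
  obtain ⟨h8, h9⟩ := h5.eq_u hγ hF1 ht h6
  exact ⟨h8, by rwa [h9]⟩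

/-- The function `p.2` itself records a backward orbit of `p`: moving the times `t_n` back by `r`
shifts the limit by `r`, and no subsequence is needed. -/
lemma IsOrbit.backward (h : IsOrbit σ ν F ω₀ U k) (hF1 : HypF1 F) (hF2 : HypF2 F) (hF3 : HypF3 F)
    {p : Ω × BU m} (hp : p ∈ omegaSet σ ω₀ U) {r : ℝ} (hr : 0 ≤ r) :
    (σ (-r) p.1, shift r p.2) ∈ omegaSet σ ω₀ U ∧ Sol σ ν F r (σ (-r) p.1) p.2 := by
  obtain ⟨tn, h1, h2, h3, h4⟩ := exists_seq_of_mem_omegaSet hp r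
  have h5 : Tendsto (fun n => σ (tn n - r) ω₀) atTop (𝓝 (σ (-r) p.1)) := by
    refine (tendsto_flow h3 (-r)).congr fun n => ?_
    rw [← Flow.map_add]
    congr 1
    ring
  constructor
  · refine ⟨fun n => tn n - r, tendsto_atTop_add_const_right _ _ h1, h5, ?_⟩
    refine (tendsto_toX_shift h4 r).congr fun n => ?_
    have := h.hist (tn n - r) (tn n) (by linarith [h2 n]) (by linarith)
    rw [sub_sub_cancel] at this
    rw [this]
  · refine sol_of_tendsto hF1 hF2 hF3 h.pos (fun n => h.bound _ (hr.trans (h2 n))) h5 h4 fun n => ?_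
    refine Sol.restart (by linarith [h2 n]) ?_
    rw [add_sub_cancel]
    exact h.sol _ (hr.trans (h2 n))

/-- Diagonal argument: each `pn n` is replaced by an orbit point at a time at least `n`, within
`1/(n+1)`, and the orbit is precompact. -/
lemma IsOrbit.exists_subseq_omegaSet [CompactSpace Ω] (h : IsOrbit σ ν F ω₀ U k)
    {pn : ℕ → Ω × BU m} (hp : ∀ n, pn n ∈ omegaSet σ ω₀ U) :
    ∃ φ : ℕ → ℕ, StrictMono φ ∧ ∃ p ∈ omegaSet σ ω₀ U,
      Tendsto (fun n => (pn (φ n)).1) atTop (𝓝 p.1) ∧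
      Tendsto (fun n => toX (pn (φ n)).2) atTop (𝓝 (toX p.2)) := by
  have h1 : ∀ n : ℕ, ∃ t : ℝ, (n : ℝ) ≤ t ∧ dist (σ t ω₀) (pn n).1 ≤ 1 / ((n : ℝ) + 1) ∧
      di (U t) (pn n).2 ≤ 1 / ((n : ℝ) + 1) := by
    intro n
    obtain ⟨tn, -, h2, h3, h4⟩ := exists_seq_of_mem_omegaSet (hp n) n
    have hpos : (0 : ℝ) < 1 / ((n : ℝ) + 1) := by positivity
    have h5 := (Metric.tendsto_nhds.1 h3) _ hpos
    have h6 := (tendsto_toX_iff_di.1 h4).eventually (gt_mem_nhds hpos)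
    obtain ⟨j, h7, h8⟩ := (h5.and h6).exists
    exact ⟨tn j, h2 j, h7.le, h8.le⟩
  choose tn htn hdist hdi using h1
  have ht0 : ∀ n, 0 ≤ tn n := fun n => (Nat.cast_nonneg n).trans (htn n)
  obtain ⟨φ, hφ, w, hw⟩ := h.exists_subseq ht0
  obtain ⟨ω, -, ψ, hψ, hω⟩ := isCompact_univ.tendsto_subseq
    fun n => mem_univ (σ (tn (φ n)) ω₀)
  have hφψ : Tendsto (fun n => φ (ψ n)) atTop atTop := hφ.tendsto_atTop.comp hψ.tendsto_atTop
  have hz := (tendsto_one_div_add_atTop_nhds_zero_nat (𝕜 := ℝ)).comp hφψ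
  have hw' := hw.comp hψ.tendsto_atTop
  refine ⟨fun n => φ (ψ n), hφ.comp hψ, (ω, w), ⟨fun n => tn (φ (ψ n)), ?_, hω, hw'⟩, ?_, ?_⟩
  · exact (tendsto_atTop_mono htn tendsto_natCast_atTop_atTop).comp hφψ
  · refine hω.congr_dist ?_
    exact squeeze_zero (fun _ => dist_nonneg) (fun n => hdist (φ (ψ n))) hz
  · rw [tendsto_toX_iff_di]
    have h2 := hz.add (tendsto_toX_iff_di.1 hw')
    rw [zero_add] at h2
    refine squeeze_zero (fun _ => di_nonneg _ _) (fun n => ?_) h2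
    refine (di_triangle _ (U (tn (φ (ψ n)))) _).trans (add_le_add ?_ le_rfl)
    rw [di_comm]
    exact hdi (φ (ψ n))

lemma IsOrbit.isCompact_omegaSet [CompactSpace Ω] (h : IsOrbit σ ν F ω₀ U k) :
    IsCompact ((fun p : Ω × BU m => (p.1, toX p.2)) '' omegaSet σ ω₀ U) := by
  refine IsSeqCompact.isCompact fun q hq => ?_
  choose pn hpn hpq using hq
  obtain ⟨φ, hφ, p, hp, h1, h2⟩ := h.exists_subseq_omegaSet hpn
  refine ⟨_, ⟨p, hp, rfl⟩, φ, hφ, ?_⟩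
  refine (h1.prodMk_nhds h2).congr fun n => ?_
  rw [Function.comp_apply, ← hpq]

end OmegaLimit

/-! ### Order stability of the omega-limit set -/

section OrderStability

variable {Ω : Type*} [MetricSpace Ω] {m : ℕ} {σ : Flow ℝ Ω}
  {ν : Fin m → Fin m → FiniteMeasure Past} {F : Ω → BU m → Fin m → ℝ}

lemma shift_comm {r q : ℝ} (hr : 0 ≤ r) (hq : 0 ≤ q) (x : BU m) :
    shift r (shift q x) = shift q (shift r x) := by
  rw [shift_shift hr hq, shift_shift hq hr, add_comm]

lemma BU_norm_add_le (x y : BU m) : ‖x + y‖ ≤ ‖x‖ + ‖y‖ := norm_add_le x y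

lemma BU_norm_sub_le (x y : BU m) : ‖x - y‖ ≤ ‖x‖ + ‖y‖ := norm_sub_le x y

lemma EquiUC.add_const {S : Set (BU m)} (hS : EquiUC S) (w : BU m) :
    EquiUC ((fun x => x + w) '' S) := by
  intro ε hε
  obtain ⟨δ₁, hδ₁, h₁⟩ := hS (ε / 2) (by linarith)
  obtain ⟨δ₂, hδ₂, h₂⟩ := equiUC_singleton w (ε / 2) (by linarith)
  refine ⟨min δ₁ δ₂, lt_min hδ₁ hδ₂, ?_⟩
  rintro _ ⟨x, hx, rfl⟩ a ha
  have h3 := h₁ x hx a ⟨ha.1, ha.2.trans (min_le_left _ _)⟩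
  have h4 := h₂ w rfl a ⟨ha.1, ha.2.trans (min_le_right _ _)⟩
  have h5 : x + w - shift a (x + w) = (x - shift a x) + (w - shift a w) := by
    apply BU_ext
    intro s hs
    simp only [ev_add, ev_sub, ev_shift ha.1 _ hs]
    abel
  rw [h5]
  exact (BU_norm_add_le _ _).trans (by linarith)

lemma Sol.norm_sub_le (hF : Continuous fun p : Ω × BU m => F p.1 p.2) {T k C : ℝ} {ω : Ω}
    {w : BU m} (h : Sol σ ν F T ω w) (hk : ‖w‖ ≤ k) (hC : ∀ ω, ∀ x ∈ B m k, ‖F ω x‖ ≤ C)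
    {b c : ℝ} (hb : 0 ≤ b) (hbc : b ≤ c) (hc : c ≤ T) :
    ‖neutralOp ν (shift b w) - neutralOp ν (shift c w)‖ ≤ C * (c - b) := by
  have h1 := h.integral_eq hF (a := T - c) (b := T - b) (by linarith) (by linarith) (by linarith)
  rw [sub_sub_cancel, sub_sub_cancel] at h1
  rw [← h1]
  have h2 := intervalIntegral.norm_integral_le_of_norm_le_const (a := T - c) (b := T - b)
    (f := fun s => F (σ s ω) (shift (T - s) w)) (C := C)
    fun s _ => hC _ _ ((norm_shift_le _ _).trans hk)
  rwa [show T - b - (T - c) = c - b by ring, abs_of_nonneg (by linarith)] at h2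

/-- Needed for perturbed solutions, which do not lie on the precompact orbit. An increment `w -
shift a w` has small `D` because `F` is bounded, and small past because `S` is equicontinuous;
`norm_ev_zero_le` then makes it small. -/
lemma equiUC_of_sol (hγ : ∃ γ, HalfWeight ν γ) (hF1 : HypF1 F) (hF2 : HypF2 F) {T k : ℝ}
    (hT : 0 ≤ T) (hk : 0 < k) {S : Set (BU m)} (hS : EquiUC S) :
    EquiUC {w | ‖w‖ ≤ k ∧ shift T w ∈ S ∧ ∃ ω, Sol σ ν F T ω w} := by
  obtain ⟨C, hC⟩ := hF2 k hk
  obtain ⟨A, hA0, hA⟩ := norm_ev_zero_le hγ T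
  have hM := mass_nonneg ν
  intro ε hε
  -- The constants make `|C| * a` and `(2 + mass ν) * ρ` each at most `ε / (2 * (A + 1))`; the
  -- estimate multiplies their sum by `A`.
  obtain ⟨δ, hδ, hδS⟩ := hS (ε / (2 * (A + 1) * (2 + mass ν))) (by positivity)
  refine ⟨min δ (ε / (2 * (A + 1) * (|C| + 1))), lt_min hδ (by positivity), ?_⟩
  rintro w ⟨hwk, hwS, ω, hw⟩ a ha
  set ρ := ε / (2 * (A + 1) * (2 + mass ν)) with hρ
  have hρ0 : 0 < ρ := by positivity
  have haδ : a ≤ δ := ha.2.trans (min_le_left _ _)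
  have haC : |C| * a ≤ ε / (2 * (A + 1)) := by
    have h1 : a ≤ ε / (2 * (A + 1) * (|C| + 1)) := ha.2.trans (min_le_right _ _)
    rw [le_div_iff₀ (by positivity)] at h1 ⊢
    have h2 : 0 ≤ a * (2 * (A + 1)) := mul_nonneg ha.1 (by positivity)
    linarith
  have hpast : ‖shift T (w - shift a w)‖ ≤ ρ := by
    rw [shift_sub, shift_comm hT ha.1]
    exact hδS _ hwS a ⟨ha.1, haδ⟩
  have hD : ∀ b ∈ Icc 0 T, ‖neutralOp ν (shift b (w - shift a w))‖
      ≤ |C| * a + (1 + mass ν) * ρ := by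
    intro b hb
    rw [shift_sub, neutralOp_sub, shift_shift hb.1 ha.1]
    -- Either the increment stays within `[0,T]`, or it straddles time `0` and is split there into a
    -- solution part and an initial part.
    rcases le_total (b + a) T with h | h
    · have h1 := hw.norm_sub_le hF1.1 hwk hC hb.1 (show b ≤ b + a by linarith [ha.1]) h
      rw [add_sub_cancel_left] at h1
      have h2 : C * a ≤ |C| * a := mul_le_mul_of_nonneg_right (le_abs_self C) ha.1
      have h3 : 0 ≤ (1 + mass ν) * ρ := by positivity
      linarith
    · have h1 := hw.norm_sub_le hF1.1 hwk hC hb.1 hb.2 le_rfl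
      have h2 : shift (b + a) w = shift (b + a - T) (shift T w) := by
        rw [shift_shift (by linarith) hT, sub_add_cancel]
      have h3 : ‖neutralOp ν (shift T w) - neutralOp ν (shift (b + a) w)‖ ≤ (1 + mass ν) * ρ := by
        rw [h2, ← neutralOp_sub]
        refine (norm_neutralOp_le ν _).trans (mul_le_mul_of_nonneg_left ?_ (by linarith))
        exact hδS _ hwS _ ⟨by linarith, by linarith [hb.2]⟩
      have h4 : C * (T - b) ≤ |C| * a :=
        (mul_le_mul_of_nonneg_right (le_abs_self C) (by linarith [hb.2])).trans
          (mul_le_mul_of_nonneg_left (by linarith) (abs_nonneg C))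
      have h5 := norm_sub_le_norm_sub_add_norm_sub (neutralOp ν (shift b w))
        (neutralOp ν (shift T w)) (neutralOp ν (shift (b + a) w))
      linarith
  have h1 := hA T ⟨hT, le_rfl⟩ (w - shift a w) (|C| * a + (1 + mass ν) * ρ)
    (add_nonneg (mul_nonneg (abs_nonneg C) ha.1) (by positivity)) hD
  refine h1.trans ?_
  have h2 : (2 + mass ν) * ρ = ε / (2 * (A + 1)) := by
    rw [hρ]
    field_simp
  calc A * (|C| * a + (1 + mass ν) * ρ + ‖shift T (w - shift a w)‖)
      ≤ A * (ε / (2 * (A + 1)) + ε / (2 * (A + 1))) :=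
        mul_le_mul_of_nonneg_left (by linarith) hA0
    _ = A * ε / (A + 1) := by field_simp; ring
    _ ≤ ε := by
        rw [div_le_iff₀ (by positivity)]
        linarith

/-- The difference `y - x` is added to the orbit points `U(t_n)`, and orbit stability is passed to
the limit. -/
lemma IsOrbit.stable_omegaSet {le : BU m → BU m → Prop}
    (hle : ∀ a b c d : BU m, b - a = d - c → le a b → le c d)
    (hγ : ∃ γ, HalfWeight ν γ) (hF1 : HypF1 F) (hF2 : HypF2 F) (hF3 : HypF3 F)
    {ω₀ : Ω} {x₀ : BU m} {k₀ : ℝ} (h : IsOrbit σ ν F ω₀ (fun t => u σ ν F t ω₀ x₀) k₀)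
    (hstab : OrbitStableForOrder σ ν F le ω₀ x₀) {k ε : ℝ} (hk : 0 < k) (hε : 0 < ε) :
    ∃ δ : ℝ, 0 < δ ∧ ∀ (ω : Ω) (x y : BU m),
      (ω, x) ∈ omegaSet σ ω₀ (fun t => u σ ν F t ω₀ x₀) → y ∈ B m k → di x y < δ →
      (le x y ∨ le y x) →
      ∀ t : ℝ, 0 ≤ t → Defined σ ν F t ω y ∧ di (u σ ν F t ω x) (u σ ν F t ω y) ≤ ε := by
  have hk₀ := h.pos
  -- The radius covers `‖U(t_n)‖ + ‖y‖ + ‖x‖` and a tube of radius `1` about the orbit. The value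
  -- `1/4 = (1/2) * (1/(1+1))` of the first term of the metric keeps present values within `1` of
  -- the orbit.
  obtain ⟨δ, hδ, hst⟩ := hstab (k + 2 * k₀ + 1) (by linarith) (min ε (1 / 4))
    (lt_min hε (by norm_num))
  refine ⟨δ, hδ, fun ω x y hx hy hxy hord T hT => ?_⟩
  have hxk := h.norm_le hx
  obtain ⟨tn, ht1, ht0, hω, hu⟩ := exists_seq_of_mem_omegaSet hx 0
  simp only at hω hu
  set U : ℝ → BU m := fun t => u σ ν F t ω₀ x₀ with hU
  set yn : ℕ → BU m := fun n => U (tn n) + (y - x) with hyn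
  have hdiff : ∀ n, yn n - U (tn n) = y - x := fun n => by
    simp only [hyn]
    abel
  have hynk : ∀ n, ‖yn n‖ ≤ k + 2 * k₀ + 1 := fun n => by
    have h1 := BU_norm_add_le (U (tn n)) (y - x)
    have h2 := BU_norm_sub_le y x
    have h3 := h.bound (tn n) (ht0 n)
    have h4 : ‖y‖ ≤ k := hy
    simp only [hyn]
    linarith
  have hdiff' : ∀ n, U (tn n) - yn n = x - y := fun n => by
    simp only [hyn]
    abel
  have hstn : ∀ n t, 0 ≤ t → Defined σ ν F t (σ (tn n) ω₀) (yn n) ∧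
      di (U (t + tn n)) (u σ ν F t (σ (tn n) ω₀) (yn n)) ≤ min ε (1 / 4) := by
    intro n
    refine hst (tn n) (ht0 n) (yn n) (hynk n) ?_ ?_
    · rw [di_congr (hdiff' n)]
      exact hxy.le
    · rcases hord with h1 | h1
      · exact Or.inr (hle _ _ _ _ (hdiff n).symm h1)
      · exact Or.inl (hle _ _ _ _ (hdiff' n).symm h1)
  set wn : ℕ → BU m := fun n => u σ ν F T (σ (tn n) ω₀) (yn n) with hwn
  have hwsol : ∀ n, Sol σ ν F T (σ (tn n) ω₀) (wn n) ∧ shift T (wn n) = yn n := fun n =>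
    u_spec (hstn n T hT).1
  have hwk : ∀ n, ‖wn n‖ ≤ k + 2 * k₀ + 1 := by
    intro n
    refine norm_le_of_ev (by linarith) fun s hs => ?_
    rcases le_total (-T) s with h1 | h1
    · have h2 := (hstn n (T + s) (by linarith)).2
      have h3 := (u_hist hγ hF1 (show 0 ≤ T + s by linarith) (by linarith) (hstn n T hT).1).2
      rw [← h3, show T - (T + s) = -s by ring] at h2
      have h4 := norm_ev_sub_le_of_di (n := 0) (η := 1) zero_le_one
        (h2.trans ((min_le_right _ _).trans (by norm_num))) (s := 0) (by norm_num) le_rfl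
      rw [ev_shift_zero (r := -s) (by linarith), neg_neg] at h4
      have h5 := (norm_ev_le (U (T + s + tn n)) 0).trans
        (h.bound _ (by linarith [ht0 n]))
      have h6 := norm_sub_norm_le (ev (wn n) s) (ev (U (T + s + tn n)) 0)
      rw [norm_sub_rev] at h6
      linarith
    · have h2 := (norm_ev_le (yn n) (s + T)).trans (hynk n)
      rwa [← (hwsol n).2, ev_shift hT _ (by linarith), add_sub_cancel_right] at h2
  have hequi := equiUC_of_sol (σ := σ) hγ hF1 hF2 hT (show 0 < k + 2 * k₀ + 1 by linarith)
    (h.equi.add_const (y - x))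
  have hux : Tendsto (fun n => toX (yn n)) atTop (𝓝 (toX y)) := tendsto_toX_of_sub hdiff hu
  obtain ⟨φ, hφ, w, hw⟩ := exists_subseq_tendsto hequi
    (fun n => ⟨hwk n, by rw [(hwsol n).2]; exact ⟨U (tn n), ⟨tn n, ht0 n, rfl⟩, rfl⟩, _, (hwsol n).1⟩)
    hwk
  have hφ' := hφ.tendsto_atTop
  obtain ⟨ψ, hψ, v, hv, hv1, hv2, -⟩ := h.forward hF1 hF2 hF3 (ht1.comp hφ') (fun n => ht0 (φ n))
    (hω.comp hφ') (hu.comp hφ') hT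
  have hw1 : Sol σ ν F T ω w := sol_of_tendsto hF1 hF2 hF3 (by linarith) (fun n => hwk (φ n))
    (hω.comp hφ') hw fun n => (hwsol (φ n)).1
  have hw2 : shift T w = y := by
    refine toX_injective (tendsto_nhds_unique (tendsto_toX_shift hw T) ?_)
    refine (hux.comp hφ').congr fun n => ?_
    rw [Function.comp_apply, (hwsol (φ n)).2]
  obtain ⟨h1, h2⟩ := hw1.eq_u hγ hF1 hT hw2
  obtain ⟨-, h3⟩ := hv1.eq_u hγ hF1 hT hv2
  refine ⟨h1, ?_⟩
  rw [h2, h3]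
  exact di_le_of_tendsto hv (hw.comp hψ.tendsto_atTop)
    fun n => ((hstn (φ (ψ n)) T hT).2).trans (min_le_left _ _)

end OrderStability

/-! ### Stable neutral operators -/

section Stable

variable {m : ℕ} {ν : Fin m → Fin m → FiniteMeasure Past}

/-- `HalfWeight` allows `γ = 0`, whereas decay of `e^{γt}` at `-∞` requires `γ > 0`. -/
lemma HalfWeight.add_one {γ : ℝ} (h : HalfWeight ν γ) : HalfWeight ν (γ + 1) := by
  refine ⟨by linarith [h.1], fun i => (Finset.sum_le_sum fun j _ => ?_).trans (h.2 i)⟩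
  refine integral_mono (integrable_exp_past (by linarith [h.1]) i j) (integrable_exp_past h.1 i j)
    fun s => ?_
  have hs : (s : ℝ) ≤ 0 := s.2
  exact Real.exp_le_exp.2 (by linarith)

/-- The convolution of a function on the line with the measures `e^{γ s} dν(s)`. -/
def conv (ν : Fin m → Fin m → FiniteMeasure Past) (γ : ℝ) (f : ℝ → Fin m → ℝ) (t : ℝ) :
    Fin m → ℝ :=
  fun i => ∑ j, ∫ s : Past, Real.exp (γ * s) * f (t + s) j ∂(ν i j : Measure Past)

lemma norm_exp_mul_le {γ : ℝ} (hγ : 0 ≤ γ) {f : ℝ → Fin m → ℝ} {C : ℝ} (hC : ∀ t, ‖f t‖ ≤ C)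
    (t : ℝ) (j : Fin m) (s : Past) : ‖Real.exp (γ * s) * f (t + s) j‖ ≤ C := by
  have h1 : Real.exp (γ * s) ≤ 1 :=
    Real.exp_le_one_iff.2 (mul_nonpos_of_nonneg_of_nonpos hγ s.2)
  have h2 : ‖f (t + s) j‖ ≤ C := (norm_le_pi_norm _ j).trans (hC _)
  rw [norm_mul, Real.norm_eq_abs, Real.abs_exp]
  calc _ ≤ 1 * ‖f (t + s) j‖ := mul_le_mul_of_nonneg_right h1 (norm_nonneg _)
    _ ≤ C := by rwa [one_mul]

lemma integrable_exp_mul {γ : ℝ} (hγ : 0 ≤ γ) {f : ℝ → Fin m → ℝ} (hf : Continuous f) {C : ℝ}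
    (hC : ∀ t, ‖f t‖ ≤ C) (t : ℝ) (i j : Fin m) :
    Integrable (fun s : Past => Real.exp (γ * s) * f (t + s) j) (ν i j : Measure Past) :=
  Integrable.of_bound (C := C) (Continuous.aestronglyMeasurable (by fun_prop))
    (Eventually.of_forall (norm_exp_mul_le hγ hC t j))

lemma continuous_conv {γ : ℝ} (hγ : 0 ≤ γ) {f : ℝ → Fin m → ℝ} (hf : Continuous f) {C : ℝ}
    (hC : ∀ t, ‖f t‖ ≤ C) : Continuous (conv ν γ f) := by
  refine continuous_pi fun i => continuous_finsetSum _ fun j _ => ?_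
  refine continuous_of_dominated (bound := fun _ => C) (fun t => ?_) (fun t => ?_)
    (integrable_const C) (Eventually.of_forall fun s => ?_)
  · exact (integrable_exp_mul hγ hf hC t i j).aestronglyMeasurable
  · exact Eventually.of_forall (norm_exp_mul_le hγ hC t j)
  · fun_prop

lemma conv_sub {γ : ℝ} (hγ : 0 ≤ γ) {f g : ℝ → Fin m → ℝ} (hf : Continuous f) (hg : Continuous g)
    {C C' : ℝ} (hC : ∀ t, ‖f t‖ ≤ C) (hC' : ∀ t, ‖g t‖ ≤ C') (t : ℝ) :
    conv ν γ (fun s => f s - g s) t = conv ν γ f t - conv ν γ g t := by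
  funext i
  simp only [conv, Pi.sub_apply, mul_sub]
  rw [← Finset.sum_sub_distrib]
  exact Finset.sum_congr rfl fun j _ =>
    integral_sub (integrable_exp_mul hγ hf hC t i j) (integrable_exp_mul hγ hg hC' t i j)

lemma HalfWeight.norm_conv_le {γ : ℝ} (h : HalfWeight ν γ) {f : ℝ → Fin m → ℝ} {C t : ℝ}
    (hC0 : 0 ≤ C) (hC : ∀ s ≤ t, ‖f s‖ ≤ C) : ‖conv ν γ f t‖ ≤ C / 2 := by
  refine (pi_norm_le_iff_of_nonneg (by positivity)).2 fun i => ?_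
  have h1 := h.abs_sum_integral_le (f := fun s j => Real.exp (γ * s) * f (t + s) j) hC0 le_rfl
    (fun s => ?_) i
  · rw [mul_zero, add_zero] at h1
    exact h1
  · have hs : (s : ℝ) ≤ 0 := s.2
    rw [add_zero]
    refine (pi_norm_le_iff_of_nonneg (by positivity)).2 fun j => ?_
    rw [norm_mul, Real.norm_eq_abs, Real.abs_exp]
    exact mul_le_mul_of_nonneg_left ((norm_le_pi_norm _ j).trans (hC _ (by linarith)))
      (Real.exp_pos _).le

/-- The bounded solution of `u = G + conv u`. -/
lemma HalfWeight.exists_fixed {γ : ℝ} (h : HalfWeight ν γ) (G : ℝ →ᵇ (Fin m → ℝ)) :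
    ∃ u : ℝ →ᵇ (Fin m → ℝ), ∀ t, u t = G t + conv ν γ u t := by
  set Φ : (ℝ →ᵇ (Fin m → ℝ)) → (ℝ →ᵇ (Fin m → ℝ)) := fun u =>
    G + BoundedContinuousFunction.ofNormedAddCommGroup (conv ν γ u)
      (continuous_conv h.1 u.continuous u.norm_coe_le_norm) (‖u‖ / 2)
      (fun t => h.norm_conv_le (norm_nonneg u) fun s _ => u.norm_coe_le_norm s) with hΦ
  have hval : ∀ u t, Φ u t = G t + conv ν γ u t := fun u t => rfl
  have hcontr : ContractingWith (1 / 2) Φ := by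
    refine ⟨by rw [← NNReal.coe_lt_coe]; norm_num, LipschitzWith.of_dist_le_mul fun u v => ?_⟩
    rw [dist_eq_norm, dist_eq_norm]
    refine (BoundedContinuousFunction.norm_le (by positivity)).2 fun t => ?_
    have h1 : (Φ u - Φ v) t = conv ν γ (fun s => u s - v s) t := by
      rw [conv_sub h.1 u.continuous v.continuous u.norm_coe_le_norm v.norm_coe_le_norm,
        BoundedContinuousFunction.sub_apply, hval, hval]
      abel
    rw [h1]
    refine (h.norm_conv_le (norm_nonneg (u - v)) fun s _ => (u - v).norm_coe_le_norm s).trans ?_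
    push_cast
    linarith
  have : Nonempty (ℝ →ᵇ (Fin m → ℝ)) := ⟨0⟩
  refine ⟨hcontr.fixedPoint Φ, fun t => ?_⟩
  rw [← hval, hcontr.fixedPoint_isFixedPt.eq]

/-- The convolution is causal, so the supremum `S` over `(-∞,T]` satisfies `S ≤ d + S/2`. -/
lemma HalfWeight.norm_fixed_le {γ : ℝ} (h : HalfWeight ν γ) {G : ℝ → Fin m → ℝ}
    {u : ℝ →ᵇ (Fin m → ℝ)} (hu : ∀ t, u t = G t + conv ν γ u t) {T d : ℝ}
    (hd : ∀ t ≤ T, ‖G t‖ ≤ d) {t : ℝ} (ht : t ≤ T) : ‖u t‖ ≤ 2 * d := by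
  have hd0 : 0 ≤ d := (norm_nonneg _).trans (hd t ht)
  set S : ℝ := ⨆ s : Set.Iic T, ‖u s‖ with hS
  have hle : ∀ s ≤ T, ‖u s‖ ≤ S := fun s hs =>
    le_ciSup (f := fun s : Set.Iic T => ‖u s‖)
      ⟨‖u‖, by rintro _ ⟨s, rfl⟩; exact u.norm_coe_le_norm _⟩ ⟨s, hs⟩
  have hS0 : 0 ≤ S := Real.iSup_nonneg fun _ => norm_nonneg _
  have h1 : S ≤ d + S / 2 := by
    refine Real.iSup_le (fun s => ?_) (by positivity)
    rw [hu s]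
    exact (norm_add_le _ _).trans (add_le_add (hd s s.2)
      (h.norm_conv_le hS0 fun q hq => hle q (hq.trans s.2)))
  have h2 := hle t ht
  linarith

lemma uniformContinuous_past_of_tendsto {f : ℝ → Fin m → ℝ} (hf : Continuous f)
    (h0 : Tendsto f atBot (𝓝 0)) (t : ℝ) : UniformContinuous fun s : Past => f (t + s) := by
  refine Continuous.uniformContinuous_of_tendsto_cocompact (x := 0) (by fun_prop) ?_
  have h1 : Tendsto (fun s : Past => (s : ℝ)) (cocompact Past) atBot := by
    rw [tendsto_atBot]
    intro b
    rw [Filter.Eventually, mem_cocompact]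
    refine ⟨{s : Past | b ≤ (s : ℝ)}, ?_, fun s hs => ?_⟩
    · rw [Topology.IsInducing.subtypeVal.isCompact_iff]
      convert! isCompact_Icc (a := b) (b := 0) using 1
      ext s
      constructor
      · rintro ⟨t, ht, rfl⟩
        exact ⟨ht, t.2⟩
      · exact fun hs => ⟨⟨s, hs.2⟩, hs.1, rfl⟩
    · exact (not_le.1 (show ¬ b ≤ (s : ℝ) from hs)).le
  exact h0.comp (tendsto_atBot_add_const_left _ t h1)

/-- With `e(t) = e^{γt} w(t)`, the forced equation becomes the contraction equation for `w` with
forcing `e^{-γt} r(t)`. Freezing that forcing at its value at `0` for `t < 0` keeps it bounded and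
continuous, lets `e` decay at `-∞`, and makes `e(T)` depend only on `r` over `[0,T]`. -/
lemma HalfWeight.exists_forced {γ : ℝ} (hγ : 0 < γ) (h : HalfWeight ν γ) {r : ℝ → Fin m → ℝ}
    (hr : Continuous r) {c : ℝ} (hc : ∀ t, ‖r t‖ ≤ c) :
    ∃ e : ℝ → Fin m → ℝ, Continuous e ∧ Tendsto e atBot (𝓝 0) ∧
      (∀ t s, s ≤ t → ‖e s‖ ≤ Real.exp (γ * t) * (2 * c)) ∧
      (∀ t, 0 ≤ t → ∀ i, e t i - ∑ j, ∫ s : Past, e (t + s) j ∂(ν i j : Measure Past) = r t i) ∧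
      ∀ T d, 0 ≤ T → (∀ t ∈ Icc 0 T, ‖r t‖ ≤ d) → ‖e T‖ ≤ Real.exp (γ * T) * (2 * d) := by
  set g : ℝ → Fin m → ℝ := fun t => Real.exp (-(γ * max t 0)) • r (max t 0) with hg
  have hgexp : ∀ t, ‖g t‖ ≤ ‖r (max t 0)‖ := fun t => by
    simp only [hg]
    rw [norm_smul, Real.norm_eq_abs, Real.abs_exp]
    refine mul_le_of_le_one_left (norm_nonneg _) (Real.exp_le_one_iff.2 ?_)
    have := mul_nonneg hγ.le (le_max_right t 0)
    linarith
  have hgc : Continuous g := by fun_prop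
  obtain ⟨w, hw⟩ := h.exists_fixed (BoundedContinuousFunction.ofNormedAddCommGroup g hgc c
    fun t => (hgexp t).trans (hc _))
  replace hw : ∀ t, w t = g t + conv ν γ w t := hw
  have hwb : ∀ t, ‖w t‖ ≤ 2 * c := fun t =>
    h.norm_fixed_le hw (T := t) (fun s _ => (hgexp s).trans (hc _)) le_rfl
  have heb : ∀ t s, s ≤ t → ‖Real.exp (γ * s) • w s‖ ≤ Real.exp (γ * t) * (2 * c) := by
    intro t s hst
    rw [norm_smul, Real.norm_eq_abs, Real.abs_exp]
    exact mul_le_mul (Real.exp_le_exp.2 (mul_le_mul_of_nonneg_left hst hγ.le)) (hwb s)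
      (norm_nonneg _) (Real.exp_pos _).le
  refine ⟨fun t => Real.exp (γ * t) • w t, ?_, ?_, heb, fun t ht i => ?_, fun T d hT hd => ?_⟩
  · have := w.continuous
    fun_prop
  · rw [tendsto_zero_iff_norm_tendsto_zero]
    have h1 : Tendsto (fun t => Real.exp (γ * t) * (2 * c)) atBot (𝓝 0) := by
      have h2 := (Real.tendsto_exp_atBot.comp (tendsto_id.const_mul_atBot hγ)).mul_const (2 * c)
      rw [zero_mul] at h2
      exact h2
    exact squeeze_zero (fun _ => norm_nonneg _) (fun t => heb t t le_rfl) h1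
  · have h1 : ∀ j, ∫ s : Past, (Real.exp (γ * (t + s)) • w (t + s)) j ∂(ν i j : Measure Past)
        = Real.exp (γ * t) * ∫ s : Past, Real.exp (γ * s) * w (t + s) j
          ∂(ν i j : Measure Past) := fun j => by
      rw [← integral_const_mul]
      refine integral_congr_ae (Eventually.of_forall fun s => ?_)
      simp only [Pi.smul_apply, smul_eq_mul]
      rw [mul_add, Real.exp_add, mul_assoc]
    simp only [h1]
    rw [← Finset.mul_sum]
    have h2 := congrFun (hw t) i
    simp only [hg, max_eq_left ht, Pi.add_apply, Pi.smul_apply, smul_eq_mul, conv] at h2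
    have h3 : Real.exp (γ * t) * Real.exp (-(γ * t)) = 1 := by
      rw [← Real.exp_add, add_neg_cancel, Real.exp_zero]
    rw [Pi.smul_apply, smul_eq_mul]
    linear_combination (Real.exp (γ * t)) * h2 + (r t i) * h3
  · simp only
    rw [norm_smul, Real.norm_eq_abs, Real.abs_exp]
    refine mul_le_mul_of_nonneg_left (h.norm_fixed_le hw (T := T) (fun t ht => ?_) le_rfl)
      (Real.exp_pos _).le
    exact (hgexp t).trans (hd _ ⟨le_max_right _ _, max_le ht hT⟩)

lemma continuous_residual {z : ℝ → Fin m → ℝ} (hz : Continuous z) {C : ℝ} (hC : ∀ t, ‖z t‖ ≤ C) :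
    Continuous fun t i => z t i - ∑ j, ∫ s : Past, z (t + s) j ∂(ν i j : Measure Past) := by
  have h1 := continuous_conv (ν := ν) le_rfl hz hC
  refine (hz.sub h1).congr fun t => ?_
  funext i
  simp [conv]

lemma norm_residual_le {z : ℝ → Fin m → ℝ} {C : ℝ} (hC : ∀ t, ‖z t‖ ≤ C) (t : ℝ) :
    ‖fun i => z t i - ∑ j, ∫ s : Past, z (t + s) j ∂(ν i j : Measure Past)‖
      ≤ (1 + mass ν) * C := by
  have hM := mass_nonneg ν
  have hC0 : 0 ≤ C := (norm_nonneg _).trans (hC t)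
  refine (pi_norm_le_iff_of_nonneg (by positivity)).2 fun i => ?_
  have h1 := abs_sum_integral_le ν hC0 (fun s : Past => z (t + s)) (fun s => hC _) i
  have h2 : |z t i| ≤ C := (norm_le_pi_norm (z t) i).trans (hC t)
  have h3 := abs_sub (z t i) (∑ j, ∫ s : Past, z (t + s) j ∂(ν i j : Measure Past))
  rw [Real.norm_eq_abs]
  linarith

/-- Subtracting from `z` the solution forced by its own residual leaves a solution of the
homogeneous equation, to which stability of `D` applies. -/
lemma exists_homogeneous {γ : ℝ} (hγ : 0 < γ) (h : HalfWeight ν γ) {z : ℝ → Fin m → ℝ}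
    (hz : UniformContinuous z) {c : ℝ} (hc : ∀ t, ‖z t‖ ≤ c) :
    ∃ (e : ℝ → Fin m → ℝ) (v : ℝ → BU m), (∀ t, IsHistory (fun t => z t - e t) t (v t)) ∧
      (∀ t, 0 ≤ t → neutralOp ν (v t) = 0) ∧ ‖v 0‖ ≤ (3 + 2 * mass ν) * c ∧
      ∀ T d, 0 ≤ T →
        (∀ t ∈ Icc 0 T, ‖fun i => z t i - ∑ j, ∫ s : Past, z (t + s) j ∂(ν i j : Measure Past)‖
          ≤ d) → ‖e T‖ ≤ Real.exp (γ * T) * (2 * d) := by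
  have hM := mass_nonneg ν
  have hc0 : 0 ≤ c := (norm_nonneg _).trans (hc 0)
  obtain ⟨e, hec, he0, heb, heq, heT⟩ :=
    h.exists_forced hγ (continuous_residual hz.continuous hc) (norm_residual_le (ν := ν) hc)
  have huc : ∀ t, UniformContinuous fun s : Past => z (t + s) - e (t + s) := fun t =>
    UniformContinuous.sub (hz.comp (uniformContinuous_const.add uniformContinuous_subtype_val))
      (uniformContinuous_past_of_tendsto hec he0 t)
  have hvb : ∀ t s, s ≤ 0 → ‖z (t + s) - e (t + s)‖
      ≤ c + Real.exp (γ * t) * (2 * ((1 + mass ν) * c)) := fun t s hs =>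
    (norm_sub_le _ _).trans (add_le_add (hc _) (heb t _ (by linarith)))
  have hevv : ∀ t s, s ≤ 0 → ev (mkBU (fun s => z (t + s) - e (t + s)) (huc t) _ (hvb t)) s
      = z (t + s) - e (t + s) := fun t s hs => ev_mkBU hs
  refine ⟨e, fun t => mkBU (fun s => z (t + s) - e (t + s)) (huc t) _ (hvb t), fun t s => ?_,
    fun t ht => ?_, ?_, heT⟩
  · rw [← ev_coe, hevv t s s.2]
  · funext i
    rw [neutralOp_apply, hevv t 0 le_rfl, add_zero]
    have h1 : ∀ j, ∫ s : Past, ev (mkBU (fun s => z (t + s) - e (t + s)) (huc t) _ (hvb t)) s j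
        ∂(ν i j : Measure Past) = ∫ s : Past, z (t + s) j ∂(ν i j : Measure Past)
          - ∫ s : Past, e (t + s) j ∂(ν i j : Measure Past) := fun j => by
      rw [← integral_sub]
      · exact integral_congr_ae (Eventually.of_forall fun s => congrFun (hevv t s s.2) j)
      · have h2 := hz.continuous
        exact Integrable.of_bound (C := c) (Continuous.aestronglyMeasurable (by fun_prop))
          (Eventually.of_forall fun s => (norm_le_pi_norm _ j).trans (hc _))
      · exact Integrable.of_bound (C := Real.exp (γ * t) * (2 * ((1 + mass ν) * c)))
          (Continuous.aestronglyMeasurable (by fun_prop))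
          (Eventually.of_forall fun s => (norm_le_pi_norm _ j).trans
            (heb t _ (by have : (s : ℝ) ≤ 0 := s.2; linarith)))
    simp only [h1]
    rw [Finset.sum_sub_distrib, Pi.sub_apply, Pi.zero_apply]
    have h2 := heq t ht i
    linarith
  · refine norm_le_of_ev (by positivity) fun s hs => ?_
    rw [hevv 0 s hs]
    refine (hvb 0 s hs).trans (le_of_eq ?_)
    rw [mul_zero, Real.exp_zero]
    ring

/-- The origin of time is moved to `-T`, so `x(0)` becomes the value at time `T`. The homogeneous
part has decayed to `η * ‖x‖` by then, and the forced part is controlled by `D` on the window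
`[0,T]` alone. -/
lemma StableOp.estimate (hst : StableOp ν) (hγ : ∃ γ, HalfWeight ν γ) {η : ℝ} (hη : 0 < η) :
    ∃ T C : ℝ, 0 ≤ T ∧ 0 ≤ C ∧ ∀ (x : BU m) (d : ℝ),
      (∀ a ∈ Icc 0 T, ‖neutralOp ν (shift a x)‖ ≤ d) → ‖ev x 0‖ ≤ η * ‖x‖ + C * d := by
  obtain ⟨γ', h'⟩ := hγ
  obtain ⟨γ, hγ0, h⟩ : ∃ γ : ℝ, 0 < γ ∧ HalfWeight ν γ := ⟨γ' + 1, by linarith [h'.1], h'.add_one⟩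
  obtain ⟨c, -, hc0, hc, hsol⟩ := hst
  have hM := mass_nonneg ν
  obtain ⟨T, hT0, hT⟩ : ∃ T, 0 ≤ T ∧ c T * (3 + 2 * mass ν) ≤ η := by
    have h1 := hc.mul_const (3 + 2 * mass ν)
    rw [zero_mul] at h1
    obtain ⟨T, h2, h3⟩ := ((h1.eventually (gt_mem_nhds hη)).and (eventually_ge_atTop 0)).exists
    exact ⟨T, h3, h2.le⟩
  refine ⟨T, 2 * Real.exp (γ * T), hT0, by positivity, fun x d hd => ?_⟩
  obtain ⟨e, v, hhist, hDv, hv0, heT⟩ := exists_homogeneous hγ0 h (z := fun t => ev x (t - T))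
    ((uniformContinuous_ev x).comp (uniformContinuous_id.sub uniformContinuous_const))
    fun t => norm_ev_le x _
  have hy := hsol (v 0) (fun t => ev x (t - T) - e t) v (hDv 0 le_rfl) rfl
    (fun t _ => hhist t) hDv T hT0
  have he := heT T d hT0 fun t ht => ?_
  · have hx : ev x 0 = (ev x (T - T) - e T) + e T := by rw [sub_add_cancel, sub_self]
    rw [hx]
    refine (norm_add_le _ _).trans (add_le_add ?_ (he.trans (le_of_eq (by ring))))
    refine hy.trans ((mul_le_mul_of_nonneg_left hv0 (hc0 T hT0)).trans ?_)
    rw [← mul_assoc]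
    exact mul_le_mul_of_nonneg_right hT (BU_norm_nonneg x)
  · refine le_of_eq_of_le (congrArg norm ?_) (hd (T - t) ⟨by linarith [ht.2], by linarith [ht.1]⟩)
    funext i
    rw [neutralOp_apply, ev_shift_zero (by linarith [ht.2]), neg_sub]
    congr 1
    refine Finset.sum_congr rfl fun j _ => integral_congr_ae (Eventually.of_forall fun s => ?_)
    have hs : (s : ℝ) ≤ 0 := s.2
    simp only
    rw [ev_shift (by linarith [ht.2]) _ hs, show t + (s : ℝ) - T = s - (T - t) by ring]

/-- Here `D x = x(0)`, so the delay cases join the neutral one with `c = 0`. -/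
lemma stableOp_of_eq_zero (hν : ∀ i j, ν i j = 0) : StableOp ν := by
  refine ⟨fun _ => 0, continuousOn_const, fun _ _ => le_rfl, tendsto_const_nhds, ?_⟩
  intro φ z v _ _ hz hD t ht
  have h1 : ev (v t) 0 = 0 := by
    rw [← hD t ht]
    funext i
    simp [neutralOp_apply, hν]
  have h2 := hz t ht now
  rw [ev_now, h1, show t + ((now : Past) : ℝ) = t from add_zero t] at h2
  simp [← h2]

end Stable

/-! ### Quasipositive matrices -/

section QuasipositiveMatrix

open Matrix

variable {m : ℕ} {A : Matrix (Fin m) (Fin m) ℝ}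

lemma exists_norm_mulVec_le (A : Matrix (Fin m) (Fin m) ℝ) :
    ∃ a : ℝ, 0 < a ∧ ∀ v : Fin m → ℝ, ‖A *ᵥ v‖ ≤ a * ‖v‖ := by
  set L := LinearMap.toContinuousLinearMap (Matrix.mulVecLin A)
  refine ⟨‖L‖ + 1, by positivity, fun v => ?_⟩
  have h1 : ‖A *ᵥ v‖ ≤ ‖L‖ * ‖v‖ := L.le_opNorm v
  linarith [norm_nonneg v]

lemma mulVec_nonneg {B : Matrix (Fin m) (Fin m) ℝ} (hB : ∀ i j, 0 ≤ B i j) {v : Fin m → ℝ}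
    (hv : 0 ≤ v) : 0 ≤ B *ᵥ v := by
  intro i
  simp only [Matrix.mulVec, dotProduct]
  exact Finset.sum_nonneg fun j _ => mul_nonneg (hB i j) (hv j)

lemma pow_entry_nonneg {B : Matrix (Fin m) (Fin m) ℝ} (hB : ∀ i j, 0 ≤ B i j) (n : ℕ) :
    ∀ i j, 0 ≤ (B ^ n) i j := by
  induction n with
  | zero =>
    intro i j
    rw [pow_zero, Matrix.one_apply]
    split_ifs <;> norm_num
  | succ n ih =>
    intro i j
    rw [pow_succ, Matrix.mul_apply]
    exact Finset.sum_nonneg fun l _ => mul_nonneg (ih i l) (hB l j)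

section

attribute [local instance] Matrix.linftyOpNormedRing Matrix.linftyOpNormedAlgebra

lemma exp_entry_nonneg_of_nonneg {B : Matrix (Fin m) (Fin m) ℝ} (hB : ∀ i j, 0 ≤ B i j) :
    ∀ i j, 0 ≤ (NormedSpace.exp B) i j := by
  intro i j
  have h1 := NormedSpace.exp_series_hasSum_exp' (𝕂 := ℝ) B
  have h2 : HasSum (fun n : ℕ => ((n.factorial : ℝ)⁻¹ • B ^ n) i j) (NormedSpace.exp B i j) :=
    Pi.hasSum.1 (Pi.hasSum.1 h1 i) j
  refine h2.nonneg fun n => ?_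
  rw [Matrix.smul_apply, smul_eq_mul]
  exact mul_nonneg (by positivity) (pow_entry_nonneg hB n i j)

/-- Write `tA = -tl I + t(A + lI)`: the summands commute, and the exponential of a nonnegative
matrix is nonnegative. -/
lemma Quasipositive.exp_nonneg (hA : Quasipositive A) {t : ℝ} (ht : 0 ≤ t) :
    ∀ i j, 0 ≤ (NormedSpace.exp (t • A)) i j := by
  obtain ⟨l, -, hl⟩ := hA
  intro i j
  have h1 : t • A = (-(t * l)) • (1 : Matrix (Fin m) (Fin m) ℝ)
      + t • (A + l • (1 : Matrix (Fin m) (Fin m) ℝ)) := by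
    rw [smul_add, smul_smul, neg_smul]
    abel
  have h2 : NormedSpace.exp ((-(t * l)) • (1 : Matrix (Fin m) (Fin m) ℝ))
      = Real.exp (-(t * l)) • (1 : Matrix (Fin m) (Fin m) ℝ) := by
    have h3 := NormedSpace.algebraMap_exp_comm (𝕂 := ℝ) (𝔸 := Matrix (Fin m) (Fin m) ℝ) (-(t * l))
    rw [Algebra.algebraMap_eq_smul_one, Algebra.algebraMap_eq_smul_one,
      ← Real.exp_eq_exp_ℝ] at h3
    exact h3.symm
  rw [h1, Matrix.exp_add_of_commute _ _ ((Commute.one_left _).smul_left _), h2, smul_mul_assoc,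
    one_mul, Matrix.smul_apply, smul_eq_mul]
  refine mul_nonneg (Real.exp_pos _).le (exp_entry_nonneg_of_nonneg (fun i j => ?_) i j)
  rw [Matrix.smul_apply, smul_eq_mul]
  exact mul_nonneg ht (hl i j)

lemma hasDerivAt_exp_mulVec (A : Matrix (Fin m) (Fin m) ℝ) (v : Fin m → ℝ) :
    HasDerivAt (fun t : ℝ => NormedSpace.exp (t • A) *ᵥ v) (A *ᵥ v) 0 := by
  have h1 := hasDerivAt_exp_smul_const A (0 : ℝ)
  set L : Matrix (Fin m) (Fin m) ℝ →ₗ[ℝ] (Fin m → ℝ) :=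
    { toFun := fun B => B *ᵥ v
      map_add' := fun B C => Matrix.add_mulVec B C v
      map_smul' := fun c B => Matrix.smul_mulVec c B v }
  have h2 := (LinearMap.toContinuousLinearMap L).hasFDerivAt.comp_hasDerivAt (0 : ℝ) h1
  rw [zero_smul, NormedSpace.exp_zero, one_mul] at h2
  exact h2

lemma continuous_exp_smul (A : Matrix (Fin m) (Fin m) ℝ) :
    Continuous fun t : ℝ => NormedSpace.exp (t • A) :=
  continuous_iff_continuousAt.2 fun t => (hasDerivAt_exp_smul_const A t).continuousAt

lemma exp_smul_add (A : Matrix (Fin m) (Fin m) ℝ) (s t : ℝ) :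
    NormedSpace.exp ((s + t) • A) = NormedSpace.exp (s • A) * NormedSpace.exp (t • A) := by
  rw [add_smul]
  exact Matrix.exp_add_of_commute _ _ (((Commute.refl A).smul_left s).smul_right t)

end

/-- A differential inequality, in terms of lower right derivatives, implies the inequality that
defines the exponential ordering. -/
lemma Quasipositive.exp_mulVec_le (hA : Quasipositive A) {f : ℝ → Fin m → ℝ} {s t : ℝ}
    (hst : s ≤ t) (hf : ContinuousOn f (Icc s t))
    (hf' : ∀ τ ∈ Ico s t, ∀ ε : ℝ, 0 < ε → ∀ᶠ z in 𝓝[>] τ, ∀ i,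
      (z - τ) * ((A *ᵥ f τ) i - ε) ≤ f z i - f τ i) :
    NormedSpace.exp ((t - s) • A) *ᵥ f s ≤ f t := by
  intro i
  have hE : ∀ j, Continuous fun τ : ℝ => NormedSpace.exp ((t - τ) • A) i j := fun j =>
    ((continuous_exp_smul A).comp (continuous_const.sub continuous_id)).matrix_elem i j
  obtain ⟨R, hR⟩ := isCompact_Icc.exists_bound_of_continuousOn (s := Icc s t)
    (f := fun τ => ∑ j, NormedSpace.exp ((t - τ) • A) i j)
    (continuous_finsetSum _ fun j _ => hE j).continuousOn
  -- Variation of constants: each component of `τ ↦ e^{(t-τ)A} f(τ)` is nondecreasing, and its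
  -- values at `s` and `t` are the two sides.
  have key := image_le_of_liminf_slope_right_le_deriv_boundary
    (f := fun τ => -(NormedSpace.exp ((t - τ) • A) *ᵥ f τ) i) (a := s) (b := t)
    (B := fun _ => -(NormedSpace.exp ((t - s) • A) *ᵥ f s) i) (B' := fun _ => 0)
    ?_ le_rfl continuousOn_const (fun _ _ => hasDerivWithinAt_const _ _ _) ?_
    (right_mem_Icc.2 hst)
  · simp only [sub_self, zero_smul, NormedSpace.exp_zero, Matrix.one_mulVec] at key
    linarith
  · simp only [Matrix.mulVec, dotProduct]
    refine ContinuousOn.neg (continuousOn_finsetSum _ fun j _ => ?_)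
    exact (hE j).continuousOn.mul ((continuous_apply j).comp_continuousOn hf)
  · intro τ hτ r hr
    refine Eventually.frequently ?_
    have hR' : 0 < |R| + 1 := by positivity
    -- Two errors `ε * (z - τ)` arise, from `f` and from the exponential; the nonnegative row of the
    -- exponential, of sum at most `|R|`, multiplies them by less than `r / (2ε)`.
    set ε := r / (4 * (|R| + 1)) with hε
    have hε0 : 0 < ε := by positivity
    have h1 : ∀ᶠ z in 𝓝[>] τ, ∀ j,
        (NormedSpace.exp ((z - τ) • A) *ᵥ f τ) j - f τ j ≤ (z - τ) * ((A *ᵥ f τ) j + ε) := by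
      rw [eventually_all]
      intro j
      have h2 : HasDerivAt (fun z : ℝ => (NormedSpace.exp ((z - τ) • A) *ᵥ f τ) j)
          ((A *ᵥ f τ) j) τ := by
        have h3 := hasDerivAt_exp_mulVec A (f τ)
        rw [← sub_self τ] at h3
        have h4 := h3.comp_sub_const τ τ
        exact (hasDerivAt_pi.1 h4) j
      have h5 := (hasDerivAt_iff_tendsto_slope.1 h2).mono_left
        (nhdsWithin_mono τ (show Ioi τ ⊆ {τ}ᶜ from fun z hz => ne_of_gt hz))
      filter_upwards [h5.eventually (gt_mem_nhds (show (A *ᵥ f τ) j < (A *ᵥ f τ) j + ε by linarith)),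
        self_mem_nhdsWithin] with z hz hzτ
      have hzτ' : 0 < z - τ := sub_pos.2 hzτ
      rw [slope_def_field, div_lt_iff₀ hzτ'] at hz
      simp only [sub_self, zero_smul, NormedSpace.exp_zero, Matrix.one_mulVec] at hz
      linarith
    filter_upwards [h1, hf' τ hτ ε hε0, self_mem_nhdsWithin, Ioo_mem_nhdsGT hτ.2]
      with z hz1 hz2 hzτ hzt
    have hzτ' : 0 < z - τ := sub_pos.2 hzτ
    have hnn := hA.exp_nonneg (show 0 ≤ t - z by linarith [hzt.2])
    have h3 : NormedSpace.exp ((t - τ) • A) *ᵥ f τ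
        = NormedSpace.exp ((t - z) • A) *ᵥ (NormedSpace.exp ((z - τ) • A) *ᵥ f τ) := by
      rw [Matrix.mulVec_mulVec, ← exp_smul_add, sub_add_sub_cancel]
    have h4 : (NormedSpace.exp ((t - z) • A) *ᵥ (NormedSpace.exp ((z - τ) • A) *ᵥ f τ)) i
        - (NormedSpace.exp ((t - z) • A) *ᵥ f z) i
        ≤ (∑ j, NormedSpace.exp ((t - z) • A) i j) * (2 * ε * (z - τ)) := by
      simp only [Matrix.mulVec, dotProduct]
      rw [← Finset.sum_sub_distrib, Finset.sum_mul]
      refine Finset.sum_le_sum fun j _ => ?_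
      rw [← mul_sub]
      refine mul_le_mul_of_nonneg_left ?_ (hnn i j)
      have h5 := hz1 j
      have h6 := hz2 j
      simp only [Matrix.mulVec, dotProduct] at h5 h6
      linarith
    have h5 : ∑ j, NormedSpace.exp ((t - z) • A) i j ≤ |R| :=
      (le_abs_self _).trans ((hR z ⟨by linarith [hτ.1], hzt.2.le⟩).trans (le_abs_self R))
    have h6 : (∑ j, NormedSpace.exp ((t - z) • A) i j) * (2 * ε * (z - τ))
        ≤ |R| * (2 * ε * (z - τ)) := mul_le_mul_of_nonneg_right h5 (by positivity)
    have h7 : |R| * (2 * ε) < r := by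
      have h8 : (|R| + 1) * (4 * ε) = r := by
        rw [hε]
        field_simp
      nlinarith [abs_nonneg R]
    rw [slope_def_field, div_lt_iff₀ hzτ', h3]
    nlinarith

/-- The same for the sum of a differentiable function and a Lipschitz perturbation. -/
lemma Quasipositive.exp_mulVec_add_le (hA : Quasipositive A) {f f' h : ℝ → Fin m → ℝ}
    {l : ℝ → ℝ} {s t : ℝ} (hst : s ≤ t) (hf : ∀ τ, HasDerivAt f (f' τ) τ) (hh : Continuous h)
    (hl : ∀ τ ∈ Ico s t, ∀ z ∈ Ioc τ t, ‖h z - h τ‖ ≤ l τ * (z - τ))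
    (hf' : ∀ τ ∈ Ico s t, ∀ i, (A *ᵥ (f τ + h τ)) i + l τ ≤ f' τ i) :
    NormedSpace.exp ((t - s) • A) *ᵥ (f s + h s) ≤ f t + h t := by
  have hfc : Continuous f := continuous_iff_continuousAt.2 fun τ => (hf τ).continuousAt
  refine hA.exp_mulVec_le (f := fun τ => f τ + h τ) hst (hfc.add hh).continuousOn
    fun τ hτ ε hε => ?_
  have h1 : ∀ᶠ z in 𝓝[>] τ, ∀ i, (z - τ) * (f' τ i - ε) ≤ f z i - f τ i := by
    rw [eventually_all]
    intro i
    have h5 := (hasDerivAt_iff_tendsto_slope.1 (hasDerivAt_pi.1 (hf τ) i)).mono_left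
      (nhdsWithin_mono τ (show Ioi τ ⊆ {τ}ᶜ from fun z hz => ne_of_gt hz))
    filter_upwards [h5.eventually (lt_mem_nhds (show f' τ i - ε < f' τ i by linarith)),
      self_mem_nhdsWithin] with z hz hzτ
    have hzτ' : 0 < z - τ := sub_pos.2 hzτ
    rw [slope_def_field, lt_div_iff₀ hzτ'] at hz
    linarith
  filter_upwards [h1, Ioc_mem_nhdsGT hτ.2] with z hz1 hz2 i
  have h2 := (norm_le_pi_norm (h z - h τ) i).trans (hl τ hτ z hz2)
  rw [Pi.sub_apply, Real.norm_eq_abs] at h2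
  have h3 := neg_abs_le (h z i - h τ i)
  have h4 : 0 ≤ (z - τ) * (f' τ i - ((A *ᵥ (f τ + h τ)) i + l τ)) :=
    mul_nonneg (by linarith [hz2.1]) (by linarith [hf' τ hτ i])
  have h5 := hz1 i
  simp only [Pi.add_apply]
  linarith

/-- A real kernel vector would be a complex eigenvector of `A` with eigenvalue `μ ≥ 0`. -/
lemma EigenvaluesNeg.det_ne_zero (hE : EigenvaluesNeg A) {μ : ℝ} (hμ : 0 ≤ μ) :
    (μ • (1 : Matrix (Fin m) (Fin m) ℝ) - A).det ≠ 0 := by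
  intro h
  obtain ⟨v, hv0, hv⟩ := Matrix.exists_mulVec_eq_zero_iff.2 h
  rw [Matrix.sub_mulVec, Matrix.smul_mulVec, Matrix.one_mulVec, sub_eq_zero] at hv
  refine absurd (hE (μ : ℂ) (Module.End.hasEigenvalue_of_hasEigenvector
    (x := fun i => (v i : ℂ)) ⟨?_, ?_⟩)) (by simpa using hμ)
  · rw [Module.End.mem_eigenspace_iff, Matrix.toLin'_apply]
    funext i
    have h1 := congrFun hv i
    simp only [Matrix.mulVec, dotProduct, Pi.smul_apply, smul_eq_mul, Matrix.map_apply] at h1 ⊢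
    rw [← Complex.ofReal_mul, h1]
    push_cast
    rfl
  · intro h1
    refine hv0 (funext fun i => ?_)
    exact Complex.ofReal_eq_zero.1 (congrFun h1 i)

/-- A quasipositive matrix whose eigenvalues have negative real parts has a positive
supersolution. -/
lemma Quasipositive.exists_pos (hA : Quasipositive A) (hE : EigenvaluesNeg A) :
    ∃ (p : Fin m → ℝ) (q : ℝ), 0 < q ∧ (∀ i, q ≤ p i) ∧ ∀ i, (A *ᵥ p) i = -1 := by
  obtain ⟨l, hl0, hl⟩ := hA
  -- Continuation of `p(μ) = (μ - A)⁻¹ 1` down to `μ = 0`. The set where `p(μ) ≥ 0` is closed in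
  -- `[0,∞)`, and open because `p(μ) ≥ 0` forces `p(μ) ≥ 1/(μ + l)`.
  set p : ℝ → Fin m → ℝ := fun μ => (μ • (1 : Matrix (Fin m) (Fin m) ℝ) - A)⁻¹ *ᵥ 1 with hp
  have heq : ∀ μ, 0 ≤ μ → ∀ i, μ * p μ i = 1 + (A *ᵥ p μ) i := by
    intro μ hμ i
    have h1 : (μ • (1 : Matrix (Fin m) (Fin m) ℝ) - A) *ᵥ p μ = 1 := by
      rw [hp, Matrix.mulVec_mulVec, Matrix.mul_nonsing_inv _ (hE.det_ne_zero hμ).isUnit,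
        Matrix.one_mulVec]
    have h2 := congrFun h1 i
    rw [Matrix.sub_mulVec, Matrix.smul_mulVec, Matrix.one_mulVec] at h2
    simp only [Pi.sub_apply, Pi.smul_apply, smul_eq_mul, Pi.one_apply] at h2
    linarith
  have hlow : ∀ μ, 0 ≤ μ → 0 ≤ p μ → ∀ i, 1 ≤ (μ + l) * p μ i := by
    intro μ hμ hpos i
    have h1 := mulVec_nonneg hl hpos i
    rw [Matrix.add_mulVec, Matrix.smul_mulVec, Matrix.one_mulVec] at h1
    simp only [Pi.add_apply, Pi.smul_apply, smul_eq_mul, Pi.zero_apply] at h1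
    have h2 := heq μ hμ i
    linarith
  have hcont : Continuous fun μ : Ici (0 : ℝ) => p μ := by
    have h1 : Continuous fun μ : Ici (0 : ℝ) => ((μ : ℝ) • (1 : Matrix (Fin m) (Fin m) ℝ) - A) :=
      (continuous_subtype_val.smul continuous_const).sub continuous_const
    refine Continuous.matrix_mulVec ?_ continuous_const
    simp only [Matrix.inv_def, Ring.inverse_eq_inv']
    exact (h1.matrix_det.inv₀ fun μ => hE.det_ne_zero μ.2).smul h1.matrix_adjugate
  have hclopen : IsClopen {μ : Ici (0 : ℝ) | ∀ i, 0 ≤ p μ i} := by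
    constructor
    · simp only [ofPred_forall]
      exact isClosed_iInter fun i =>
        isClosed_le continuous_const ((continuous_apply i).comp hcont)
    · have h1 : {μ : Ici (0 : ℝ) | ∀ i, 0 ≤ p μ i} = {μ : Ici (0 : ℝ) | ∀ i, 0 < p μ i} := by
        ext μ
        refine ⟨fun h i => ?_, fun h i => (h i).le⟩
        have hμ : (0 : ℝ) ≤ μ := μ.2
        exact pos_of_mul_pos_right (lt_of_lt_of_le one_pos (hlow μ hμ h i)) (by linarith)
      rw [h1]
      simp only [ofPred_forall]
      exact isOpen_iInter_of_finite fun i =>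
        isOpen_lt continuous_const ((continuous_apply i).comp hcont)
  have hne : {μ : Ici (0 : ℝ) | ∀ i, 0 ≤ p μ i}.Nonempty := by
    obtain ⟨a, ha, hab⟩ := exists_norm_mulVec_le A
    have h2a : (0 : ℝ) ≤ 2 * a := by positivity
    refine ⟨⟨2 * a, h2a⟩, fun i => ?_⟩
    -- At `μ = 2a` this gives `a‖p‖ ≤ 1`, hence `μ p = 1 + A p ≥ 0`.
    have h1 : 2 * a * ‖p (2 * a)‖ ≤ 1 + a * ‖p (2 * a)‖ := by
      have h2 : ‖(2 * a) • p (2 * a)‖ ≤ 1 + a * ‖p (2 * a)‖ := by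
        refine (pi_norm_le_iff_of_nonneg (by positivity)).2 fun j => ?_
        rw [Pi.smul_apply, smul_eq_mul, heq _ h2a j]
        refine (norm_add_le _ _).trans ?_
        rw [norm_one]
        exact add_le_add le_rfl ((norm_le_pi_norm _ j).trans (hab _))
      rwa [norm_smul, Real.norm_of_nonneg h2a] at h2
    have h3 := (norm_le_pi_norm (A *ᵥ p (2 * a)) i).trans (hab _)
    rw [Real.norm_eq_abs] at h3
    have h4 := neg_abs_le ((A *ᵥ p (2 * a)) i)
    have h5 := heq _ h2a i
    have h6 : 0 ≤ 2 * a * p (2 * a) i := by linarith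
    exact nonneg_of_mul_nonneg_right h6 (by positivity)
  have : PreconnectedSpace (Ici (0 : ℝ)) :=
    isPreconnected_iff_preconnectedSpace.1 isPreconnected_Ici
  have huniv := hclopen.eq_univ hne
  have h0 : 0 ≤ p 0 := fun i => by
    have h1 : (⟨0, self_mem_Ici⟩ : Ici (0 : ℝ)) ∈ {μ : Ici (0 : ℝ) | ∀ i, 0 ≤ p μ i} := by
      rw [huniv]
      trivial
    exact h1 i
  refine ⟨p 0, 1 / l, by positivity, fun i => ?_, fun i => ?_⟩
  · rw [div_le_iff₀ hl0]
    have := hlow 0 le_rfl h0 i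
    linarith
  · have := heq 0 le_rfl i
    linarith

end QuasipositiveMatrix

/-! ### Upper bounds for the exponential orderings -/

section Order

open Matrix

variable {m : ℕ} {A : Matrix (Fin m) (Fin m) ℝ}

/-- The order involves only differences; this translation invariance allows perturbing the orbit
instead of its limits. -/
lemma leR_of_sub_eq {r : ℝ} {a b c d : BU m} (h : b - a = d - c) (hab : leR A r a b) :
    leR A r c d := by
  have h1 : ∀ s : Past, b.1 s - a.1 s = d.1 s - c.1 s := fun s => by
    have h2 := congrArg (fun z => ev z (s : ℝ)) h
    simp only [ev_sub] at h2
    rwa [ev_coe, ev_coe, ev_coe, ev_coe] at h2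
  refine ⟨fun s => ?_, fun s t hs hst => ?_⟩
  · rw [← sub_nonneg, ← h1, sub_nonneg]
    exact hab.1 s
  · rw [← h1, ← h1]
    exact hab.2 s t hs hst

lemma leInf_iff {x y : BU m} : leInf A x y ↔ ∀ r : ℝ, 0 ≤ r → leR A r x y := by
  refine ⟨fun h r _ => ⟨h.1, fun s t _ hst => h.2 s t hst⟩, fun h => ⟨(h 0 le_rfl).1, ?_⟩⟩
  intro s t hst
  have hs : (s : ℝ) ≤ 0 := s.2
  exact (h (-s) (by linarith)).2 s t (by linarith) hst

lemma leInf_of_sub_eq {a b c d : BU m} (h : b - a = d - c) (hab : leInf A a b) :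
    leInf A c d := by
  rw [leInf_iff] at hab ⊢
  exact fun r hr => leR_of_sub_eq h (hab r hr)

lemma leR_zero {r : ℝ} {z : BU m} (h0 : ∀ s : ℝ, s ≤ 0 → 0 ≤ ev z s)
    (h : ∀ s t : ℝ, -r ≤ s → s ≤ t → t ≤ 0 →
      NormedSpace.exp ((t - s) • A) *ᵥ ev z s ≤ ev z t) : leR A r 0 z := by
  refine ⟨fun s => ?_, fun s t hs hst => ?_⟩
  · rw [← ev_coe, ← ev_coe]
    exact h0 s s.2
  · rw [← ev_coe, ← ev_coe, ← ev_coe, ← ev_coe, ev_zero, ev_zero, sub_zero, sub_zero]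
    exact h s t hs hst t.2

/-- The order `le` admits small upper bounds: functions `h` that are small and have a small
Lipschitz constant on a long interval are dominated, in the sense `0 ≤ w` and `0 ≤ w + h`, by
bounded functions `w` that are small on a given interval. -/
def Dominating (le : BU m → BU m → Prop) : Prop :=
  ∀ M : ℝ, 0 < M → ∃ K : ℝ, 0 < K ∧ ∀ ε : ℝ, 0 < ε → ∀ N₀ : ℕ, ∃ η : ℝ, 0 < η ∧ ∃ N : ℕ,
    ∀ h : BU m, ‖h‖ ≤ M →
      (∀ s s' : ℝ, s' ≤ s → s ≤ 0 → ‖ev h s - ev h s'‖ ≤ M * (s - s')) →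
      (∀ s : ℝ, -(N : ℝ) ≤ s → s ≤ 0 → ‖ev h s‖ ≤ η) →
      (∀ s s' : ℝ, -(N : ℝ) ≤ s' → s' ≤ s → s ≤ 0 → ‖ev h s - ev h s'‖ ≤ η * (s - s')) →
      ∃ w : BU m, ‖w‖ ≤ K ∧ (∀ s : ℝ, -(N₀ : ℝ) ≤ s → s ≤ 0 → ‖ev w s‖ ≤ ε) ∧
        le 0 w ∧ le 0 (w + h)

lemma norm_const_le {c : ℝ} (hc : 0 ≤ c) : ‖(fun _ : Fin m => c)‖ ≤ c :=
  (pi_norm_le_iff_of_nonneg hc).2 fun _ => le_of_eq (Real.norm_of_nonneg hc)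

lemma nonneg_add_of_norm_le {u v : Fin m → ℝ} (h : ∀ i, ‖v‖ ≤ u i) : 0 ≤ u + v := fun i => by
  have h1 := (norm_le_pi_norm v i).trans (h i)
  rw [Real.norm_eq_abs] at h1
  have h2 := neg_abs_le (v i)
  simp only [Pi.zero_apply, Pi.add_apply]
  linarith

lemma mulVec_apply_le {a : ℝ} (ha : ∀ v : Fin m → ℝ, ‖A *ᵥ v‖ ≤ a * ‖v‖) (v : Fin m → ℝ)
    (i : Fin m) : (A *ᵥ v) i ≤ a * ‖v‖ :=
  (le_abs_self _).trans ((norm_le_pi_norm (A *ᵥ v) i).trans (ha v))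

/-- Before `-r` the order is pointwise and the amplitude suffices. After `-r` the amplitude is a
constant `C ≥ (1 + a) * η`, and growth at rate `a + 1` beats `A(w + k)` plus the Lipschitz constant
`η`. The cases `k = 0` and `k = h` give the two required relations. -/
lemma Quasipositive.leR_of_formula (hA : Quasipositive A) {a : ℝ} (ha0 : 0 < a)
    (ha : ∀ v : Fin m → ℝ, ‖A *ᵥ v‖ ≤ a * ‖v‖) {r η : ℝ} (hη : 0 ≤ η) {h k w : BU m}
    (hw : ∀ s ≤ 0, ev w s = fun _ =>
      ((1 + a) * η + ‖ev h (min s (-r))‖) * Real.exp ((a + 1) * max (s + r) 0))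
    (hkh : ∀ s, ‖ev k s‖ ≤ ‖ev h s‖) (hh : ∀ s, -r ≤ s → s ≤ 0 → ‖ev h s‖ ≤ η)
    (hk : ∀ s s' : ℝ, -r ≤ s' → s' ≤ s → s ≤ 0 → ‖ev k s - ev k s'‖ ≤ η * (s - s')) :
    leR A r 0 (w + k) := by
  have haη : 0 ≤ a * η := by positivity
  refine leR_zero (fun s hs => ?_) fun s t hs hst ht => ?_
  · rw [ev_add, hw s hs]
    refine nonneg_add_of_norm_le fun _ => (hkh s).trans ?_
    have h1 : 1 ≤ Real.exp ((a + 1) * max (s + r) 0) :=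
      Real.one_le_exp (mul_nonneg (by linarith) (le_max_right _ _))
    have h2 : ‖ev h s‖ ≤ (1 + a) * η + ‖ev h (min s (-r))‖ := by
      rcases le_total s (-r) with h3 | h3
      · rw [min_eq_left h3]
        linarith
      · linarith [hh s h3 hs, norm_nonneg (ev h (min s (-r)))]
    exact h2.trans (le_mul_of_one_le_right ((norm_nonneg _).trans h2) h1)
  · set C := (1 + a) * η + ‖ev h (-r)‖ with hC
    have hC1 : (1 + a) * η ≤ C := le_add_of_nonneg_right (norm_nonneg _)
    have hC0 : 0 ≤ C := by linarith
    have hw' : ∀ τ, -r ≤ τ → τ ≤ 0 → ev (w + k) τ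
        = (fun _ => C * Real.exp ((a + 1) * (τ + r))) + ev k τ := fun τ h1 h2 => by
      rw [ev_add, hw τ h2, min_eq_right h1, max_eq_left (by linarith)]
    rw [hw' s hs (hst.trans ht), hw' t (hs.trans hst) ht]
    refine hA.exp_mulVec_add_le (f := fun τ _ => C * Real.exp ((a + 1) * (τ + r)))
      (f' := fun τ _ => C * (Real.exp ((a + 1) * (τ + r)) * (a + 1))) (l := fun _ => η) hst
      (fun τ => ?_) (continuous_ev k) (fun τ hτ z hz => ?_) fun τ hτ i => ?_
    · refine hasDerivAt_pi.2 fun _ => HasDerivAt.const_mul C (HasDerivAt.exp ?_)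
      simpa using ((hasDerivAt_id τ).add_const r).const_mul (a + 1)
    · exact hk z τ (hs.trans hτ.1) hz.1.le (hz.2.trans ht)
    · have hτ1 : -r ≤ τ := hs.trans hτ.1
      have h1 : 1 ≤ Real.exp ((a + 1) * (τ + r)) :=
        Real.one_le_exp (mul_nonneg (by linarith) (by linarith))
      have h2 : C ≤ C * Real.exp ((a + 1) * (τ + r)) := le_mul_of_one_le_right hC0 h1
      have h3 := mulVec_apply_le ha ((fun _ => C * Real.exp ((a + 1) * (τ + r))) + ev k τ) i
      have h4 := (norm_add_le (fun _ : Fin m => C * Real.exp ((a + 1) * (τ + r))) (ev k τ)).trans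
        (add_le_add (norm_const_le (by positivity))
          ((hkh τ).trans (hh τ hτ1 (hτ.2.le.trans ht))))
      have h5 := mul_le_mul_of_nonneg_left h4 ha0.le
      linarith

lemma Quasipositive.dominating_leR (hA : Quasipositive A) {r : ℝ} (hr : 0 ≤ r) :
    Dominating (leR A r) := by
  obtain ⟨a, ha0, ha⟩ := exists_norm_mulVec_le A
  intro M hM
  set E := Real.exp ((a + 1) * r) with hE
  have hE0 : 0 < E := Real.exp_pos _
  refine ⟨((1 + a) + M) * E, by positivity, fun ε hε N₀ => ?_⟩
  obtain ⟨R, hR⟩ := exists_nat_ge r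
  -- On `[-N₀,0]` the amplitude is at most `(2 + a) * η` and the exponential at most `E`. The window
  -- `N₀ + R` contains both `[-N₀,0]` and `[-r,0]`.
  set η := min 1 (ε / ((2 + a) * E)) with hη
  have hη0 : 0 < η := lt_min one_pos (by positivity)
  refine ⟨η, hη0, N₀ + R, fun h hhM _ hsmall hlip => ?_⟩
  have hNr : -((N₀ + R : ℕ) : ℝ) ≤ -r := by
    push_cast
    linarith [Nat.cast_nonneg (α := ℝ) N₀]
  set f : ℝ → Fin m → ℝ := fun s _ =>
    ((1 + a) * η + ‖ev h (min s (-r))‖) * Real.exp ((a + 1) * max (s + r) 0) with hf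
  have hexp : ∀ s ≤ 0, Real.exp ((a + 1) * max (s + r) 0) ≤ E := fun s hs =>
    Real.exp_le_exp.2 (mul_le_mul_of_nonneg_left (max_le (by linarith) hr) (by linarith))
  have hfle : ∀ s ≤ 0, ∀ c, (1 + a) * η + ‖ev h (min s (-r))‖ ≤ c → ‖f s‖ ≤ c * E := by
    intro s hs c hc
    refine (norm_const_le (by positivity)).trans (mul_le_mul hc (hexp s hs) (Real.exp_pos _).le ?_)
    exact le_trans (by positivity) hc
  have hbound : ∀ s ≤ 0, ‖f s‖ ≤ ((1 + a) + M) * E := fun s hs => by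
    refine hfle s hs _ (add_le_add ?_ ((norm_ev_le h _).trans hhM))
    exact mul_le_of_le_one_right (by linarith) (min_le_left _ _)
  have huc : UniformContinuous fun s : Past => f s := by
    refine uniformContinuous_pi.2 fun _ => ?_
    have h1 : UniformContinuous fun s : ℝ =>
        (1 + a) * η + ‖ev h (min s (-r))‖ :=
      uniformContinuous_const.add (uniformContinuous_norm.comp
        ((uniformContinuous_ev h).comp (LipschitzWith.id.min_const (-r)).uniformContinuous))
    -- The exponential factor passes through `s ↦ max s (-r)`, with values in a compact interval.
    have h2 : UniformContinuous fun s : Icc (-r) 0 => Real.exp ((a + 1) * ((s : ℝ) + r)) := by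
      refine CompactSpace.uniformContinuous_of_continuous ?_
      fun_prop
    have h3 : UniformContinuous fun s : Past => Real.exp ((a + 1) * max ((s : ℝ) + r) 0) := by
      have h4 : UniformContinuous fun s : Past => (⟨max (s : ℝ) (-r), le_max_right _ _,
          max_le s.2 (by linarith)⟩ : Icc (-r) 0) := by
        apply UniformContinuous.subtype_mk
        exact (LipschitzWith.id.max_const (-r)).uniformContinuous.comp uniformContinuous_subtype_val
      have h5 : ∀ s : Past, max ((s : ℝ) + r) 0 = max (s : ℝ) (-r) + r := fun s => by
        rw [← max_add_add_right, neg_add_cancel]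
      simp only [h5]
      exact h2.comp h4
    rw [Metric.uniformContinuous_iff]
    intro δ hδ
    set c := (1 + a) + M with hc
    have hc0 : 0 < c := by positivity
    obtain ⟨δ₁, hδ₁, h5⟩ := Metric.uniformContinuous_iff.1 h1 (δ / (2 * E)) (by positivity)
    obtain ⟨δ₂, hδ₂, h6⟩ := Metric.uniformContinuous_iff.1 h3 (δ / (2 * c)) (by positivity)
    refine ⟨min δ₁ δ₂, lt_min hδ₁ hδ₂, fun s t hst => ?_⟩
    have h7 := h5 (a := (s : ℝ)) (b := (t : ℝ)) (lt_of_lt_of_le hst (min_le_left _ _))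
    have h8 := h6 (a := s) (b := t) (lt_of_lt_of_le hst (min_le_right _ _))
    rw [Real.dist_eq] at h7 h8 ⊢
    simp only [hf]
    set p := (1 + a) * η + ‖ev h (min (s : ℝ) (-r))‖
    set p' := (1 + a) * η + ‖ev h (min (t : ℝ) (-r))‖ with hp'
    set q := Real.exp ((a + 1) * max ((s : ℝ) + r) 0)
    set q' := Real.exp ((a + 1) * max ((t : ℝ) + r) 0)
    have hp'0 : 0 ≤ p' := by positivity
    have hp'c : p' ≤ c := add_le_add
      (mul_le_of_le_one_right (by linarith) (min_le_left _ _)) ((norm_ev_le h _).trans hhM)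
    have hq0 : 0 < q := Real.exp_pos _
    have hqE : q ≤ E := hexp s s.2
    have h9 : p * q - p' * q' = (p - p') * q + p' * (q - q') := by ring
    rw [h9]
    have h10 : |(p - p') * q| ≤ |p - p'| * E := by
      rw [abs_mul, abs_of_pos hq0]
      exact mul_le_mul_of_nonneg_left hqE (abs_nonneg _)
    have h11 : |p' * (q - q')| ≤ c * |q - q'| := by
      rw [abs_mul, abs_of_nonneg hp'0]
      exact mul_le_mul_of_nonneg_right hp'c (abs_nonneg _)
    have h12 : |p - p'| * E < δ / 2 := by
      rw [lt_div_iff₀ (by positivity)] at h7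
      linarith
    have h13 : c * |q - q'| < δ / 2 := by
      rw [lt_div_iff₀ (by positivity)] at h8
      linarith
    exact lt_of_le_of_lt (abs_add_le _ _) (by linarith)
  have hev : ∀ s ≤ 0, ev (mkBU f huc _ hbound) s = f s := fun s hs => ev_mkBU hs
  have hhsmall : ∀ s, -r ≤ s → s ≤ 0 → ‖ev h s‖ ≤ η := fun s hs hs0 =>
    hsmall s (hNr.trans hs) hs0
  refine ⟨mkBU f huc _ hbound, norm_le_of_ev (by positivity) fun s hs => ?_, fun s hs hs0 => ?_,
    ?_, ?_⟩
  · rw [hev s hs]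
    exact hbound s hs
  · rw [hev s hs0]
    have h1 : ‖ev h (min s (-r))‖ ≤ η := by
      refine hsmall _ (le_min ?_ hNr) ((min_le_left _ _).trans hs0)
      push_cast
      linarith [Nat.cast_nonneg (α := ℝ) R]
    refine (hfle s hs0 ((2 + a) * η) (by linarith)).trans ?_
    have h2 : η ≤ ε / ((2 + a) * E) := min_le_right _ _
    rw [le_div_iff₀ (by positivity)] at h2
    linarith
  · have h1 := hA.leR_of_formula ha0 ha hη0.le (h := h) (k := 0) hev
      (fun s => by rw [ev_zero, norm_zero]; exact norm_nonneg _) hhsmall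
      fun s s' _ h2 _ => by
        rw [ev_zero, ev_zero, sub_zero, norm_zero]
        exact mul_nonneg hη0.le (by linarith)
    rwa [add_zero] at h1
  · exact hA.leR_of_formula ha0 ha hη0.le (h := h) (k := h) hev (fun s => le_rfl) hhsmall
      fun s s' h1 h2 h3 => hlip s s' (hNr.trans h1) h2 h3

end Order

/-! ### Upper bounds for the order `≤_{A,∞}` -/

section OrderInfinity

open Matrix

variable {m : ℕ} {A : Matrix (Fin m) (Fin m) ℝ}

/-- A decreasing logistic function with values between `c` and `c + d`. -/
def logistic (c d κ N t : ℝ) : ℝ := c + d / (1 + Real.exp (κ * (t + N)))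

/-- The derivative of `logistic`. -/
def logisticDeriv (d κ N t : ℝ) : ℝ :=
  -(d * (Real.exp (κ * (t + N)) * κ)) / (1 + Real.exp (κ * (t + N))) ^ 2

lemma hasDerivAt_logistic (c d κ N t : ℝ) :
    HasDerivAt (logistic c d κ N) (logisticDeriv d κ N t) t := by
  have h0 : (1 + Real.exp (κ * (t + N))) ≠ 0 := by positivity
  have h1 : HasDerivAt (fun t => 1 + Real.exp (κ * (t + N)))
      (Real.exp (κ * (t + N)) * κ) t := by
    refine HasDerivAt.const_add 1 (HasDerivAt.exp ?_)
    simpa using ((hasDerivAt_id t).add_const N).const_mul κ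
  have h2 := ((hasDerivAt_const t d).div h1 h0).const_add c
  rwa [zero_mul, zero_sub] at h2

lemma logistic_ge {c d κ N : ℝ} (hd : 0 ≤ d) (t : ℝ) : c ≤ logistic c d κ N t :=
  le_add_of_nonneg_right (by positivity)

lemma logistic_ge_half {c d κ N : ℝ} (hd : 0 ≤ d) (hκ : 0 ≤ κ) {t : ℝ} (ht : t ≤ -N) :
    c + d / 2 ≤ logistic c d κ N t := by
  refine add_le_add le_rfl (div_le_div_of_nonneg_left hd (by positivity) ?_)
  have : Real.exp (κ * (t + N)) ≤ 1 :=
    Real.exp_le_one_iff.2 (mul_nonpos_of_nonneg_of_nonpos hκ (by linarith))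
  linarith

lemma logistic_le {c d κ N : ℝ} (hd : 0 ≤ d) (t : ℝ) : logistic c d κ N t ≤ c + d :=
  add_le_add le_rfl (div_le_self hd (by linarith [Real.exp_pos (κ * (t + N))]))

lemma logistic_le_exp {c d κ N N₀ : ℝ} (hd : 0 ≤ d) (hκ : 0 ≤ κ) {t : ℝ} (ht : -N₀ ≤ t) :
    logistic c d κ N t ≤ c + d * Real.exp (-(κ * (N - N₀))) := by
  refine add_le_add le_rfl ?_
  have h1 : Real.exp (κ * (N - N₀)) ≤ Real.exp (κ * (t + N)) :=
    Real.exp_le_exp.2 (mul_le_mul_of_nonneg_left (by linarith) hκ)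
  rw [Real.exp_neg, ← div_eq_mul_inv]
  exact div_le_div_of_nonneg_left hd (Real.exp_pos _) (by linarith)

/-- The relative rate of decrease is at most `κ`, so for small `κ` the slope of `φ p` stays above
half of `A(φ p) = -φ`. -/
lemma logisticDeriv_ge {c d κ N : ℝ} (hc : 0 ≤ c) (hd : 0 ≤ d) (hκ : 0 ≤ κ) (t : ℝ) :
    -(κ * logistic c d κ N t) ≤ logisticDeriv d κ N t := by
  rw [logistic, logisticDeriv]
  set E := Real.exp (κ * (t + N))
  have hE : 0 < E := Real.exp_pos _
  have h1 : d * (E * κ) / (1 + E) ^ 2 ≤ κ * (d / (1 + E)) := by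
    rw [mul_div_assoc', div_le_div_iff₀ (by positivity) (by positivity)]
    have h2 : 0 ≤ κ * d * (1 + E) := by positivity
    nlinarith
  have h2 : 0 ≤ κ * c := by positivity
  rw [neg_div, mul_add]
  linarith

lemma uniformContinuous_logistic {c d κ N : ℝ} (hκ : 0 < κ) (p : Fin m → ℝ) :
    UniformContinuous fun s : Past => logistic c d κ N s • p := by
  have hc : Continuous (logistic c d κ N) :=
    continuous_iff_continuousAt.2 fun t => (hasDerivAt_logistic c d κ N t).continuousAt
  have h1 : Tendsto (logistic c d κ N) atBot (𝓝 (c + d)) := by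
    have h2 : Tendsto (fun t : ℝ => Real.exp (κ * (t + N))) atBot (𝓝 0) :=
      Real.tendsto_exp_atBot.comp
        ((tendsto_atBot_add_const_right _ N tendsto_id).const_mul_atBot hκ)
    have h3 := (tendsto_const_nhds (x := d)).div (h2.const_add 1) (by norm_num)
    rw [add_zero, div_one] at h3
    exact h3.const_add c
  have h2 : Tendsto (fun t => logistic c d κ N t • p - (c + d) • p) atBot (𝓝 0) := by
    have h3 := (h1.smul_const p).sub_const ((c + d) • p)
    rwa [sub_self] at h3
  have h3 := (uniformContinuous_past_of_tendsto ((hc.smul continuous_const).sub continuous_const)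
    h2 0).add (uniformContinuous_const (b := (c + d) • p))
  simpa using h3

/-- With `w = φ p` and `b` the local bound on `k` and its slope, `φ ≥ D b`. Since `κ p ≤ 1/2`, the
slope of `w` is at least `-φ/2`, while `A(w + k) + b ≤ -φ + (1 + a) b ≤ -φ/2` because `D ≥ 2(1 +
a)`. The inequality `D q ≥ 1` gives `w ≥ |k|`. -/
lemma Quasipositive.leInf_of_formula (hA : Quasipositive A) {a : ℝ} (ha0 : 0 < a)
    (ha : ∀ v : Fin m → ℝ, ‖A *ᵥ v‖ ≤ a * ‖v‖) {p : Fin m → ℝ} {q κ : ℝ} (hq : 0 < q)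
    (hqp : ∀ i, q ≤ p i) (hAp : ∀ i, (A *ᵥ p) i = -1) (hκ : 0 ≤ κ) (hκp : ∀ i, κ * p i ≤ 1 / 2)
    {M η D N : ℝ} (hM : 0 ≤ M) (hη : 0 ≤ η) (hD : D = 2 * (1 + a) + 1 / q) {k w : BU m}
    (hw : ∀ s ≤ 0, ev w s = logistic (D * η) (2 * D * M) κ N s • p)
    (hkM : ‖k‖ ≤ M) (hkL : ∀ s s' : ℝ, s' ≤ s → s ≤ 0 → ‖ev k s - ev k s'‖ ≤ M * (s - s'))
    (hkη : ∀ s, -N ≤ s → s ≤ 0 → ‖ev k s‖ ≤ η)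
    (hkl : ∀ s s' : ℝ, -N ≤ s' → s' ≤ s → s ≤ 0 → ‖ev k s - ev k s'‖ ≤ η * (s - s')) :
    leInf A 0 (w + k) := by
  have hD0 : 0 < D := by rw [hD]; positivity
  have hDa : 2 * (1 + a) ≤ D := by rw [hD]; exact le_add_of_nonneg_right (by positivity)
  have hDq : 1 ≤ D * q := by
    rw [hD, add_mul, one_div, inv_mul_cancel₀ hq.ne']
    exact le_add_of_nonneg_left (by positivity)
  set φ := logistic (D * η) (2 * D * M) κ N with hφ
  have hDM : 0 ≤ 2 * D * M := by positivity
  have hDη : 0 ≤ D * η := by positivity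
  have hφη : ∀ t, D * η ≤ φ t := fun t => logistic_ge hDM t
  have hφM : ∀ t ≤ -N, D * M ≤ φ t := fun t ht => by
    have := logistic_ge_half (c := D * η) hDM hκ ht
    linarith
  -- The logistic step follows this jump: it is at least half its height for `t ≤ -N`, hence the
  -- factor `2` in `2 * D * M`.
  set b : ℝ → ℝ := fun t => if -N ≤ t then η else M with hb
  have hb0 : ∀ t, 0 ≤ b t := fun t => by
    simp only [hb]
    split_ifs <;> assumption
  have hφb : ∀ t, D * b t ≤ φ t := fun t => by
    simp only [hb]
    split_ifs with h
    · exact hφη t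
    · exact hφM t (not_le.1 h).le
  have hkb : ∀ t ≤ 0, ‖ev k t‖ ≤ b t := fun t ht => by
    simp only [hb]
    split_ifs with h
    · exact hkη t h ht
    · exact (norm_ev_le k t).trans hkM
  rw [leInf_iff]
  intro r _
  refine leR_zero (fun s hs => ?_) fun s t _ hst ht => ?_
  · rw [ev_add, hw s hs]
    refine nonneg_add_of_norm_le fun i => (hkb s hs).trans ?_
    rw [Pi.smul_apply, smul_eq_mul]
    calc b s ≤ b s * (D * q) := le_mul_of_one_le_right (hb0 s) hDq
      _ = D * b s * q := by ring
      _ ≤ φ s * p i := mul_le_mul (hφb s) (hqp i) hq.le (hDη.trans (hφη s))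
  · rw [ev_add, ev_add, hw s (hst.trans ht), hw t ht]
    refine hA.exp_mulVec_add_le (f := fun τ => φ τ • p)
      (f' := fun τ => logisticDeriv (2 * D * M) κ N τ • p) (l := b) hst
      (fun τ => (hasDerivAt_logistic _ _ κ N τ).smul_const p) (continuous_ev k)
      (fun τ hτ z hz => ?_) fun τ hτ i => ?_
    · simp only [hb]
      split_ifs with h
      · exact hkl z τ h hz.1.le (hz.2.trans ht)
      · exact hkL z τ hz.1.le (hz.2.trans ht)
    · rw [Matrix.mulVec_add, Matrix.mulVec_smul, Pi.add_apply, Pi.smul_apply, Pi.smul_apply, hAp,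
        smul_eq_mul, smul_eq_mul]
      have hpi : 0 < p i := hq.trans_le (hqp i)
      have h1 := mulVec_apply_le ha (ev k τ) i
      have h2 := mul_le_mul_of_nonneg_left (hkb τ (hτ.2.le.trans ht)) ha0.le
      have h3 := mul_le_mul_of_nonneg_right (logisticDeriv_ge (N := N) hDη hDM hκ τ) hpi.le
      have h4 := mul_le_mul_of_nonneg_left (hκp i) (hDη.trans (hφη τ))
      have h5 := mul_le_mul_of_nonneg_right hDa (hb0 τ)
      have h6 := hφb τ
      rw [← hφ] at h3
      linarith

lemma Quasipositive.dominating_leInf (hA : Quasipositive A) (hE : EigenvaluesNeg A) :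
    Dominating (leInf A) := by
  obtain ⟨a, ha0, ha⟩ := exists_norm_mulVec_le A
  obtain ⟨p, q, hq, hqp, hAp⟩ := hA.exists_pos hE
  intro M hM
  obtain ⟨D, hD⟩ : ∃ D, D = 2 * (1 + a) + 1 / q := ⟨_, rfl⟩
  have hD0 : 0 < D := by rw [hD]; positivity
  set P := ‖p‖ + 1 with hP
  have hP0 : 0 < P := by positivity
  set κ := 1 / (2 * P) with hκ
  have hκ0 : 0 < κ := by positivity
  have hκp : ∀ i, κ * p i ≤ 1 / 2 := fun i => by
    have h1 : p i ≤ P := ((le_abs_self _).trans (norm_le_pi_norm p i)).trans (by linarith)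
    calc κ * p i ≤ κ * P := mul_le_mul_of_nonneg_left h1 hκ0.le
      _ = 1 / 2 := by rw [hκ]; field_simp
  refine ⟨(D + 2 * D * M) * P, by positivity, fun ε hε N₀ => ?_⟩
  set η := min 1 (ε / (2 * D * P)) with hη
  have hη0 : 0 < η := lt_min one_pos (by positivity)
  have hη1 : D * η * P ≤ ε / 2 := by
    have h1 : η ≤ ε / (2 * D * P) := min_le_right _ _
    rw [le_div_iff₀ (by positivity)] at h1
    linarith
  -- The step is centred at `-N`, so far back that it has nearly finished descending at `-N₀`.
  obtain ⟨N, hN⟩ : ∃ N : ℕ, 2 * D * M * Real.exp (-(κ * (N - N₀))) * P ≤ ε / 2 := by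
    have h1 : Tendsto (fun N : ℕ => 2 * D * M * Real.exp (-(κ * ((N : ℝ) - N₀))) * P) atTop
        (𝓝 (2 * D * M * 0 * P)) := by
      refine Tendsto.mul_const _ (Tendsto.const_mul _ (Real.tendsto_exp_neg_atTop_nhds_zero.comp ?_))
      exact (tendsto_atTop_add_const_right _ _ tendsto_natCast_atTop_atTop).const_mul_atTop hκ0
    rw [mul_zero, zero_mul] at h1
    obtain ⟨N, hN⟩ := (h1.eventually (gt_mem_nhds (show 0 < ε / 2 by linarith))).exists
    exact ⟨N, hN.le⟩
  refine ⟨η, hη0, N, fun h hhM hlipM hsmall hlip => ?_⟩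
  have hDM : 0 ≤ 2 * D * M := by positivity
  have hnorm : ∀ s c, logistic (D * η) (2 * D * M) κ N s ≤ c →
      ‖logistic (D * η) (2 * D * M) κ N s • p‖ ≤ c * P := fun s c hc => by
    have h0 : 0 ≤ logistic (D * η) (2 * D * M) κ N s :=
      (show 0 ≤ D * η by positivity).trans (logistic_ge hDM s)
    rw [norm_smul, Real.norm_of_nonneg h0]
    exact mul_le_mul hc (by linarith) (norm_nonneg p) (h0.trans hc)
  have hbound : ∀ s ≤ 0, ‖logistic (D * η) (2 * D * M) κ N s • p‖ ≤ (D + 2 * D * M) * P :=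
    fun s _ => by
      refine hnorm s _ ((logistic_le hDM s).trans (add_le_add ?_ le_rfl))
      exact mul_le_of_le_one_right hD0.le (min_le_left _ _)
  have hev : ∀ s ≤ 0, ev (mkBU (fun s => logistic (D * η) (2 * D * M) κ N s • p)
      (uniformContinuous_logistic hκ0 p) _ hbound) s = logistic (D * η) (2 * D * M) κ N s • p :=
    fun s hs => ev_mkBU hs
  refine ⟨mkBU (fun s => logistic (D * η) (2 * D * M) κ N s • p)
    (uniformContinuous_logistic hκ0 p) _ hbound,
    norm_le_of_ev (by positivity) fun s hs => ?_, fun s hs hs0 => ?_, ?_, ?_⟩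
  · rw [hev s hs]
    exact hbound s hs
  · rw [hev s hs0]
    refine (hnorm s _ (logistic_le_exp hDM hκ0.le hs)).trans ?_
    linarith
  · have h1 := hA.leInf_of_formula ha0 ha hq hqp hAp hκ0.le hκp hM.le hη0.le hD (k := 0) hev
      (BU_norm_zero.trans_le hM.le)
      (fun s s' h2 _ => by
        rw [ev_zero, ev_zero, sub_zero, norm_zero]
        exact mul_nonneg hM.le (by linarith))
      (fun s _ _ => by rw [ev_zero, norm_zero]; exact hη0.le)
      fun s s' _ h2 _ => by
        rw [ev_zero, ev_zero, sub_zero, norm_zero]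
        exact mul_nonneg hη0.le (by linarith)
    rwa [add_zero] at h1
  · exact hA.leInf_of_formula ha0 ha hq hqp hAp hκ0.le hκp hM.le hη0.le hD (k := h) hev
      hhM hlipM hsmall hlip

end OrderInfinity

/-! ### Uniform stability of the omega-limit set -/

section Stability

variable {Ω : Type*} [MetricSpace Ω] {m : ℕ} {σ : Flow ℝ Ω}
  {ν : Fin m → Fin m → FiniteMeasure Past} {F : Ω → BU m → Fin m → ℝ}
  {ω₀ : Ω} {U : ℝ → BU m} {k : ℝ}

/-- Both functions are, on their own past, solutions along the same base orbit, so the integrated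
equations can be subtracted. -/
lemma IsOrbit.norm_neutralOp_sub_le (h : IsOrbit σ ν F ω₀ U k) (hF1 : HypF1 F) (hF2 : HypF2 F)
    (hF3 : HypF3 F) {ω : Ω} {x y : BU m} (hx : (ω, x) ∈ omegaSet σ ω₀ U)
    (hy : (ω, y) ∈ omegaSet σ ω₀ U) {b c d : ℝ} (hb : 0 ≤ b) (hbc : b ≤ c)
    (hd : ∀ s ∈ Icc b c, ‖F (σ (-s) ω) (shift s x) - F (σ (-s) ω) (shift s y)‖ ≤ d) :
    ‖neutralOp ν (shift b (x - y)) - neutralOp ν (shift c (x - y))‖ ≤ d * (c - b) := by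
  have hc : 0 ≤ c := hb.trans hbc
  have h1 := (h.backward hF1 hF2 hF3 hx hc).2.integral_eq hF1.1 le_rfl
    (show 0 ≤ c - b by linarith) (by linarith)
  have h2 := (h.backward hF1 hF2 hF3 hy hc).2.integral_eq hF1.1 le_rfl
    (show 0 ≤ c - b by linarith) (by linarith)
  rw [sub_sub_cancel, sub_zero] at h1 h2
  have h3 : neutralOp ν (shift b (x - y)) - neutralOp ν (shift c (x - y)) =
      ∫ s in (0 : ℝ)..(c - b), (F (σ s (σ (-c) ω)) (shift (c - s) x)
        - F (σ s (σ (-c) ω)) (shift (c - s) y)) := by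
    rw [intervalIntegral.integral_sub ((continuous_rhs hF1.1 c _ x).intervalIntegrable _ _)
      ((continuous_rhs hF1.1 c _ y).intervalIntegrable _ _), h1, h2, shift_sub, shift_sub,
      neutralOp_sub, neutralOp_sub]
    abel
  rw [h3]
  refine (intervalIntegral.norm_integral_le_of_norm_le_const (C := d) fun s hs => ?_).trans
    (le_of_eq ?_)
  · rw [uIoc_of_le (by linarith)] at hs
    have h4 := hd (c - s) ⟨by linarith [hs.2], by linarith [hs.1]⟩
    rwa [show -(c - s) = s + -c by ring, Flow.map_add] at h4
  · rw [sub_zero, abs_of_nonneg (by linarith)]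

lemma IsOrbit.norm_neutralOp_increment_le (h : IsOrbit σ ν F ω₀ U k) (hF1 : HypF1 F)
    (hF2 : HypF2 F) (hF3 : HypF3 F) {ω : Ω} {x y : BU m} (hx : (ω, x) ∈ omegaSet σ ω₀ U)
    (hy : (ω, y) ∈ omegaSet σ ω₀ U) {a b d : ℝ} (ha : 0 ≤ a) (hb : 0 ≤ b)
    (hd : ∀ s ∈ Icc b (b + a), ‖F (σ (-s) ω) (shift s x) - F (σ (-s) ω) (shift s y)‖ ≤ d) :
    ‖neutralOp ν (shift b ((x - y) - shift a (x - y)))‖ ≤ d * a := by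
  have h1 := h.norm_neutralOp_sub_le hF1 hF2 hF3 hx hy hb (by linarith) hd
  rwa [add_sub_cancel_left, ← shift_shift hb ha, ← neutralOp_sub, ← shift_sub] at h1

/-- `StableOp.estimate` with `η = 1/2`, applied to an increment at every point of the past: the term
`‖e‖ / 2` is absorbed, and boundedness of `F` makes the rest proportional to `a`. -/
lemma IsOrbit.exists_lipschitz (h : IsOrbit σ ν F ω₀ U k) (hγ : ∃ γ, HalfWeight ν γ)
    (hst : StableOp ν) (hF1 : HypF1 F) (hF2 : HypF2 F) (hF3 : HypF3 F) :
    ∃ M : ℝ, 0 ≤ M ∧ ∀ (ω : Ω) (x y : BU m), (ω, x) ∈ omegaSet σ ω₀ U →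
      (ω, y) ∈ omegaSet σ ω₀ U → ∀ a : ℝ, 0 ≤ a → ‖(x - y) - shift a (x - y)‖ ≤ M * a := by
  obtain ⟨C, hC⟩ := hF2 k h.pos
  obtain ⟨T, C₀, hT, hC₀, hest⟩ := hst.estimate hγ (show (0 : ℝ) < 1 / 2 by norm_num)
  refine ⟨2 * (C₀ * (2 * |C|)), by positivity, fun ω x y hx hy a ha => ?_⟩
  have hxk : ‖x‖ ≤ k := h.norm_le (p := (ω, x)) hx
  have hyk : ‖y‖ ≤ k := h.norm_le (p := (ω, y)) hy
  set e := (x - y) - shift a (x - y) with he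
  have hF : ∀ s, ‖F (σ (-s) ω) (shift s x) - F (σ (-s) ω) (shift s y)‖ ≤ 2 * |C| := fun s => by
    have h1 := hC (σ (-s) ω) (shift s x) ((norm_shift_le _ _).trans hxk)
    have h2 := hC (σ (-s) ω) (shift s y) ((norm_shift_le _ _).trans hyk)
    have h3 := norm_sub_le (F (σ (-s) ω) (shift s x)) (F (σ (-s) ω) (shift s y))
    linarith [le_abs_self C]
  have h1 : ‖e‖ ≤ 1 / 2 * ‖e‖ + C₀ * (2 * |C| * a) := by
    have he0 := BU_norm_nonneg e
    refine norm_le_of_ev (by positivity) fun s hs => ?_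
    have h2 := hest (shift (-s) e) (2 * |C| * a) fun b hb => ?_
    · rw [ev_shift_zero (by linarith), neg_neg] at h2
      linarith [norm_shift_le (-s) e]
    · rw [shift_shift hb.1 (by linarith)]
      exact h.norm_neutralOp_increment_le hF1 hF2 hF3 hx hy ha (by linarith [hb.1])
        fun s _ => hF s
  linarith

/-- By contradiction, with compactness of the omega-limit set and (F3). Shifts by at most `R` keep
nearby functions near on compact intervals, so both shifted sequences have the same limit. -/
lemma IsOrbit.exists_rhs_close [CompactSpace Ω] (h : IsOrbit σ ν F ω₀ U k) (hF1 : HypF1 F)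
    (hF2 : HypF2 F) (hF3 : HypF3 F) {d : ℝ} (hd : 0 < d) (R : ℝ) :
    ∃ δ : ℝ, 0 < δ ∧ ∀ (ω : Ω) (x y : BU m), (ω, x) ∈ omegaSet σ ω₀ U →
      (ω, y) ∈ omegaSet σ ω₀ U → di x y < δ → ∀ s ∈ Icc 0 R,
        ‖F (σ (-s) ω) (shift s x) - F (σ (-s) ω) (shift s y)‖ ≤ d := by
  by_contra! hcon
  choose ωn xn yn hx hy hxy sn hsn hn using fun n : ℕ => hcon (1 / ((n : ℝ) + 1)) (by positivity)
  obtain ⟨φ, hφ, p, hp, hp1, hp2⟩ := h.exists_subseq_omegaSet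
    fun n => (h.backward hF1 hF2 hF3 (hx n) (hsn n).1).1
  simp only at hp1 hp2
  have hdi : Tendsto (fun n => di (xn (φ n)) (yn (φ n))) atTop (𝓝 0) :=
    squeeze_zero (fun _ => di_nonneg _ _) (fun n => (hxy (φ n)).le)
      (tendsto_one_div_add_atTop_nhds_zero_nat.comp hφ.tendsto_atTop)
  have hp3 : Tendsto (fun n => toX (shift (sn (φ n)) (yn (φ n)))) atTop (𝓝 (toX p.2)) := by
    rw [tendsto_toX_iff] at hp2 ⊢
    intro N ε hε
    obtain ⟨R', hR'⟩ := exists_nat_ge R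
    obtain ⟨δ, hδ, hclose⟩ := exists_le_of_di (m := m) (N + R') (ε / 2) (by linarith)
    filter_upwards [hp2 N (ε / 2) (by linarith), hdi.eventually (gt_mem_nhds hδ)]
      with n h1 h2 s hs hs0
    have h3 := h1 s hs hs0
    have h4 := (hsn (φ n))
    have h5 := hclose _ _ h2.le (s - sn (φ n)) (by push_cast; linarith [h4.2])
      (by linarith [h4.1])
    rw [ev_shift h4.1 _ hs0] at h3 ⊢
    rw [norm_sub_rev] at h5
    have h6 := norm_sub_le_norm_sub_add_norm_sub (ev (yn (φ n)) (s - sn (φ n)))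
      (ev (xn (φ n)) (s - sn (φ n))) (ev p.2 s)
    linarith
  have hk : ∀ n, shift (sn (φ n)) (xn (φ n)) ∈ B m k := fun n =>
    (norm_shift_le _ _).trans (h.norm_le (p := (_, xn (φ n))) (hx (φ n)))
  have hk' : ∀ n, shift (sn (φ n)) (yn (φ n)) ∈ B m k := fun n =>
    (norm_shift_le _ _).trans (h.norm_le (p := (_, yn (φ n))) (hy (φ n)))
  have h1 := hF3 k h.pos _ _ _ _ hk (h.norm_le hp) hp1 hp2
  have h2 := hF3 k h.pos _ _ _ _ hk' (h.norm_le hp) hp1 hp3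
  have h3 := (h1.sub h2).norm
  rw [sub_self, norm_zero] at h3
  exact absurd (ge_of_tendsto' h3 fun n => (hn (φ n)).le) (by linarith)

/-- The remote past contributes a small multiple of the global Lipschitz constant; the window of
length `N + T` contributes a small difference of `F`. Each is at most half of `η`. -/
lemma IsOrbit.exists_small_lipschitz [CompactSpace Ω] (h : IsOrbit σ ν F ω₀ U k)
    (hγ : ∃ γ, HalfWeight ν γ) (hst : StableOp ν) (hF1 : HypF1 F) (hF2 : HypF2 F) (hF3 : HypF3 F)
    {η : ℝ} (hη : 0 < η) (N : ℕ) :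
    ∃ δ : ℝ, 0 < δ ∧ ∀ (ω : Ω) (x y : BU m), (ω, x) ∈ omegaSet σ ω₀ U →
      (ω, y) ∈ omegaSet σ ω₀ U → di x y < δ → ∀ s s' : ℝ, -(N : ℝ) ≤ s' → s' ≤ s → s ≤ 0 →
        ‖ev (x - y) s - ev (x - y) s'‖ ≤ η * (s - s') := by
  obtain ⟨M, hM, hlip⟩ := h.exists_lipschitz hγ hst hF1 hF2 hF3
  obtain ⟨T, C, hT, hC, hest⟩ := hst.estimate hγ (show 0 < η / (2 * (M + 1)) by positivity)
  obtain ⟨δ, hδ, hclose⟩ := h.exists_rhs_close hF1 hF2 hF3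
    (show 0 < η / (2 * (C + 1)) by positivity) (N + T)
  refine ⟨δ, hδ, fun ω x y hx hy hxy s s' hs' hss' hs => ?_⟩
  set a := s - s' with ha
  have ha0 : 0 ≤ a := by linarith
  set e := (x - y) - shift a (x - y) with he
  have h1 := hest (shift (-s) e) (η / (2 * (C + 1)) * a) fun b hb => ?_
  · rw [ev_shift_zero (by linarith), neg_neg, he, ev_sub, ev_shift ha0 _ hs, ha,
      sub_sub_cancel] at h1
    refine h1.trans ?_
    have h2 : ‖shift (-s) ((x - y) - shift (s - s') (x - y))‖ ≤ M * a :=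
      (norm_shift_le _ _).trans (hlip ω x y hx hy a ha0)
    have h3 : η / (2 * (M + 1)) * ‖shift (-s) ((x - y) - shift (s - s') (x - y))‖
        ≤ η / (2 * (M + 1)) * (M * a) := mul_le_mul_of_nonneg_left h2 (by positivity)
    have h4 : η / (2 * (M + 1)) * M ≤ η / 2 := by
      rw [div_mul_eq_mul_div, div_le_div_iff₀ (by positivity) (by positivity)]
      nlinarith
    have h5 : C * (η / (2 * (C + 1))) ≤ η / 2 := by
      rw [mul_div_assoc', div_le_div_iff₀ (by positivity) (by positivity)]
      nlinarith
    have h6 := mul_le_mul_of_nonneg_right h4 ha0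
    have h7 := mul_le_mul_of_nonneg_right h5 ha0
    rw [← ha] at h3 ⊢
    linarith
  · rw [shift_shift hb.1 (by linarith)]
    refine h.norm_neutralOp_increment_le hF1 hF2 hF3 hx hy ha0 (by linarith [hb.1]) fun q hq => ?_
    exact hclose ω x y hx hy hxy q ⟨by linarith [hq.1, hb.1], by linarith [hq.2, hb.2]⟩

lemma IsOrbit.uniformlyStable [CompactSpace Ω] {le : BU m → BU m → Prop}
    (hle : ∀ a b c d : BU m, b - a = d - c → le a b → le c d) (hdom : Dominating le)
    (hγ : ∃ γ, HalfWeight ν γ) (hst : StableOp ν) (hF1 : HypF1 F) (hF2 : HypF2 F) (hF3 : HypF3 F)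
    {x₀ : BU m} (h : IsOrbit σ ν F ω₀ (fun t => u σ ν F t ω₀ x₀) k)
    (hstab : OrbitStableForOrder σ ν F le ω₀ x₀) {ε : ℝ} (hε : 0 < ε) :
    ∃ δ : ℝ, 0 < δ ∧ ∀ (ω : Ω) (x y : BU m),
      (ω, x) ∈ omegaSet σ ω₀ (fun t => u σ ν F t ω₀ x₀) →
      (ω, y) ∈ omegaSet σ ω₀ (fun t => u σ ν F t ω₀ x₀) → di x y < δ →
      ∀ t : ℝ, 0 ≤ t → di (u σ ν F t ω x) (u σ ν F t ω y) ≤ ε := by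
  have hk := h.pos
  obtain ⟨M₀, hM₀, hlip⟩ := h.exists_lipschitz hγ hst hF1 hF2 hF3
  -- One constant serves both as a bound for `x - y`, at most `2k`, and as its Lipschitz constant,
  -- at most `M₀`.
  obtain ⟨K, hK, hdomK⟩ := hdom (M₀ + 2 * k) (by positivity)
  obtain ⟨δ₁, hδ₁, h₁⟩ := h.stable_omegaSet hle hγ hF1 hF2 hF3 hstab
    (show 0 < k + K by positivity) (show 0 < ε / 2 by linarith)
  obtain ⟨N₀, ε₁, hε₁, hdi⟩ := exists_di_le (m := m) (δ₁ / 3) (by linarith)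
  obtain ⟨η, hη, N, hdomN⟩ := hdomK ε₁ hε₁ N₀
  obtain ⟨δ₂, hδ₂, h₂⟩ := h.exists_small_lipschitz hγ hst hF1 hF2 hF3 hη N
  obtain ⟨δ₃, hδ₃, h₃⟩ := exists_le_of_di (m := m) N η hη
  refine ⟨min (δ₁ / 3) (min δ₂ δ₃), lt_min (by linarith) (lt_min hδ₂ hδ₃),
    fun ω x y hx hy hxy t ht => ?_⟩
  have hxy₁ : di x y < δ₁ / 3 := hxy.trans_le (min_le_left _ _)
  have hxy₂ : di x y < δ₂ := hxy.trans_le ((min_le_right _ _).trans (min_le_left _ _))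
  have hxy₃ : di x y < δ₃ := hxy.trans_le ((min_le_right _ _).trans (min_le_right _ _))
  have hxk : ‖x‖ ≤ k := h.norm_le (p := (ω, x)) hx
  have hyk : ‖y‖ ≤ k := h.norm_le (p := (ω, y)) hy
  obtain ⟨w, hwK, hwε, hw0, hwh⟩ := hdomN (x - y)
    ((BU_norm_sub_le x y).trans (by linarith))
    (fun s s' hss' hs => by
      have h4 := (norm_ev_le _ s).trans (hlip ω x y hx hy (s - s') (by linarith))
      rw [ev_sub, ev_shift (by linarith) _ hs, sub_sub_cancel] at h4
      have h5 : 0 ≤ 2 * k * (s - s') := mul_nonneg (by linarith) (by linarith)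
      linarith)
    (fun s hs hs0 => h₃ x y hxy₃.le s hs hs0) (h₂ ω x y hx hy hxy₂)
  -- The point `x + w` is above `x` as `0 ≤ w`, and above `y` as `0 ≤ w + (x - y)`. Its distances
  -- are at most `δ₁/3` from `x` and less than `2δ₁/3` from `y`.
  have hzB : x + w ∈ B m (k + K) := (BU_norm_add_le x w).trans (by linarith)
  have hxz : di x (x + w) ≤ δ₁ / 3 := hdi _ _ fun s hs hs0 => by
    rw [ev_add, sub_add_cancel_left, norm_neg]
    exact hwε s hs hs0
  have hyz : di y (x + w) < δ₁ := by
    have h4 := di_triangle y x (x + w)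
    rw [di_comm y x] at h4
    linarith
  have h4 := (h₁ ω x (x + w) hx hzB (by linarith)
    (Or.inl (hle 0 w x (x + w) (by abel) hw0)) t ht).2
  have h5 := (h₁ ω y (x + w) hy hzB hyz
    (Or.inl (hle 0 (w + (x - y)) y (x + w) (by abel) hwh)) t ht).2
  have h6 := di_triangle (u σ ν F t ω x) (u σ ν F t ω (x + w)) (u σ ν F t ω y)
  rw [di_comm (u σ ν F t ω (x + w))] at h6
  linarith

lemma AdmissibleCase.properties {A : Matrix (Fin m) (Fin m) ℝ} (hA : Quasipositive A)
    {le : BU m → BU m → Prop} (h : AdmissibleCase A ν le) :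
    (∀ a b c d : BU m, b - a = d - c → le a b → le c d) ∧ Dominating le ∧ StableOp ν := by
  rcases h with ⟨hν, r, hr, rfl⟩ | ⟨hν, hE, rfl⟩ | ⟨hst, hE, rfl⟩
  · exact ⟨fun _ _ _ _ => leR_of_sub_eq, hA.dominating_leR hr, stableOp_of_eq_zero hν⟩
  · exact ⟨fun _ _ _ _ => leInf_of_sub_eq, hA.dominating_leInf hE, stableOp_of_eq_zero hν⟩
  · exact ⟨fun _ _ _ _ => leInf_of_sub_eq, hA.dominating_leInf hE, hst⟩

end Stability

end ExpOrdering

end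

theorem mainTheorem6 {Ω : Type*} [MetricSpace Ω] [CompactSpace Ω] (σ : Flow ℝ Ω)
    (hσ : ExpOrdering.IsMinimalFlow σ) (m : ℕ)
    (A : Matrix (Fin m) (Fin m) ℝ) (hA : ExpOrdering.Quasipositive A)
    (ν : Fin m → Fin m → FiniteMeasure ExpOrdering.Past)
    (hν : ∀ i j, (ν i j : Measure ExpOrdering.Past) {ExpOrdering.now} = 0)
    (le : ExpOrdering.BU m → ExpOrdering.BU m → Prop)
    (hcase : ExpOrdering.AdmissibleCase A ν le)
    (F : Ω → ExpOrdering.BU m → Fin m → ℝ)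
    (hF1 : ExpOrdering.HypF1 F) (hF2 : ExpOrdering.HypF2 F) (hF3 : ExpOrdering.HypF3 F)
    (hF4 : ExpOrdering.HypF4 A ν le F)
    (ω₀ : Ω) (x₀ : ExpOrdering.BU m)
    (hcomp : ExpOrdering.RelativelyCompactOrbit σ ν F ω₀ x₀)
    (hstab : ExpOrdering.OrbitStableForOrder σ ν F le ω₀ x₀) :
    ExpOrdering.SetStableForOrder σ ν F le (ExpOrdering.omegaLimitSet σ ν F ω₀ x₀) ∧
      ExpOrdering.UniformlyStable σ ν F (ExpOrdering.omegaLimitSet σ ν F ω₀ x₀) := by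
  obtain ⟨hle, hdom, hst⟩ := hcase.properties hA
  have hγ := ExpOrdering.exists_halfWeight hν
  obtain ⟨k, h⟩ := ExpOrdering.isOrbit_u hγ hF1 hcomp
  have hinv := h.positivelyInvariant hγ hF1 hF2 hF3
  exact ⟨⟨hinv, fun _ hk _ hε => h.stable_omegaSet hle hγ hF1 hF2 hF3 hstab hk hε⟩,
    h.isCompact_omegaSet, hinv,
    fun _ hε => h.uniformlyStable hle hdom hγ hst hF1 hF2 hF3 hstab hε⟩
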